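/- Let $d\ge 1$, $\alpha\in(0,1)$, $0<T<\infty$, $\mathbb T^d=\mathbb R^d/\mathbb Z^d$, and identify functions on $\mathbb T^d$ with $\mathbb Z^d$-periodic functions on $\mathbb R^d$. Let $H:[0,T]\times\mathbb T^d\times\mathbb R\times\mathbb R^d\to\mathbb R$ and $u_0:\mathbb T^d\to\mathbb R$ satisfy: (A1) $H$ is continuous; (A2) there is a modulus $\omega:[0,\infty)\to[0,\infty)$ (that is, $\omega(0)=0$ and $\omega(s)\to0$ as $s\downarrow0$) such that $|H(t,x,r,p)-H(t,y,r,p)|\le\omega(|x-y|(1+|p|))$ for all $t\in[0,T]$, $x,y\in\mathbb R^d$, $r\in\mathbb R$, $p\in\mathbb R^d$; (A3) $r\mapsto H(t,x,r,p)$ is nondecreasing for all $(t,x,p)\in[0,T]\times\mathbb T^d\times\mathbb R^d$; (A4) $u_0$ is continuous. Then the initial value problem for the Hamilton--Jacobi equation with Caputo time derivative $$\partial_t^\alpha u+H(t,x,u,Du)=0\ \text{ in }(0,T]\times\mathbb T^d,\qquad u(0,\cdot)=u_0\ \text{ on }\mathbb T^d,$$ has exactly one viscosity solution $u\in C([0,T]\times\mathbb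 T^d)$. Here viscosity solutions are understood as follows. For $f:[0,T]\to\mathbb R$ and $t\in(0,T]$ put $$J_r[f](t)=\frac{\alpha}{\Gamma(1-\alpha)}\int_0^r\frac{f(t)-f(t-\tau)}{\tau^{\alpha+1}}\,d\tau,\qquad K_r[f](t)=\frac{f(t)-f(0)}{t^\alpha\Gamma(1-\alpha)}+\frac{\alpha}{\Gamma(1-\alpha)}\int_r^t\frac{f(t)-f(t-\tau)}{\tau^{\alpha+1}}\,d\tau ,$$ and for functions of $(t,x)$ apply these operators in $t$ with $x$ fixed. Let $\mathcal C^1([0,T]\times\mathbb R^d)$ be the set of $\phi\in C([0,T]\times\mathbb R^d)\cap C^1((0,T]\times\mathbb R^d)$ with $\partial_t\phi(\cdot,x)\in L^1(0,T)$ for every $x\in\mathbb R^d$. An upper (resp. lower) semicontinuous $u:[0,T]\times\mathbb T^d\to\mathbb R$ is a viscosity subsolution (resp. supersolution) of the equation if for all $0\le a<b\le T$, every open ball $B\subset\mathbb R^d$, every $\phi\in\mathcal C^1([0,T]\times\mathbb R^d)$ and every $(\hat t,\hat x)\in(a,b]\times B$ at which $u-\phi$ attains its maximum (resp. minimum) over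 $[a,b]\times\overline B$, $$J_{\hat t-a}[\phi](\hat t,\hat x)+K_{\hat t-a}[u](\hat t,\hat x)+H(\hat t,\hat x,u(\hat t,\hat x),D\phi(\hat t,\hat x))\le0\quad(\text{resp. }\ge0).$$ A function $u\in C([0,T]\times\mathbb T^d)$ is a viscosity solution of the initial value problem if it is both a subsolution and a supersolution and $u(0,\cdot)=u_0$. -/

import Mathlib

open MeasureTheory Set Filter Topology

noncomputable section

/-- A function on `ℝ^d` that is `ℤ^d`-periodic, i.e. a function on the torus `𝕋^d = ℝ^d / ℤ^d`. -/
def ZPeriodic {d : ℕ} (f : EuclideanSpace ℝ (Fin d) → ℝ) : Prop :=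
  ∀ (x : EuclideanSpace ℝ (Fin d)) (z : Fin d → ℤ),
    f (x + WithLp.toLp 2 (fun i => (z i : ℝ))) = f x

/-- A modulus: a function `ω : [0,∞) → [0,∞)` with `ω(0) = 0` that is continuous at `0`.
Only the values of `ω` on `[0,∞)` matter. -/
def IsModulus (ω : ℝ → ℝ) : Prop :=
  (∀ s, 0 ≤ s → 0 ≤ ω s) ∧ ω 0 = 0 ∧ Tendsto ω (𝓝[≥] 0) (𝓝 0)

/-- `J_r[f](t) = α / Γ(1-α) ∫₀^r (f(t) - f(t-τ)) τ^(-α-1) dτ`. -/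
def fracJ (α r : ℝ) (f : ℝ → ℝ) (t : ℝ) : ℝ :=
  α / Real.Gamma (1 - α) * ∫ τ in Ioc 0 r, (f t - f (t - τ)) / τ ^ (α + 1)

/-- `K_r[f](t) = (f(t) - f(0)) / (t^α Γ(1-α)) + α / Γ(1-α) ∫_r^t (f(t) - f(t-τ)) τ^(-α-1) dτ`. -/
def fracK (α r : ℝ) (f : ℝ → ℝ) (t : ℝ) : ℝ :=
  (f t - f 0) / (t ^ α * Real.Gamma (1 - α)) +
    α / Real.Gamma (1 - α) * ∫ τ in Ioc r t, (f t - f (t - τ)) / τ ^ (α + 1)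

/-- `K_r[f](t)` exists as a finite number. -/
def FracKExists (α r : ℝ) (f : ℝ → ℝ) (t : ℝ) : Prop :=
  IntegrableOn (fun τ => (f t - f (t - τ)) / τ ^ (α + 1)) (Ioc r t)

/-- The class `𝓒¹([0,T] × ℝ^d)` of test functions: continuous on `[0,T] × ℝ^d`, of class `C¹` on
`(0,T] × ℝ^d` (one-sided in time at `t = T`), and with `∂_t φ(·,x) ∈ L¹(0,T)` for every `x`. -/
def IsTestFunction {d : ℕ} (T : ℝ) (φ : ℝ → EuclideanSpace ℝ (Fin d) → ℝ) : Prop :=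
  ContinuousOn (fun q : ℝ × EuclideanSpace ℝ (Fin d) => φ q.1 q.2) (Icc 0 T ×ˢ univ) ∧
  ContDiffOn ℝ 1 (fun q : ℝ × EuclideanSpace ℝ (Fin d) => φ q.1 q.2) (Ioc 0 T ×ˢ univ) ∧
  ∀ x, IntegrableOn (fun t => deriv (fun s => φ s x) t) (Ioo 0 T)

/-- Viscosity subsolutions `u ∈ USC([0,T] × 𝕋^d)` of `∂_t^α u + H(t,x,u,Du) = 0` in
`(0,T] × 𝕋^d`. The integral in `K` lies in `(-∞,∞]`, so the inequality includes its finiteness;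
the integral in `J` converges absolutely for every test function. -/
def IsViscositySubsolution {d : ℕ} (α T : ℝ)
    (H : ℝ → EuclideanSpace ℝ (Fin d) → ℝ → EuclideanSpace ℝ (Fin d) → ℝ)
    (u : ℝ → EuclideanSpace ℝ (Fin d) → ℝ) : Prop :=
  (∀ t ∈ Icc 0 T, ZPeriodic (u t)) ∧
  UpperSemicontinuousOn (fun q : ℝ × EuclideanSpace ℝ (Fin d) => u q.1 q.2) (Icc 0 T ×ˢ univ) ∧
  ∀ (a b : ℝ), 0 ≤ a → a < b → b ≤ T →
  ∀ (c : EuclideanSpace ℝ (Fin d)) (ρ : ℝ), 0 < ρ →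
  ∀ φ : ℝ → EuclideanSpace ℝ (Fin d) → ℝ, IsTestFunction T φ →
  ∀ t' ∈ Ioc a b, ∀ x' ∈ Metric.ball c ρ,
    (∀ t ∈ Icc a b, ∀ x ∈ Metric.closedBall c ρ, u t x - φ t x ≤ u t' x' - φ t' x') →
    FracKExists α (t' - a) (fun s => u s x') t' ∧
    fracJ α (t' - a) (fun s => φ s x') t' + fracK α (t' - a) (fun s => u s x') t'
      + H t' x' (u t' x') (gradient (φ t') x') ≤ 0

/-- Viscosity supersolutions `u ∈ LSC([0,T] × 𝕋^d)` of `∂_t^α u + H(t,x,u,Du) = 0` in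
`(0,T] × 𝕋^d`. The integral in `K` lies in `[-∞,∞)`, so the inequality includes its finiteness. -/
def IsViscositySupersolution {d : ℕ} (α T : ℝ)
    (H : ℝ → EuclideanSpace ℝ (Fin d) → ℝ → EuclideanSpace ℝ (Fin d) → ℝ)
    (u : ℝ → EuclideanSpace ℝ (Fin d) → ℝ) : Prop :=
  (∀ t ∈ Icc 0 T, ZPeriodic (u t)) ∧
  LowerSemicontinuousOn (fun q : ℝ × EuclideanSpace ℝ (Fin d) => u q.1 q.2) (Icc 0 T ×ˢ univ) ∧
  ∀ (a b : ℝ), 0 ≤ a → a < b → b ≤ T →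
  ∀ (c : EuclideanSpace ℝ (Fin d)) (ρ : ℝ), 0 < ρ →
  ∀ φ : ℝ → EuclideanSpace ℝ (Fin d) → ℝ, IsTestFunction T φ →
  ∀ t' ∈ Ioc a b, ∀ x' ∈ Metric.ball c ρ,
    (∀ t ∈ Icc a b, ∀ x ∈ Metric.closedBall c ρ, u t' x' - φ t' x' ≤ u t x - φ t x) →
    FracKExists α (t' - a) (fun s => u s x') t' ∧
    0 ≤ fracJ α (t' - a) (fun s => φ s x') t' + fracK α (t' - a) (fun s => u s x') t'
      + H t' x' (u t' x') (gradient (φ t') x')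

/-- Viscosity solutions `u ∈ C([0,T] × 𝕋^d)` of the initial value problem
`∂_t^α u + H(t,x,u,Du) = 0` in `(0,T] × 𝕋^d`, `u(0,·) = u₀`. -/
def IsViscositySolutionIVP {d : ℕ} (α T : ℝ)
    (H : ℝ → EuclideanSpace ℝ (Fin d) → ℝ → EuclideanSpace ℝ (Fin d) → ℝ)
    (u₀ : EuclideanSpace ℝ (Fin d) → ℝ) (u : ℝ → EuclideanSpace ℝ (Fin d) → ℝ) : Prop :=
  ContinuousOn (fun q : ℝ × EuclideanSpace ℝ (Fin d) => u q.1 q.2) (Icc 0 T ×ˢ univ) ∧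
  IsViscositySubsolution α T H u ∧ IsViscositySupersolution α T H u ∧
  ∀ x, u 0 x = u₀ x

end

/-! The equation is nonlocal only in time, and its Caputo part can be freed of the test function. At
a maximum of u - φ the differences u(t) - u(t - τ) dominate those of φ, which are O(τ), so the
singular integrand of u is bounded below by a multiple of τ^(-α), integrable because α < 1. Letting
r tend to 0 in J_r[φ] + K_r[u], Fatou's lemma yields K_0[u] + H ≤ 0; the converse is monotonicity of
the integral. In this form, `CaputoSubsolution`, φ enters only through its spatial gradient. The
stability lemma `caputoFrom_add_le_of_limit` packages the Fatou argument and also carries the limits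
in the existence proof. Supersolutions are reduced to subsolutions by u ↦ -u
(`isViscositySubsolution_neg_iff`).

Uniqueness is comparison by doubling variables. With w = -v, maximise u(t,x) + w(s,y) - m(t-s)² -
k|x-y|². Moving both times back by the same τ leaves the penalty unchanged, so the two Caputo
integrands have a nonnegative sum on the common range, and the rest is O(|t-s|)
(`neg_le_add_caputo_integrals`). As m → ∞ only the boundary terms (u(t) - u(0))/(t^α Γ(1-α))
survive. If u exceeds v by θ somewhere, these are at least a positive multiple of θ, while the
Hamiltonians differ by at most ω(|x-y|(1+2k|x-y|)), which tends to 0 as k → ∞: a contradiction.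

Existence is Perron's method. Barriers β(x) - K t^α, with β smooth and periodic below u₀, and their
duals above, pin down the initial value. The upper envelope U of all periodic subsolutions starting
below u₀ is a subsolution (`caputoSubsolution_upperEnvelope`). Were its lower envelope -V not a
supersolution, U could be raised near a point (`exists_larger_subsolution`). At a raised point the
recent past is controlled by the smooth bump and costs O(r^(1-α)), while the remote past is compared
with -V ≤ U. The bump destroys periodicity, which the envelope of its integer translates restores,
contradicting maximality. Comparison then gives U ≤ -V, hence U = -V is continuous. -/

/-! ### Fatou's lemma and stability of the Caputo operator -/

/-- Fatou's lemma for real functions bounded below by an integrable function. -/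
theorem integrable_and_integral_le_of_liminf {X : Type*} [MeasurableSpace X] {μ : Measure X}
    {f : ℕ → X → ℝ} {g B : X → ℝ} {c : ℝ} (hf : ∀ n, Integrable (f n) μ)
    (hg : AEStronglyMeasurable g μ) (hB : Integrable B μ)
    (hlow : ∀ n, ∀ᵐ x ∂μ, -B x ≤ f n x) (hglow : ∀ᵐ x ∂μ, -B x ≤ g x)
    (hlim : ∀ᵐ x ∂μ, ∀ e > 0, ∀ᶠ n in atTop, g x - e ≤ f n x)
    (hle : ∀ e > 0, ∀ᶠ n in atTop, ∫ x, f n x ∂μ ≤ c + e) :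
    Integrable g μ ∧ ∫ x, g x ∂μ ≤ c := by
  have hlow' : ∀ᵐ x ∂μ, ∀ n, -B x ≤ f n x := ae_all_iff.2 hlow
  -- Adding B makes all integrands nonnegative, so that Fatou's lemma for lower integrals applies.
  set G : X → ℝ := fun x => max (g x + B x) 0 with hG
  have hGm : AEStronglyMeasurable G μ := (hg.add hB.1).sup aestronglyMeasurable_const
  have hG0 : 0 ≤ᵐ[μ] G := ae_of_all _ fun x => le_max_right _ _
  have hlint : ∀ e > 0, ∫⁻ x, ENNReal.ofReal (G x) ∂μ ≤
      ENNReal.ofReal (c + ∫ x, B x ∂μ + e) := by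
    intro e he
    calc ∫⁻ x, ENNReal.ofReal (G x) ∂μ
        ≤ ∫⁻ x, liminf (fun n => ENNReal.ofReal (f n x + B x)) atTop ∂μ := by
          refine lintegral_mono_ae ?_
          filter_upwards [hlow', hlim] with x h1 h2
          refine le_of_forall_lt fun y hy => ?_
          obtain ⟨z, hyz, hz⟩ := exists_between hy
          refine lt_of_lt_of_le hyz (le_liminf_of_le (by isBoundedDefault) ?_)
          have hzt : z ≠ ⊤ := ne_top_of_lt hz
          have hz' : z.toReal < G x := by
            rwa [ENNReal.lt_ofReal_iff_toReal_lt hzt] at hz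
          rcases lt_max_iff.1 hz' with h | h
          · filter_upwards [h2 (g x + B x - z.toReal) (by linarith)] with n hn
            rw [ENNReal.le_ofReal_iff_toReal_le hzt (by linarith [h1 n])]
            linarith
          · exact absurd h (not_lt.2 ENNReal.toReal_nonneg)
      _ ≤ liminf (fun n => ∫⁻ x, ENNReal.ofReal (f n x + B x) ∂μ) atTop :=
          lintegral_liminf_le' fun n => ((hf n).add hB).1.aemeasurable.ennreal_ofReal
      _ ≤ ENNReal.ofReal (c + ∫ x, B x ∂μ + e) := by
          refine liminf_le_of_frequently_le' ?_
          refine ((hle e he).mono fun n hn => ?_).frequently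
          have h := ofReal_integral_eq_lintegral_ofReal ((hf n).add hB) (by
            filter_upwards [hlow n] with x hx
            simp only [Pi.zero_apply, Pi.add_apply]; linarith)
          simp only [Pi.add_apply] at h
          rw [← h, integral_add (hf n) hB]
          exact ENNReal.ofReal_le_ofReal (by linarith)
  have hGi : Integrable G μ := by
    refine ⟨hGm, ?_⟩
    rw [hasFiniteIntegral_iff_ofReal hG0]
    exact (hlint 1 one_pos).trans_lt ENNReal.ofReal_lt_top
  have hgB : g =ᵐ[μ] fun x => G x - B x := by
    filter_upwards [hglow] with x h1
    simp [hG, max_eq_left (show 0 ≤ g x + B x by linarith)]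
  refine ⟨(hGi.sub hB).congr hgB.symm, ?_⟩
  rw [integral_congr_ae hgB, integral_sub hGi hB]
  refine le_of_forall_pos_le_add fun e he => ?_
  have h := hlint e he
  rw [← ofReal_integral_eq_lintegral_ofReal hGi hG0] at h
  -- `ENNReal.ofReal` truncates at 0, so the bound is informative only once its right side is known
  -- to be nonnegative; any single f n with large index shows this.
  have hnn : 0 ≤ c + ∫ x, B x ∂μ + e := by
    obtain ⟨n, hn⟩ := (hle e he).exists
    have : ∫ x, -B x ∂μ ≤ ∫ x, f n x ∂μ := integral_mono_ae hB.neg (hf n) (hlow n)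
    rw [integral_neg] at this
    linarith
  rw [ENNReal.ofReal_le_ofReal_iff hnn] at h
  linarith

/-- `(a - f 0) / (t^α Γ(1-α)) + α / Γ(1-α) ∫_r^t (a - f(t-τ)) τ^(-α-1) dτ`. -/
noncomputable def caputoFrom (α r a : ℝ) (f : ℝ → ℝ) (t : ℝ) : ℝ :=
  (a - f 0) / (t ^ α * Real.Gamma (1 - α)) +
    α / Real.Gamma (1 - α) * ∫ τ in Ioc r t, (a - f (t - τ)) / τ ^ (α + 1)

theorem integrableOn_rpow_neg_Ioc {α : ℝ} (hα₁ : α < 1) (r : ℝ) :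
    IntegrableOn (fun τ : ℝ => τ ^ (-α)) (Ioc 0 r) := by
  rcases le_or_gt r 0 with h | h
  · simp [Ioc_eq_empty_of_le h]
  · exact (intervalIntegrable_iff_integrableOn_Ioc_of_le h.le).1
      (intervalIntegral.intervalIntegrable_rpow' (by linarith))

theorem integral_rpow_neg_Ioc {α : ℝ} (hα₁ : α < 1) {r : ℝ} (hr : 0 ≤ r) :
    ∫ τ in Ioc 0 r, τ ^ (-α) = r ^ (1 - α) / (1 - α) := by
  rw [← intervalIntegral.integral_of_le hr, integral_rpow (Or.inl (by linarith)),
    Real.zero_rpow (by linarith), sub_zero, neg_add_eq_sub]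

theorem mul_div_rpow_add_one {τ : ℝ} (hτ : 0 < τ) (α C : ℝ) :
    C * τ / τ ^ (α + 1) = C * τ ^ (-α) := by
  rw [Real.rpow_add_one hτ.ne', Real.rpow_neg hτ.le]
  field_simp

/-- The reflection τ ↦ t - τ preserves Lebesgue measure on [0,t]. -/
theorem aestronglyMeasurable_caputo_integrand {f : ℝ → ℝ} {t : ℝ} (α a : ℝ)
    (hf : AEStronglyMeasurable f (volume.restrict (Icc 0 t))) :
    AEStronglyMeasurable (fun τ => (a - f (t - τ)) / τ ^ (α + 1))
      (volume.restrict (Ioc 0 t)) := by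
  have h1 : AEStronglyMeasurable (fun τ => f (t - τ)) (volume.restrict (Ioc 0 t)) := by
    have hmp : MeasurePreserving (fun τ : ℝ => t - τ) (volume.restrict (Icc 0 t))
        (volume.restrict (Icc 0 t)) := by
      have := (Measure.measurePreserving_sub_left (volume : Measure ℝ) t).restrict_preimage
        (measurableSet_Icc (a := (0 : ℝ)) (b := t))
      simpa using this
    exact (hf.comp_measurePreserving hmp).mono_measure
      (Measure.restrict_mono Ioc_subset_Icc_self le_rfl)
  have h2 : Measurable fun τ : ℝ => τ ^ (α + 1) := by fun_prop
  exact ((aestronglyMeasurable_const.sub h1).aemeasurable.div h2.aemeasurable).aestronglyMeasurable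

/-- Stability of `K_r[f](t) + X ≤ 0` under relaxed upper limits. -/
theorem caputoFrom_add_le_of_limit {α T M C r₀ r a t X : ℝ} (hα₀ : 0 < α) (hα₁ : α < 1)
    {f : ℝ → ℝ} {F : ℕ → ℝ → ℝ} {A R S Y : ℕ → ℝ}
    (hS : ∀ n, 0 < S n ∧ S n ≤ T) (ht : 0 < t) (htT : t ≤ T) (hr : 0 ≤ r)
    (hR : ∀ n, 0 ≤ R n)
    (hint : ∀ n, IntegrableOn (fun τ => (A n - F n (S n - τ)) / τ ^ (α + 1)) (Ioc (R n) (S n)))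
    (hf : AEStronglyMeasurable f (volume.restrict (Icc 0 t)))
    (hC : 0 ≤ C) (hr₀ : 0 < r₀)
    (hlowF : ∀ n, ∀ τ ∈ Ioc (R n) (S n), τ ≤ r₀ → -(C * τ) ≤ A n - F n (S n - τ))
    (hlowf : ∀ τ ∈ Ioc r t, τ ≤ r₀ → -(C * τ) ≤ a - f (t - τ))
    (hFM : ∀ n, ∀ s ∈ Icc 0 (S n), F n s ≤ M) (hfM : ∀ s ∈ Icc 0 t, f s ≤ M)
    (hA : Tendsto A atTop (𝓝 a)) (hSt : Tendsto S atTop (𝓝 t)) (hRr : Tendsto R atTop (𝓝 r))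
    (hlim : ∀ τ ∈ Ioo r t, ∀ e > 0, ∀ᶠ n in atTop, F n (S n - τ) ≤ f (t - τ) + e)
    (hlim₀ : ∀ e > 0, ∀ᶠ n in atTop, F n 0 ≤ f 0 + e)
    (hY : Tendsto Y atTop (𝓝 X))
    (hle : ∀ e > 0, ∀ᶠ n in atTop, caputoFrom α (R n) (A n) (F n) (S n) + Y n ≤ e) :
    IntegrableOn (fun τ => (a - f (t - τ)) / τ ^ (α + 1)) (Ioc r t) ∧
      caputoFrom α r a f t + X ≤ 0 := by
  have hΓ : 0 < Real.Gamma (1 - α) := Real.Gamma_pos_of_pos (by linarith)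
  set Γ := Real.Gamma (1 - α) with hΓdef
  obtain ⟨A₀, hA₀⟩ : ∃ A₀, ∀ n, |A n| ≤ A₀ := by
    obtain ⟨b, hb⟩ := (Metric.isBounded_range_of_tendsto A hA).exists_norm_le
    exact ⟨b, fun n => hb _ ⟨n, rfl⟩⟩
  have hA₀a : |a| ≤ A₀ := le_of_tendsto hA.abs (Eventually.of_forall hA₀)
  -- The integrable minorant is -(C τ^(-α) + K): the linear lower bound tames the kernel for τ ≤ r₀,
  -- and for τ > r₀ the kernel is at most r₀^(-α-1).
  set K := (A₀ + |M|) / r₀ ^ (α + 1) with hK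
  have hr₀' : 0 < r₀ ^ (α + 1) := Real.rpow_pos_of_pos hr₀ _
  have hAM : 0 ≤ A₀ + |M| := by have := abs_nonneg a; have := abs_nonneg M; linarith
  have hK0 : 0 ≤ K := by positivity
  have hbound : ∀ v τ : ℝ, 0 < τ → (τ ≤ r₀ → -(C * τ) ≤ v) → -(A₀ + |M|) ≤ v →
      -(C * τ ^ (-α) + K) ≤ v / τ ^ (α + 1) := by
    intro v τ hτ h1 h2
    have hτ' : 0 < τ ^ (α + 1) := Real.rpow_pos_of_pos hτ _
    have hτ'' : 0 ≤ C * τ ^ (-α) := mul_nonneg hC (Real.rpow_nonneg hτ.le _)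
    rcases le_or_gt τ r₀ with h | h
    · have : -(C * τ) / τ ^ (α + 1) ≤ v / τ ^ (α + 1) := by
        gcongr; exact h1 h
      rw [neg_div, mul_div_rpow_add_one hτ] at this
      linarith
    · have h3 : r₀ ^ (α + 1) ≤ τ ^ (α + 1) := Real.rpow_le_rpow hr₀.le h.le (by linarith)
      have h4 : (A₀ + |M|) / τ ^ (α + 1) ≤ K := by rw [hK]; gcongr
      have h5 : -(A₀ + |M|) / τ ^ (α + 1) ≤ v / τ ^ (α + 1) := by gcongr
      rw [neg_div] at h5
      linarith
  have habs : ∀ v w : ℝ, |v| ≤ A₀ → w ≤ M → -(A₀ + |M|) ≤ v - w := fun v w hv hw => by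
    have := neg_abs_le v; have := le_abs_self M; linarith
  -- The domains of integration vary with n; indicators place all integrals on the fixed interval
  -- (0,T].
  set g : ℝ → ℝ := (Ioc r t).indicator fun τ => (a - f (t - τ)) / τ ^ (α + 1) with hg
  set G : ℕ → ℝ → ℝ := fun n =>
    (Ioc (R n) (S n)).indicator fun τ => (A n - F n (S n - τ)) / τ ^ (α + 1) with hG
  have hsub : Ioc r t ⊆ Ioc 0 T := Ioc_subset_Ioc hr htT
  have hsubn : ∀ n, Ioc (R n) (S n) ⊆ Ioc 0 T := fun n => Ioc_subset_Ioc (hR n) (hS n).2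
  set μ := volume.restrict (Ioc 0 T) with hμ
  have hIG : ∀ n, ∫ τ, G n τ ∂μ = ∫ τ in Ioc (R n) (S n), (A n - F n (S n - τ)) / τ ^ (α + 1) := by
    intro n
    rw [hμ, hG, setIntegral_indicator measurableSet_Ioc, inter_eq_self_of_subset_right (hsubn n)]
  have hIg : ∫ τ, g τ ∂μ = ∫ τ in Ioc r t, (a - f (t - τ)) / τ ^ (α + 1) := by
    rw [hμ, hg, setIntegral_indicator measurableSet_Ioc, inter_eq_self_of_subset_right hsub]
  have hB : Integrable (fun τ : ℝ => C * τ ^ (-α) + K) μ :=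
    ((integrableOn_rpow_neg_Ioc hα₁ T).const_mul C).add (integrable_const K)
  have hBnn : ∀ τ : ℝ, 0 < τ → -(C * τ ^ (-α) + K) ≤ 0 := fun τ hτ => by
    have := mul_nonneg hC (Real.rpow_nonneg hτ.le (-α)); linarith
  have hfirst : ∀ e > 0, ∀ᶠ n in atTop, (a - f 0) / (t ^ α * Γ) - e ≤
      (A n - F n 0) / (S n ^ α * Γ) := by
    intro e he
    have htα : 0 < t ^ α * Γ := mul_pos (Real.rpow_pos_of_pos ht _) hΓ
    -- Replacing f 0 by f 0 + e₁ costs exactly e / 2 in the limiting quotient.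
    set e₁ := e / 2 * (t ^ α * Γ) with he₁
    have hlimp : Tendsto (fun n => (A n - (f 0 + e₁)) / (S n ^ α * Γ)) atTop
        (𝓝 ((a - (f 0 + e₁)) / (t ^ α * Γ))) :=
      (hA.sub_const _).div ((hSt.rpow_const (Or.inl ht.ne')).mul_const _) htα.ne'
    have hval : (a - (f 0 + e₁)) / (t ^ α * Γ) = (a - f 0) / (t ^ α * Γ) - e / 2 := by
      rw [he₁]; field_simp; ring
    rw [hval] at hlimp
    filter_upwards [hlimp.eventually_const_lt
      (show (a - f 0) / (t ^ α * Γ) - e < (a - f 0) / (t ^ α * Γ) - e / 2 by linarith),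
      hlim₀ e₁ (by positivity)] with n h1 h2
    refine h1.le.trans ?_
    have : 0 < S n ^ α * Γ := mul_pos (Real.rpow_pos_of_pos (hS n).1 _) hΓ
    gcongr
  -- The constant c is the bound on the integral obtained by solving `caputoFrom α r a f t + X ≤ 0`
  -- for it.
  have key := integrable_and_integral_le_of_liminf (μ := μ) (f := G) (g := g)
    (B := fun τ => C * τ ^ (-α) + K)
    (c := Γ / α * (-X - (a - f 0) / (t ^ α * Γ)))
    (fun n => ?_) ?_ hB (fun n => ?_) ?_ ?_ ?_
  · obtain ⟨h1, h2⟩ := key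
    have h1' : IntegrableOn (fun τ => (a - f (t - τ)) / τ ^ (α + 1)) (Ioc r t) := by
      rw [hg, integrable_indicator_iff measurableSet_Ioc, hμ, IntegrableOn,
        Measure.restrict_restrict measurableSet_Ioc, inter_eq_self_of_subset_left hsub] at h1
      exact h1
    refine ⟨h1', ?_⟩
    rw [hIg] at h2
    have h3 := mul_le_mul_of_nonneg_left h2 (show 0 ≤ α / Γ by positivity)
    have h4 : α / Γ * (Γ / α * (-X - (a - f 0) / (t ^ α * Γ))) = -X - (a - f 0) / (t ^ α * Γ) := by
      field_simp
    rw [h4] at h3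
    unfold caputoFrom
    linarith
  · rw [hG, integrable_indicator_iff measurableSet_Ioc, hμ, IntegrableOn,
      Measure.restrict_restrict measurableSet_Ioc, inter_eq_self_of_subset_left (hsubn n)]
    exact hint n
  · rw [hg, hμ, aestronglyMeasurable_indicator_iff measurableSet_Ioc,
      Measure.restrict_restrict measurableSet_Ioc, inter_eq_self_of_subset_left hsub]
    exact (aestronglyMeasurable_caputo_integrand α a hf).mono_measure
      (Measure.restrict_mono (Ioc_subset_Ioc_left hr) le_rfl)
  · refine (ae_restrict_iff' measurableSet_Ioc).2 (ae_of_all _ fun τ hτ => ?_)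
    by_cases h : τ ∈ Ioc (R n) (S n)
    · simp only [hG, indicator_of_mem h]
      exact hbound _ _ hτ.1 (hlowF n τ h) (habs _ _ (hA₀ n)
        (hFM n _ ⟨by linarith [h.2], by linarith [hτ.1]⟩))
    · simp only [hG, indicator_of_notMem h]
      exact hBnn τ hτ.1
  · refine (ae_restrict_iff' measurableSet_Ioc).2 (ae_of_all _ fun τ hτ => ?_)
    by_cases h : τ ∈ Ioc r t
    · simp only [hg, indicator_of_mem h]
      exact hbound _ _ hτ.1 (hlowf τ h) (habs _ _ hA₀a
        (hfM _ ⟨by linarith [h.2], by linarith [hτ.1]⟩))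
    · simp only [hg, indicator_of_notMem h]
      exact hBnn τ hτ.1
  -- At the two endpoints the indicators need not converge; these points form a null set.
  · have hne : ∀ᵐ τ ∂μ, τ ≠ r ∧ τ ≠ t := by
      have h1 : ∀ᵐ τ ∂(volume : Measure ℝ), τ ≠ r := by simp [ae_iff]
      have h2 : ∀ᵐ τ ∂(volume : Measure ℝ), τ ≠ t := by simp [ae_iff]
      exact ae_restrict_of_ae (h1.and h2)
    filter_upwards [hne, ae_restrict_mem measurableSet_Ioc] with τ hτ hτT e he
    rcases lt_or_gt_of_ne hτ.1 with h | h
    · filter_upwards [hRr.eventually_const_lt h] with n hn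
      rw [hg, hG, indicator_of_notMem (fun h' => absurd h'.1 (not_lt.2 h.le))]
      simp only []
      rw [indicator_of_notMem (fun h' => absurd h'.1 (not_lt.2 hn.le))]
      linarith
    rcases lt_or_gt_of_ne hτ.2 with h' | h'
    · have hτp : 0 < τ ^ (α + 1) := Real.rpow_pos_of_pos hτT.1 _
      filter_upwards [hRr.eventually_lt_const h, hSt.eventually_const_lt h',
        hlim τ ⟨h, h'⟩ (e * τ ^ (α + 1) / 2) (by positivity),
        hA.eventually_const_lt (show a - e * τ ^ (α + 1) / 2 < a by
          have : 0 < e * τ ^ (α + 1) := by positivity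
          linarith)] with n h1 h2 h3 h4
      rw [hg, hG, indicator_of_mem (show τ ∈ Ioc r t from ⟨h, h'.le⟩)]
      simp only []
      rw [indicator_of_mem (show τ ∈ Ioc (R n) (S n) from ⟨h1, h2.le⟩)]
      rw [show (a - f (t - τ)) / τ ^ (α + 1) - e =
        (a - f (t - τ) - e * τ ^ (α + 1)) / τ ^ (α + 1) by field_simp]
      exact div_le_div_of_nonneg_right (by linarith) hτp.le
    · filter_upwards [hSt.eventually_lt_const h'] with n hn
      rw [hg, hG, indicator_of_notMem (fun h'' => absurd h''.2 (not_le.2 h'))]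
      simp only []
      rw [indicator_of_notMem (fun h'' => absurd h''.2 (not_le.2 hn))]
      linarith
  · intro e he
    -- Three errors of size e' arise: in the inequality, in the boundary term and in Y.
    set e' := α / Γ * e / 3 with he'
    have he'0 : 0 < e' := by positivity
    filter_upwards [hle e' he'0, hfirst e' he'0,
      hY.eventually_const_lt (show X - e' < X by linarith)] with n h1 h2 h3
    rw [hIG]
    unfold caputoFrom at h1
    rw [← hΓdef] at h1
    have h4 : α / Γ * ∫ τ in Ioc (R n) (S n), (A n - F n (S n - τ)) / τ ^ (α + 1) ≤
        -X - (a - f 0) / (t ^ α * Γ) + 3 * e' := by linarith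
    have h5 := mul_le_mul_of_nonneg_left h4 (show 0 ≤ Γ / α by positivity)
    rw [← mul_assoc, show Γ / α * (α / Γ) = 1 by field_simp, one_mul] at h5
    refine h5.trans (le_of_eq ?_)
    rw [he']; field_simp

/-- The linear bound near τ = 0 reduces the kernel to τ^(-α), which is integrable since α < 1;
beyond r₀ the integrand is bounded. -/
theorem integrableOn_caputo_of_bounds {α C K r₀ a t : ℝ} (hα₀ : 0 < α) (hα₁ : α < 1)
    {f : ℝ → ℝ} (hf : AEStronglyMeasurable f (volume.restrict (Icc 0 t)))
    (hC : 0 ≤ C) (hr₀ : 0 < r₀) (hK : 0 ≤ K)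
    (h1 : ∀ τ ∈ Ioc 0 t, τ ≤ r₀ → |a - f (t - τ)| ≤ C * τ)
    (h2 : ∀ τ ∈ Ioc 0 t, |a - f (t - τ)| ≤ K) :
    IntegrableOn (fun τ => (a - f (t - τ)) / τ ^ (α + 1)) (Ioc 0 t) := by
  have hB : IntegrableOn (fun τ : ℝ => C * τ ^ (-α) + K / r₀ ^ (α + 1)) (Ioc 0 t) :=
    ((integrableOn_rpow_neg_Ioc hα₁ t).const_mul C).add (integrable_const _)
  refine hB.mono' (aestronglyMeasurable_caputo_integrand α a hf) ?_
  refine (ae_restrict_iff' measurableSet_Ioc).2 (ae_of_all _ fun τ hτ => ?_)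
  have hτ' : 0 < τ ^ (α + 1) := Real.rpow_pos_of_pos hτ.1 _
  have hr₀' : 0 < r₀ ^ (α + 1) := Real.rpow_pos_of_pos hr₀ _
  rw [Real.norm_eq_abs, abs_div, abs_of_pos hτ']
  have hτ'' : 0 ≤ C * τ ^ (-α) := mul_nonneg hC (Real.rpow_nonneg hτ.1.le _)
  have hKr : 0 ≤ K / r₀ ^ (α + 1) := by positivity
  rcases le_or_gt τ r₀ with h | h
  · have : |a - f (t - τ)| / τ ^ (α + 1) ≤ C * τ / τ ^ (α + 1) := by
      gcongr; exact h1 τ hτ h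
    rw [mul_div_rpow_add_one hτ.1] at this
    linarith
  · have h3 : r₀ ^ (α + 1) ≤ τ ^ (α + 1) := Real.rpow_le_rpow hr₀.le h.le (by linarith)
    have : |a - f (t - τ)| / τ ^ (α + 1) ≤ K / r₀ ^ (α + 1) := by
      gcongr; exact h2 τ hτ
    linarith

theorem integrableOn_caputo_of_pos {α K r a t : ℝ} (hα₀ : 0 < α)
    {f : ℝ → ℝ} (hf : AEStronglyMeasurable f (volume.restrict (Icc 0 t)))
    (hr : 0 < r) (hK : 0 ≤ K) (h2 : ∀ τ ∈ Ioc 0 t, |a - f (t - τ)| ≤ K) :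
    IntegrableOn (fun τ => (a - f (t - τ)) / τ ^ (α + 1)) (Ioc r t) := by
  have hB : IntegrableOn (fun _ : ℝ => K / r ^ (α + 1)) (Ioc r t) := integrable_const _
  refine hB.mono' ((aestronglyMeasurable_caputo_integrand α a hf).mono_measure
    (Measure.restrict_mono (Ioc_subset_Ioc_left hr.le) le_rfl)) ?_
  refine (ae_restrict_iff' measurableSet_Ioc).2 (ae_of_all _ fun τ hτ => ?_)
  have hτ0 : 0 < τ := hr.trans hτ.1
  have hr' : 0 < r ^ (α + 1) := Real.rpow_pos_of_pos hr _
  rw [Real.norm_eq_abs, abs_div, abs_of_pos (Real.rpow_pos_of_pos hτ0 _)]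
  have h3 : r ^ (α + 1) ≤ τ ^ (α + 1) := Real.rpow_le_rpow hr.le hτ.1.le (by linarith)
  gcongr
  exact h2 τ ⟨hτ0, hτ.2⟩

/-- Although Φ may be differentiable only one-sidedly in time at an endpoint of I, a slice at fixed
time lies wholly in the domain, so the spatial derivative is a genuine one. -/
theorem hasFDerivAt_slice {E : Type*} [NormedAddCommGroup E] [NormedSpace ℝ E] {I : Set ℝ}
    {Φ : ℝ × E → ℝ} (hΦ : DifferentiableOn ℝ Φ (I ×ˢ univ)) {t : ℝ} (ht : t ∈ I) (x : E) :
    HasFDerivAt (fun y => Φ (t, y))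
      ((fderivWithin ℝ Φ (I ×ˢ univ) (t, x)).comp (ContinuousLinearMap.inr ℝ ℝ E)) x := by
  have h1 := (hΦ (t, x) ⟨ht, mem_univ _⟩).hasFDerivWithinAt
  have h2 : HasFDerivWithinAt (fun y : E => (t, y)) (ContinuousLinearMap.inr ℝ ℝ E) univ x :=
    (hasFDerivAt_prodMk_right t x).hasFDerivWithinAt
  exact hasFDerivWithinAt_univ.1 (h1.comp x h2 fun y _ => ⟨ht, mem_univ _⟩)

/-! ### Test functions and semicontinuous functions -/

section

variable {d : ℕ}

local notation:max "𝔼" d:max => EuclideanSpace ℝ (Fin d)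

namespace IsTestFunction

variable {T : ℝ} {φ ψ : ℝ → 𝔼 d → ℝ}

theorem hasFDerivAt (hφ : IsTestFunction T φ) {t : ℝ} (ht : t ∈ Ioc 0 T) (x : 𝔼 d) :
    HasFDerivAt (φ t) ((fderivWithin ℝ (fun q : ℝ × 𝔼 d => φ q.1 q.2) (Ioc 0 T ×ˢ univ) (t, x)).comp
      (ContinuousLinearMap.inr ℝ ℝ 𝔼 d)) x :=
  hasFDerivAt_slice (hφ.2.1.differentiableOn one_ne_zero) ht x

theorem differentiableAt (hφ : IsTestFunction T φ) {t : ℝ} (ht : t ∈ Ioc 0 T) (x : 𝔼 d) :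
    DifferentiableAt ℝ (φ t) x :=
  (hφ.hasFDerivAt ht x).differentiableAt

theorem continuousOn_gradient (hφ : IsTestFunction T φ) :
    ContinuousOn (fun q : ℝ × 𝔼 d => gradient (φ q.1) q.2) (Ioc 0 T ×ˢ univ) := by
  have hu : UniqueDiffOn ℝ (Ioc 0 T ×ˢ (univ : Set 𝔼 d)) :=
    (uniqueDiffOn_Ioc 0 T).prod uniqueDiffOn_univ
  have h1 := hφ.2.1.continuousOn_fderivWithin hu le_rfl
  have h2 : ContinuousOn (fun q : ℝ × 𝔼 d => (InnerProductSpace.toDual ℝ 𝔼 d).symm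
      ((fderivWithin ℝ (fun q : ℝ × 𝔼 d => φ q.1 q.2) (Ioc 0 T ×ˢ univ) q).comp
        (ContinuousLinearMap.inr ℝ ℝ 𝔼 d))) (Ioc 0 T ×ˢ univ) :=
    (InnerProductSpace.toDual ℝ 𝔼 d).symm.continuous.comp_continuousOn
      (h1.clm_comp continuousOn_const)
  refine h2.congr fun q hq => ?_
  rw [gradient, (hφ.hasFDerivAt hq.1 q.2).fderiv]

/-- A C¹ function on the convex set (0,T] × ℝ^d is locally Lipschitz, also at t = T. The constant is
uniform for y near x, as is needed when contact points move. -/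
theorem exists_lipschitz (hφ : IsTestFunction T φ) {t : ℝ} (ht : t ∈ Ioc 0 T) (x : 𝔼 d) :
    ∃ C δ : ℝ, 0 ≤ C ∧ 0 < δ ∧ ∀ y ∈ Metric.ball x δ, ∀ s ∈ Ioc 0 T, ∀ s' ∈ Ioc 0 T,
      |s - t| < δ → |s' - t| < δ → |φ s y - φ s' y| ≤ C * |s - s'| := by
  have hconv : Convex ℝ (Ioc 0 T ×ˢ (univ : Set 𝔼 d)) := (convex_Ioc 0 T).prod convex_univ
  obtain ⟨K, U, hU, hL⟩ :=
    (hφ.2.1 (t, x) ⟨ht, mem_univ _⟩).exists_lipschitzOnWith hconv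
  obtain ⟨δ, hδ, hsub⟩ := Metric.mem_nhdsWithin_iff.1 hU
  refine ⟨K, δ, K.2, hδ, fun y hy s hs s' hs' h h' => ?_⟩
  have hmem : ∀ r ∈ Ioc 0 T, |r - t| < δ → (r, y) ∈ U := fun r hr hrt =>
    hsub ⟨by simpa [Prod.dist_eq, Real.dist_eq] using ⟨hrt, hy⟩, hr, mem_univ _⟩
  have := hL.dist_le_mul _ (hmem s hs h) _ (hmem s' hs' h')
  simpa [Prod.dist_eq, Real.dist_eq] using this

theorem integrableOn (hφ : IsTestFunction T φ) {α : ℝ} (hα₀ : 0 < α) (hα₁ : α < 1) {t : ℝ}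
    (ht : t ∈ Ioc 0 T) (x : 𝔼 d) :
    IntegrableOn (fun τ => (φ t x - φ (t - τ) x) / τ ^ (α + 1)) (Ioc 0 t) := by
  obtain ⟨C, δ, hC, hδ, h⟩ := hφ.exists_lipschitz ht x
  have hc : ContinuousOn (fun s => φ s x) (Icc 0 t) := by
    have := hφ.1.comp (f := fun s : ℝ => (s, x)) (s := Icc 0 t) (by fun_prop)
      fun s hs => ⟨⟨hs.1, hs.2.trans ht.2⟩, mem_univ _⟩
    exact this
  obtain ⟨M, hM⟩ := isCompact_Icc.exists_bound_of_continuousOn hc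
  have hM0 : 0 ≤ M := (norm_nonneg _).trans (hM t ⟨ht.1.le, le_rfl⟩)
  -- The choice of r₀ keeps t - τ positive and within δ of t.
  refine integrableOn_caputo_of_bounds (f := fun s => φ s x) (C := C) (K := M + M)
    (r₀ := min (δ / 2) (t / 2)) hα₀ hα₁
    (hc.aestronglyMeasurable measurableSet_Icc) hC (by have := ht.1; positivity) (by positivity)
    (fun τ hτ hτ' => ?_) (fun τ hτ => ?_)
  · have h1 := hτ'.trans (min_le_left _ _)
    have h2 := hτ'.trans (min_le_right _ _)
    have := h x (Metric.mem_ball_self hδ) t ht (t - τ)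
      ⟨by linarith [hτ.1, ht.1], by linarith [hτ.1, ht.2]⟩ (by simpa using hδ)
      (by rw [sub_sub_cancel_left, abs_neg, abs_of_pos hτ.1]; linarith)
    rwa [sub_sub_cancel, abs_of_pos hτ.1] at this
  · have h1 := hM t ⟨ht.1.le, le_rfl⟩
    have h2 := hM (t - τ) ⟨by linarith [hτ.2], by linarith [hτ.1]⟩
    exact (abs_sub _ _).trans (add_le_add h1 h2)

theorem of_contDiff (h : ContDiff ℝ 1 fun q : ℝ × 𝔼 d => φ q.1 q.2) : IsTestFunction T φ := by
  refine ⟨h.continuous.continuousOn, h.contDiffOn, fun x => ?_⟩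
  have h1 : ContDiff ℝ 1 fun s => φ s x :=
    h.comp (f := fun s : ℝ => (s, x)) (contDiff_id.prodMk contDiff_const)
  exact ((h1.continuous_deriv le_rfl).integrableOn_Icc).mono_set Ioo_subset_Icc_self

theorem differentiableAt_time (hφ : IsTestFunction T φ) {t : ℝ} (ht : t ∈ Ioo 0 T) (x : 𝔼 d) :
    DifferentiableAt ℝ (fun s => φ s x) t := by
  have h1 : DifferentiableOn ℝ (fun s => φ s x) (Ioc 0 T) :=
    (hφ.2.1.differentiableOn one_ne_zero).comp (f := fun s : ℝ => (s, x)) (by fun_prop)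
      fun s hs => ⟨hs, mem_univ _⟩
  exact (h1 t ⟨ht.1, ht.2.le⟩).differentiableAt (Ioc_mem_nhds ht.1 ht.2)

theorem add (hφ : IsTestFunction T φ) (hψ : IsTestFunction T ψ) :
    IsTestFunction T fun t x => φ t x + ψ t x := by
  refine ⟨hφ.1.add hψ.1, hφ.2.1.add hψ.2.1, fun x => ?_⟩
  refine ((hφ.2.2 x).add (hψ.2.2 x)).congr_fun (fun t ht => ?_) measurableSet_Ioo
  exact (deriv_add (hφ.differentiableAt_time ht x) (hψ.differentiableAt_time ht x)).symm

theorem neg (hφ : IsTestFunction T φ) : IsTestFunction T fun t x => -φ t x := by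
  refine ⟨hφ.1.neg, hφ.2.1.neg, fun x => ?_⟩
  refine (hφ.2.2 x).neg.congr_fun (fun t ht => ?_) measurableSet_Ioo
  simp [deriv.fun_neg]

end IsTestFunction

theorem gradient_add' {f g : 𝔼 d → ℝ} {x : 𝔼 d} (hf : DifferentiableAt ℝ f x)
    (hg : DifferentiableAt ℝ g x) :
    gradient (fun y => f y + g y) x = gradient f x + gradient g x := by
  simp [gradient, fderiv_fun_add hf hg]

theorem gradient_neg' (f : 𝔼 d → ℝ) (x : 𝔼 d) :
    gradient (fun y => -f y) x = -gradient f x := by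
  simp [gradient, fderiv_fun_neg]

theorem gradient_eq_of_isLocalMax_sub {f g : 𝔼 d → ℝ} {x : 𝔼 d} (hf : DifferentiableAt ℝ f x)
    (hg : DifferentiableAt ℝ g x) (h : IsLocalMax (fun y => f y - g y) x) :
    gradient f x = gradient g x := by
  have := h.fderiv_eq_zero
  rw [fderiv_fun_sub hf hg, sub_eq_zero] at this
  simp [gradient, this]

theorem UpperSemicontinuousOn.time_slice {T : ℝ} {u : ℝ → 𝔼 d → ℝ}
    (hu : UpperSemicontinuousOn (fun q : ℝ × 𝔼 d => u q.1 q.2) (Icc 0 T ×ˢ univ)) (x : 𝔼 d) :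
    UpperSemicontinuousOn (fun s => u s x) (Icc 0 T) :=
  hu.comp (g := fun s : ℝ => (s, x)) (by fun_prop) fun _ hs => ⟨hs, mem_univ _⟩

theorem UpperSemicontinuousOn.aestronglyMeasurable_Icc {f : ℝ → ℝ} {a b : ℝ}
    (hf : UpperSemicontinuousOn f (Icc a b)) :
    AEStronglyMeasurable f (volume.restrict (Icc a b)) := by
  have h : UpperSemicontinuous ((Icc a b).domRestrict f) := upperSemicontinuousOn_iff_restrict.2 hf
  exact (aemeasurable_restrict_of_measurable_subtype measurableSet_Icc
    h.measurable).aestronglyMeasurable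

theorem UpperSemicontinuousOn.aestronglyMeasurable_time_slice {T t : ℝ} {u : ℝ → 𝔼 d → ℝ}
    (hu : UpperSemicontinuousOn (fun q : ℝ × 𝔼 d => u q.1 q.2) (Icc 0 T ×ˢ univ)) (ht : t ≤ T)
    (x : 𝔼 d) : AEStronglyMeasurable (fun s => u s x) (volume.restrict (Icc 0 t)) :=
  ((hu.time_slice x).mono (Icc_subset_Icc_right ht)).aestronglyMeasurable_Icc

/-- The Hamiltonian of the equation solved by `-u`. -/
def dualHamiltonian (H : ℝ → 𝔼 d → ℝ → 𝔼 d → ℝ) : ℝ → 𝔼 d → ℝ → 𝔼 d → ℝ :=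
  fun t x r p => -H t x (-r) (-p)

/-- The inequality for subsolutions with the whole Caputo derivative falling on the function. -/
def CaputoSubsolution (α T : ℝ) (H : ℝ → 𝔼 d → ℝ → 𝔼 d → ℝ) (u : ℝ → 𝔼 d → ℝ) : Prop :=
  ∀ (a b : ℝ), 0 ≤ a → a < b → b ≤ T →
  ∀ (c : 𝔼 d) (ρ : ℝ), 0 < ρ →
  ∀ φ : ℝ → 𝔼 d → ℝ, IsTestFunction T φ →
  ∀ t' ∈ Ioc a b, ∀ x' ∈ Metric.ball c ρ,
    (∀ t ∈ Icc a b, ∀ x ∈ Metric.closedBall c ρ, u t x - φ t x ≤ u t' x' - φ t' x') →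
    FracKExists α 0 (fun s => u s x') t' ∧
    fracK α 0 (fun s => u s x') t' + H t' x' (u t' x') (gradient (φ t') x') ≤ 0

end

/-! ### The Caputo form of the viscosity inequality, and duality -/

section
variable {d : ℕ}
local notation:max "𝔼" d:max => EuclideanSpace ℝ (Fin d)

/-- Passage to `r = 0` in `K_r[f](t) + X ≤ 0`. -/
theorem fracK_zero_add_le {α C r₀ t M X : ℝ} (hα₀ : 0 < α) (hα₁ : α < 1) (ht : 0 < t)
    {f : ℝ → ℝ} (hf : AEStronglyMeasurable f (volume.restrict (Icc 0 t)))
    (hfM : ∀ s ∈ Icc 0 t, f s ≤ M) (hC : 0 ≤ C) (hr₀ : 0 < r₀)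
    (hlow : ∀ τ ∈ Ioc 0 t, τ ≤ r₀ → -(C * τ) ≤ f t - f (t - τ))
    (hle : ∀ e > 0, ∀ᶠ r in 𝓝[>] 0, FracKExists α r f t ∧ fracK α r f t + X ≤ e) :
    FracKExists α 0 f t ∧ fracK α 0 f t + X ≤ 0 := by
  obtain ⟨δ, hδ, hδ'⟩ := mem_nhdsGT_iff_exists_Ioo_subset.1 (hle 1 one_pos)
  rw [mem_Ioi] at hδ
  set R : ℕ → ℝ := fun n => δ / 2 / ((n : ℝ) + 1) with hR
  have hR0 : Tendsto R atTop (𝓝 0) := by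
    have := (tendsto_one_div_add_atTop_nhds_zero_nat (𝕜 := ℝ)).const_mul (δ / 2)
    simpa [hR, div_eq_mul_inv] using this
  have hRpos : ∀ n, 0 < R n := fun n => by positivity
  have hRlt : ∀ n, R n < δ := fun n => by
    have : R n ≤ δ / 2 := div_le_self (by positivity) (by linarith [n.cast_nonneg (α := ℝ)])
    linarith
  refine caputoFrom_add_le_of_limit (T := t) (M := M) (C := C) (r₀ := r₀) (F := fun _ => f)
    (A := fun _ => f t) (R := R) (S := fun _ => t) (Y := fun _ => X) hα₀ hα₁
    (fun _ => ⟨ht, le_rfl⟩) ht le_rfl le_rfl (fun n => (hRpos n).le)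
    (fun n => (hδ' ⟨hRpos n, hRlt n⟩).1) hf hC hr₀ (fun n τ hτ => hlow τ ⟨(hRpos n).trans hτ.1, hτ.2⟩)
    hlow (fun _ => hfM) hfM tendsto_const_nhds tendsto_const_nhds hR0 (fun τ _ e he => ?_)
    (fun e he => ?_) tendsto_const_nhds fun e he => ?_
  · exact Eventually.of_forall fun n => by linarith
  · exact Eventually.of_forall fun n => by linarith
  · have h1 : Tendsto R atTop (𝓝[>] 0) :=
      tendsto_nhdsWithin_iff.2 ⟨hR0, Eventually.of_forall hRpos⟩
    exact (h1.eventually (hle e he)).mono fun n hn => hn.2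

theorem UpperSemicontinuousOn.exists_time_bound {T : ℝ} {u : ℝ → 𝔼 d → ℝ}
    (hu : UpperSemicontinuousOn (fun q : ℝ × 𝔼 d => u q.1 q.2) (Icc 0 T ×ˢ univ)) (x : 𝔼 d) :
    ∃ M, ∀ s ∈ Icc 0 T, u s x ≤ M := by
  obtain ⟨M, hM⟩ := (hu.time_slice x).bddAbove_of_isCompact isCompact_Icc
  exact ⟨M, fun s hs => hM ⟨s, hs, rfl⟩⟩

variable {α T : ℝ} {H : ℝ → 𝔼 d → ℝ → 𝔼 d → ℝ} {u : ℝ → 𝔼 d → ℝ}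

/-- If `u - φ` is maximal at `(t, x)` over the past, then `u` inherits from `φ` a one-sided
Lipschitz bound. -/
theorem IsTestFunction.exists_lower_bound {φ : ℝ → 𝔼 d → ℝ} (hφ : IsTestFunction T φ) {a t : ℝ}
    (ha : 0 ≤ a) (hat : a < t) (htT : t ≤ T) {x : 𝔼 d} {f : ℝ → ℝ}
    (hmax : ∀ s ∈ Icc a t, f s - φ s x ≤ f t - φ t x) :
    ∃ C r₀ : ℝ, 0 ≤ C ∧ 0 < r₀ ∧ ∀ τ ∈ Ioc 0 t, τ ≤ r₀ → -(C * τ) ≤ f t - f (t - τ) := by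
  have ht : t ∈ Ioc 0 T := ⟨ha.trans_lt hat, htT⟩
  obtain ⟨C, δ, hC, hδ, h⟩ := hφ.exists_lipschitz ht x
  refine ⟨C, min (δ / 2) ((t - a) / 2), hC, by have := sub_pos.2 hat; positivity,
    fun τ hτ hτ' => ?_⟩
  have h1 := hτ'.trans (min_le_left _ _)
  have h2 := hτ'.trans (min_le_right _ _)
  have h3 := h x (Metric.mem_ball_self hδ) t ht (t - τ)
    ⟨by linarith, by linarith [hτ.1, ht.2]⟩ (by simpa using hδ)
    (by rw [sub_sub_cancel_left, abs_neg, abs_of_pos hτ.1]; linarith)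
  rw [sub_sub_cancel, abs_of_pos hτ.1] at h3
  have h4 := hmax (t - τ) ⟨by linarith, by linarith [hτ.1]⟩
  linarith [neg_abs_le (φ t x - φ (t - τ) x)]

/-- A maximum over [a,b] is also one over [t - r, b], so the definition holds with J_r and K_r for
every small r. As r → 0, J_r[φ] vanishes, and K_r[u] passes to the limit because u inherits a
one-sided Lipschitz bound from φ. -/
theorem IsViscositySubsolution.caputoSubsolution (hα₀ : 0 < α) (hα₁ : α < 1)
    (hu : IsViscositySubsolution α T H u) : CaputoSubsolution α T H u := by
  intro a b ha hab hb c ρ hρ φ hφ t ht x hx hmax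
  have htT : t ∈ Ioc 0 T := ⟨ha.trans_lt ht.1, ht.2.trans hb⟩
  have hxc : x ∈ Metric.closedBall c ρ := Metric.ball_subset_closedBall hx
  obtain ⟨C, r₀, hC, hr₀, hlow⟩ := hφ.exists_lower_bound (x := x) (f := fun s => u s x) ha ht.1 htT.2
    fun s hs => hmax s ⟨hs.1, hs.2.trans ht.2⟩ x hxc
  obtain ⟨M, hM⟩ := hu.2.1.exists_time_bound x
  refine fracK_zero_add_le hα₀ hα₁ htT.1 (hu.2.1.aestronglyMeasurable_time_slice htT.2 x)
    (fun s hs => hM s ⟨hs.1, hs.2.trans htT.2⟩) hC hr₀ hlow fun e he => ?_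
  have hJ : ∀ᶠ r in 𝓝[>] (0 : ℝ), -e ≤ fracJ α r (fun s => φ s x) t := by
    have hi := hφ.integrableOn hα₀ hα₁ htT x
    have h1 : Tendsto (fun r => ∫ τ in Ioc 0 r, (φ t x - φ (t - τ) x) / τ ^ (α + 1))
        (𝓝[>] 0) (𝓝 0) := by
      have h2 : ContinuousWithinAt (fun r => ∫ τ in (0 : ℝ)..r,
          (φ t x - φ (t - τ) x) / τ ^ (α + 1)) (Icc 0 t) 0 :=
        intervalIntegral.continuousOn_primitive_interval
          (by rwa [uIcc_of_le htT.1.le, integrableOn_Icc_iff_integrableOn_Ioc])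
          0 (by simp [htT.1.le]) |>.mono (by rw [uIcc_of_le htT.1.le])
      have h3 : Tendsto (fun r => ∫ τ in (0 : ℝ)..r,
          (φ t x - φ (t - τ) x) / τ ^ (α + 1)) (𝓝[Ioc 0 t] 0) (𝓝 0) := by
        have := h2.mono Ioc_subset_Icc_self
        rw [ContinuousWithinAt, intervalIntegral.integral_same] at this
        exact this
      rw [nhdsWithin_Ioc_eq_nhdsGT htT.1] at h3
      refine h3.congr' ?_
      filter_upwards [self_mem_nhdsWithin] with r hr
      rw [intervalIntegral.integral_of_le (le_of_lt hr)]
    have h4 := h1.const_mul (α / Real.Gamma (1 - α))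
    rw [mul_zero] at h4
    exact (h4.eventually_const_lt (show -e < 0 by linarith)).mono fun r hr => hr.le
  filter_upwards [hJ, Ioo_mem_nhdsGT (show (0 : ℝ) < t - a by linarith [ht.1])] with r hr hr'
  -- Taking t - r for the left endpoint of the time window turns the splitting parameter t' - a of
  -- the definition into r.
  have := hu.2.2 (t - r) b (by linarith [hr'.2]) (by linarith [hr'.1, ht.2]) hb c ρ hρ φ hφ t
    ⟨by linarith [hr'.1], ht.2⟩ x hx fun s hs y hy => hmax s ⟨by linarith [hr'.2, hs.1], hs.2⟩ y hy
  rw [sub_sub_cancel] at this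
  exact ⟨this.1, by linarith [this.2]⟩

/-- On the window the differences of φ are at most those of u, so J[φ] does not exceed the part of
the integral of u that it replaces. -/
theorem CaputoSubsolution.isViscositySubsolution (hα₀ : 0 < α) (hα₁ : α < 1)
    (h : CaputoSubsolution α T H u) (hper : ∀ t ∈ Icc 0 T, ZPeriodic (u t))
    (husc : UpperSemicontinuousOn (fun q : ℝ × 𝔼 d => u q.1 q.2) (Icc 0 T ×ˢ univ)) :
    IsViscositySubsolution α T H u := by
  refine ⟨hper, husc, fun a b ha hab hb c ρ hρ φ hφ t ht x hx hmax => ?_⟩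
  obtain ⟨h1, h2⟩ := h a b ha hab hb c ρ hρ φ hφ t ht x hx hmax
  have htT : t ∈ Ioc 0 T := ⟨ha.trans_lt ht.1, ht.2.trans hb⟩
  have hr : 0 < t - a := sub_pos.2 ht.1
  have hxc : x ∈ Metric.closedBall c ρ := Metric.ball_subset_closedBall hx
  have hΓ : 0 < Real.Gamma (1 - α) := Real.Gamma_pos_of_pos (by linarith)
  refine ⟨h1.mono_set (Ioc_subset_Ioc_left hr.le), le_trans ?_ h2⟩
  unfold FracKExists at h1
  unfold fracJ fracK
  have hdisj : Disjoint (Ioc 0 (t - a)) (Ioc (t - a) t) := Ioc_disjoint_Ioc_of_le le_rfl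
  have hunion : Ioc 0 (t - a) ∪ Ioc (t - a) t = Ioc 0 t :=
    Ioc_union_Ioc_eq_Ioc hr.le (by linarith)
  rw [← hunion, setIntegral_union hdisj measurableSet_Ioc
    (h1.mono_set (hunion ▸ subset_union_left)) (h1.mono_set (hunion ▸ subset_union_right)), mul_add]
  have hle : ∫ τ in Ioc 0 (t - a), (φ t x - φ (t - τ) x) / τ ^ (α + 1) ≤
      ∫ τ in Ioc 0 (t - a), (u t x - u (t - τ) x) / τ ^ (α + 1) := by
    refine setIntegral_mono_on ((hφ.integrableOn hα₀ hα₁ htT x).mono_set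
      (hunion ▸ subset_union_left)) (h1.mono_set (hunion ▸ subset_union_left)) measurableSet_Ioc
      fun τ hτ => ?_
    have := hmax (t - τ) ⟨by linarith [hτ.2], by linarith [hτ.1, ht.2]⟩ x hxc
    exact div_le_div_of_nonneg_right (by linarith) (Real.rpow_nonneg hτ.1.le _)
  have := mul_le_mul_of_nonneg_left hle (show 0 ≤ α / Real.Gamma (1 - α) by positivity)
  linarith

theorem fracJ_neg (α r : ℝ) (f : ℝ → ℝ) (t : ℝ) :
    fracJ α r (fun s => -f s) t = -fracJ α r f t := by
  unfold fracJ
  rw [← mul_neg, ← integral_neg]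
  congr 2; ext τ; ring

theorem fracK_neg (α r : ℝ) (f : ℝ → ℝ) (t : ℝ) :
    fracK α r (fun s => -f s) t = -fracK α r f t := by
  unfold fracK
  rw [neg_add, ← mul_neg, ← integral_neg]
  congr 1
  · ring
  · congr 2; ext τ; ring

theorem fracKExists_neg {α r : ℝ} {f : ℝ → ℝ} {t : ℝ} :
    FracKExists α r (fun s => -f s) t ↔ FracKExists α r f t := by
  unfold FracKExists
  have : (fun τ => (-f t - -f (t - τ)) / τ ^ (α + 1)) =
      fun τ => -((f t - f (t - τ)) / τ ^ (α + 1)) := by ext τ; ring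
  rw [this]
  exact integrableOn_neg_iff

/-- J, K and the gradient are odd in the function, and the dual Hamiltonian absorbs the signs.
Everything needed about supersolutions follows from subsolutions through this equivalence. -/
theorem isViscositySubsolution_neg_iff :
    IsViscositySubsolution α T (dualHamiltonian H) (fun t x => -u t x) ↔
      IsViscositySupersolution α T H u := by
  have hper : (∀ t ∈ Icc 0 T, ZPeriodic fun x => -u t x) ↔ ∀ t ∈ Icc 0 T, ZPeriodic (u t) := by
    simp [ZPeriodic]
  have hsc : UpperSemicontinuousOn (fun q : ℝ × 𝔼 d => -u q.1 q.2) (Icc 0 T ×ˢ univ) ↔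
      LowerSemicontinuousOn (fun q : ℝ × 𝔼 d => u q.1 q.2) (Icc 0 T ×ˢ univ) := by
    constructor
    · intro h
      have := continuous_neg.comp_upperSemicontinuousOn_antitone h (fun _ _ => neg_le_neg)
      simpa [Function.comp_def] using this
    · intro h
      exact continuous_neg.comp_lowerSemicontinuousOn_antitone h (fun _ _ => neg_le_neg)
  refine and_congr hper (and_congr hsc ?_)
  refine forall₄_congr fun a b ha hab => forall₄_congr fun hb c ρ hρ => ?_
  constructor
  · intro h φ hφ t ht x hx hmin
    obtain ⟨h1, h2⟩ := h _ hφ.neg t ht x hx fun s hs y hy => by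
      have := hmin s hs y hy; linarith
    rw [fracKExists_neg] at h1
    rw [fracJ_neg, fracK_neg, gradient_neg'] at h2
    simp only [dualHamiltonian, neg_neg] at h2
    exact ⟨h1, by linarith⟩
  · intro h φ hφ t ht x hx hmax
    obtain ⟨h1, h2⟩ := h _ hφ.neg t ht x hx fun s hs y hy => by
      have := hmax s hs y hy; linarith
    rw [fracJ_neg, gradient_neg'] at h2
    rw [fracKExists_neg, fracK_neg]
    simp only [dualHamiltonian, neg_neg]
    exact ⟨h1, by linarith⟩

end

/-! ### Comparison by doubling of variables -/

section
variable {d : ℕ}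
local notation:max "𝔼" d:max => EuclideanSpace ℝ (Fin d)

/-- Subtracting integer parts moves x into the unit cube. This is how compactness of the torus is
used. -/
theorem exists_integer_translate_norm_le (x : 𝔼 d) :
    ∃ z : Fin d → ℤ, ‖x + WithLp.toLp 2 (fun i => (z i : ℝ))‖ ≤ √d := by
  refine ⟨fun i => -⌊x i⌋, ?_⟩
  rw [EuclideanSpace.norm_eq]
  refine Real.sqrt_le_sqrt ?_
  calc ∑ i, ‖(x + WithLp.toLp 2 (fun i => ((-⌊x i⌋ : ℤ) : ℝ))) i‖ ^ 2 ≤ ∑ _i : Fin d, (1 : ℝ) := by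
        refine Finset.sum_le_sum fun i _ => ?_
        have h1 := Int.floor_le (x i)
        have h2 := Int.lt_floor_add_one (x i)
        simp only [PiLp.add_apply, Int.cast_neg, Real.norm_eq_abs, sq_abs]
        nlinarith
    _ = d := by simp

variable {α T : ℝ} {H : ℝ → 𝔼 d → ℝ → 𝔼 d → ℝ} {u v w : ℝ → 𝔼 d → ℝ}

theorem UpperSemicontinuousOn.exists_bound_of_periodic
    (hu : UpperSemicontinuousOn (fun q : ℝ × 𝔼 d => u q.1 q.2) (Icc 0 T ×ˢ univ))
    (hper : ∀ t ∈ Icc 0 T, ZPeriodic (u t)) : ∃ M, ∀ t ∈ Icc 0 T, ∀ x, u t x ≤ M := by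
  obtain ⟨M, hM⟩ := (hu.mono (prod_mono_right (subset_univ (Metric.closedBall 0 √d)))).bddAbove_of_isCompact
    (isCompact_Icc.prod (isCompact_closedBall _ _))
  refine ⟨M, fun t ht x => ?_⟩
  obtain ⟨z, hz⟩ := exists_integer_translate_norm_le x
  rw [← hper t ht x z]
  exact hM ⟨(t, _), ⟨ht, by simpa using hz⟩, rfl⟩

theorem UpperSemicontinuousOn.eventually_lt_of_tendsto {ι : Type*} {l : Filter ι}
    (hu : UpperSemicontinuousOn (fun q : ℝ × 𝔼 d => u q.1 q.2) (Icc 0 T ×ˢ univ))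
    {s : ι → ℝ} {y : ι → 𝔼 d} {t : ℝ} {x : 𝔼 d} (ht : t ∈ Icc 0 T) (hs : ∀ᶠ i in l, s i ∈ Icc 0 T)
    (hst : Tendsto s l (𝓝 t)) (hyx : Tendsto y l (𝓝 x)) {c : ℝ} (hc : u t x < c) :
    ∀ᶠ i in l, u (s i) (y i) < c := by
  have h : Tendsto (fun i => (s i, y i)) l (𝓝[Icc 0 T ×ˢ univ] (t, x)) :=
    tendsto_nhdsWithin_iff.2 ⟨hst.prodMk_nhds hyx, hs.mono fun _ h => ⟨h, mem_univ _⟩⟩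
  exact h.eventually (hu (t, x) ⟨ht, mem_univ _⟩ c hc)

/-- The doubled functional has a global maximum. -/
theorem exists_max_doubled (hT : 0 < T)
    (hu : UpperSemicontinuousOn (fun q : ℝ × 𝔼 d => u q.1 q.2) (Icc 0 T ×ˢ univ))
    (hw : UpperSemicontinuousOn (fun q : ℝ × 𝔼 d => w q.1 q.2) (Icc 0 T ×ˢ univ))
    (hup : ∀ t ∈ Icc 0 T, ZPeriodic (u t)) (hwp : ∀ t ∈ Icc 0 T, ZPeriodic (w t)) :
    ∃ R, ∀ k m : ℝ, 1 ≤ k → 0 ≤ m →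
      ∃ t ∈ Icc 0 T, ∃ s ∈ Icc 0 T, ∃ x ∈ Metric.closedBall (0 : 𝔼 d) R,
        ∃ y ∈ Metric.closedBall (0 : 𝔼 d) R, ∀ t' ∈ Icc 0 T, ∀ s' ∈ Icc 0 T, ∀ x' y',
          u t' x' + w s' y' - m * (t' - s') ^ 2 - k * ‖x' - y'‖ ^ 2 ≤
            u t x + w s y - m * (t - s) ^ 2 - k * ‖x - y‖ ^ 2 := by
  obtain ⟨M, hM⟩ := hu.exists_bound_of_periodic hup
  obtain ⟨N, hN⟩ := hw.exists_bound_of_periodic hwp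
  -- If x' lies in the ball of radius √d and y' outside that of radius R, then |x' - y'| ≥ 1 + c;
  -- since k ≥ 1 the penalty exceeds c, and the functional is no larger than at the origin. Hence R
  -- does not depend on k or m.
  set c := |M + N - u 0 0 - w 0 0| with hc
  set R := √d + 1 + c with hR
  have hc0 : 0 ≤ c := abs_nonneg _
  have hd : 0 ≤ √(d : ℝ) := Real.sqrt_nonneg _
  refine ⟨R, fun k m hk hm => ?_⟩
  set Φ : ℝ × ℝ × 𝔼 d × 𝔼 d → ℝ := fun q =>
    u q.1 q.2.2.1 + w q.2.1 q.2.2.2 + (-(m * (q.1 - q.2.1) ^ 2) - k * ‖q.2.2.1 - q.2.2.2‖ ^ 2) with hΦ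
  set K : Set (ℝ × ℝ × 𝔼 d × 𝔼 d) :=
    Icc 0 T ×ˢ Icc 0 T ×ˢ Metric.closedBall 0 R ×ˢ Metric.closedBall 0 R with hK
  have hKc : IsCompact K := isCompact_Icc.prod (isCompact_Icc.prod
    ((isCompact_closedBall _ _).prod (isCompact_closedBall _ _)))
  have hΦu : UpperSemicontinuousOn Φ K := by
    have h1 : UpperSemicontinuousOn (fun q : ℝ × ℝ × 𝔼 d × 𝔼 d => u q.1 q.2.2.1) K :=
      hu.comp (g := fun q : ℝ × ℝ × 𝔼 d × 𝔼 d => (q.1, q.2.2.1)) (by fun_prop)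
        fun q hq => ⟨hq.1, mem_univ _⟩
    have h2 : UpperSemicontinuousOn (fun q : ℝ × ℝ × 𝔼 d × 𝔼 d => w q.2.1 q.2.2.2) K :=
      hw.comp (g := fun q : ℝ × ℝ × 𝔼 d × 𝔼 d => (q.2.1, q.2.2.2)) (by fun_prop)
        fun q hq => ⟨hq.2.1, mem_univ _⟩
    have h3 : UpperSemicontinuousOn (fun q : ℝ × ℝ × 𝔼 d × 𝔼 d =>
        (-(m * (q.1 - q.2.1) ^ 2) - k * ‖q.2.2.1 - q.2.2.2‖ ^ 2)) K := by
      refine ContinuousOn.upperSemicontinuousOn (Continuous.continuousOn ?_)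
      fun_prop
    exact (h1.add h2).add h3
  have h0R : 0 ≤ R := by positivity
  have hne : ((0, 0, 0, 0) : ℝ × ℝ × 𝔼 d × 𝔼 d) ∈ K := by
    simp [hK, hT.le, h0R]
  obtain ⟨⟨t, s, x, y⟩, hmem, hmax⟩ := hΦu.exists_isMaxOn ⟨_, hne⟩ hKc
  refine ⟨t, hmem.1, s, hmem.2.1, x, hmem.2.2.1, y, hmem.2.2.2, fun t' ht' s' hs' x' y' => ?_⟩
  -- Both points are translated by the same integer vector, which leaves x' - y' and the functional
  -- unchanged.
  obtain ⟨z, hz⟩ := exists_integer_translate_norm_le x'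
  set e : 𝔼 d := WithLp.toLp 2 (fun i => (z i : ℝ)) with he
  rw [← hup t' ht' x' z, ← hwp s' hs' y' z, ← he,
    show x' - y' = (x' + e) - (y' + e) by abel]
  have hx' : x' + e ∈ Metric.closedBall (0 : 𝔼 d) R := by
    simp only [mem_closedBall_zero_iff]; linarith
  by_cases hy : y' + e ∈ Metric.closedBall (0 : 𝔼 d) R
  · have : Φ (t', s', x' + e, y' + e) ≤ Φ (t, s, x, y) := hmax ⟨ht', hs', hx', hy⟩
    simp only [hΦ] at this
    linarith
  · have h1 : Φ (0, 0, 0, 0) ≤ Φ (t, s, x, y) := hmax hne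
    simp only [hΦ, sub_self, norm_zero] at h1
    have h2 : 1 + c ≤ ‖(x' + e) - (y' + e)‖ := by
      simp only [mem_closedBall_zero_iff, not_le] at hy
      have := norm_sub_norm_le (y' + e) (x' + e)
      rw [norm_sub_rev] at this
      linarith
    have h3 : c ≤ k * ‖(x' + e) - (y' + e)‖ ^ 2 := by nlinarith
    have h4 := hM t' ht' (x' + e)
    have h5 := hN s' hs' (y' + e)
    have h6 := le_abs_self (M + N - u 0 0 - w 0 0)
    have h7 : 0 ≤ m * (t' - s') ^ 2 := by positivity
    simp only [ne_eq, OfNat.ofNat_ne_zero, not_false_eq_true, zero_pow, mul_zero] at h1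
    linarith

/-- Lower bound for the sum of two Caputo integrals at a maximum of the doubled functional. -/
theorem neg_le_add_caputo_integrals {f g : ℝ → ℝ} {t s L : ℝ} (hα₀ : 0 < α) (ht : 0 < t)
    (hs : 0 < s) (hf : FracKExists α 0 f t) (hg : FracKExists α 0 g s) (hL : 0 ≤ L)
    (hfL : ∀ σ ∈ Icc 0 t, -L ≤ f t - f σ) (hgL : ∀ σ ∈ Icc 0 s, -L ≤ g s - g σ)
    (hmax : ∀ τ, 0 ≤ τ → τ ≤ t → τ ≤ s → f (t - τ) + g (s - τ) ≤ f t + g s) :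
    -(L / min t s ^ (α + 1) * |t - s|) ≤ (∫ τ in Ioc 0 t, (f t - f (t - τ)) / τ ^ (α + 1)) +
      ∫ τ in Ioc 0 s, (g s - g (s - τ)) / τ ^ (α + 1) := by
  set β := min t s with hβ
  have hβ0 : 0 < β := lt_min ht hs
  have hβp : 0 < β ^ (α + 1) := Real.rpow_pos_of_pos hβ0 _
  -- Beyond β the integrand is at least -L / β^(α+1). Only the larger of the two times has such a
  -- part, of length |t - s|.
  have split : ∀ (h : ℝ → ℝ) (r : ℝ), β ≤ r → FracKExists α 0 h r →
      (∀ σ ∈ Icc 0 r, -L ≤ h r - h σ) →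
      (∫ τ in Ioc 0 β, (h r - h (r - τ)) / τ ^ (α + 1)) - L / β ^ (α + 1) * (r - β) ≤
        ∫ τ in Ioc 0 r, (h r - h (r - τ)) / τ ^ (α + 1) := by
    intro h r hr hh hhL
    unfold FracKExists at hh
    have hun : Ioc 0 β ∪ Ioc β r = Ioc 0 r := Ioc_union_Ioc_eq_Ioc hβ0.le hr
    rw [← hun, setIntegral_union (Ioc_disjoint_Ioc_of_le le_rfl) measurableSet_Ioc
      (hh.mono_set (hun ▸ subset_union_left)) (hh.mono_set (hun ▸ subset_union_right))]
    have h1 : ∫ _τ in Ioc β r, -(L / β ^ (α + 1)) ≤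
        ∫ τ in Ioc β r, (h r - h (r - τ)) / τ ^ (α + 1) := by
      refine setIntegral_mono_on (integrable_const _) (hh.mono_set (hun ▸ subset_union_right))
        measurableSet_Ioc fun τ hτ => ?_
      have hτ0 : 0 < τ := hβ0.trans hτ.1
      have h2 := hhL (r - τ) ⟨by linarith [hτ.2], by linarith⟩
      have h3 : β ^ (α + 1) ≤ τ ^ (α + 1) := Real.rpow_le_rpow hβ0.le hτ.1.le (by linarith)
      have h4 : L / τ ^ (α + 1) ≤ L / β ^ (α + 1) := by gcongr
      have h5 : -L / τ ^ (α + 1) ≤ (h r - h (r - τ)) / τ ^ (α + 1) :=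
        div_le_div_of_nonneg_right h2 (Real.rpow_nonneg hτ0.le _)
      rw [neg_div] at h5
      linarith
    rw [setIntegral_const, measureReal_def, Real.volume_Ioc,
      ENNReal.toReal_ofReal (by linarith), smul_eq_mul] at h1
    linarith
  have h1 := split f t (min_le_left _ _) hf hfL
  have h2 := split g s (min_le_right _ _) hg hgL
  -- On the common range neither integrand has a sign, but their sum is nonnegative by `hmax`.
  have h3 : 0 ≤ (∫ τ in Ioc 0 β, (f t - f (t - τ)) / τ ^ (α + 1)) +
      ∫ τ in Ioc 0 β, (g s - g (s - τ)) / τ ^ (α + 1) := by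
    rw [← integral_add (hf.mono_set (Ioc_subset_Ioc_right (min_le_left _ _)))
      (hg.mono_set (Ioc_subset_Ioc_right (min_le_right _ _)))]
    refine setIntegral_nonneg measurableSet_Ioc fun τ hτ => ?_
    have := hmax τ hτ.1.le (hτ.2.trans (min_le_left _ _)) (hτ.2.trans (min_le_right _ _))
    rw [← add_div]
    exact div_nonneg (by linarith) (Real.rpow_nonneg hτ.1.le _)
  have h4 : |t - s| = (t - β) + (s - β) := by
    rcases le_total t s with h | h
    · rw [hβ, min_eq_left h, abs_of_nonpos (by linarith)]; ring
    · rw [hβ, min_eq_right h, abs_of_nonneg (by linarith)]; ring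
  rw [h4]
  linarith

theorem gradient_const_add_sq_norm (c k : ℝ) (x y : 𝔼 d) :
    gradient (fun z : 𝔼 d => c + k * ‖z - y‖ ^ 2) x = (2 * k) • (x - y) := by
  have h1 : HasFDerivAt (fun z : 𝔼 d => c + k * ‖z - y‖ ^ 2)
      (k • ((2 : ℝ) • (innerSL ℝ (x - y)))) x := by
    have h2 : HasFDerivAt (fun z : 𝔼 d => ‖z - y‖ ^ 2) ((2 : ℝ) • (innerSL ℝ (x - y))) x := by
      have := ((hasFDerivAt_id x).sub_const y).norm_sq
      refine this.congr_fderiv ?_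
      ext z
      simp [two_mul]
    exact (h2.const_mul k).const_add c
  rw [gradient, h1.fderiv]
  apply (InnerProductSpace.toDual ℝ (𝔼 d)).injective
  ext z
  simp [mul_comm, mul_assoc]


theorem isTestFunction_quadratic (T c m k s : ℝ) (y : 𝔼 d) :
    IsTestFunction T fun (t : ℝ) (x : 𝔼 d) => (c + m * (t - s) ^ 2) + k * ‖x - y‖ ^ 2 := by
  apply IsTestFunction.of_contDiff
  have h : ContDiff ℝ 1 fun q : ℝ × 𝔼 d => ‖q.2 - y‖ ^ 2 :=
    (contDiff_snd.sub contDiff_const).norm_sq ℝ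
  have h' : ContDiff ℝ 1 fun q : ℝ × 𝔼 d => (q.1 - s) ^ 2 :=
    (contDiff_fst.sub contDiff_const).pow 2
  exact (contDiff_const.add (contDiff_const.mul h')).add (contDiff_const.mul h)

/-- The viscosity inequalities at a maximum of the doubled functional, combined. -/
theorem doubled_inequality (hα₀ : 0 < α) (hα₁ : α < 1) (hT : 0 < T)
    (hu : CaputoSubsolution α T H u) (hw : CaputoSubsolution α T (dualHamiltonian H) w)
    {k m L t s : ℝ} {x y : 𝔼 d} (ht : t ∈ Ioc 0 T) (hs : s ∈ Ioc 0 T) (hL : 0 ≤ L)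
    (huL : ∀ σ ∈ Icc 0 T, -L ≤ u t x - u σ x) (hwL : ∀ σ ∈ Icc 0 T, -L ≤ w s y - w σ y)
    (hmax : ∀ t' ∈ Icc 0 T, ∀ s' ∈ Icc 0 T, ∀ x' y',
          u t' x' + w s' y' - m * (t' - s') ^ 2 - k * ‖x' - y'‖ ^ 2 ≤
            u t x + w s y - m * (t - s) ^ 2 - k * ‖x - y‖ ^ 2) :
    (u t x - u 0 x) / (t ^ α * Real.Gamma (1 - α)) +
      (w s y - w 0 y) / (s ^ α * Real.Gamma (1 - α)) -
      α / Real.Gamma (1 - α) * (L / min t s ^ (α + 1) * |t - s|) +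
      H t x (u t x) ((2 * k) • (x - y)) - H s y (-w s y) ((2 * k) • (x - y)) ≤ 0 := by
  have hΓ : 0 < Real.Gamma (1 - α) := Real.Gamma_pos_of_pos (by linarith)
  have ht' : t ∈ Icc 0 T := ⟨ht.1.le, ht.2⟩
  have hs' : s ∈ Icc 0 T := ⟨hs.1.le, hs.2⟩
  -- With (s,y) frozen, the penalty is a test function for u at (t,x); with (t,x) frozen, it is one
  -- for w at (s,y).
  obtain ⟨hu1, hu2⟩ := hu 0 T le_rfl hT le_rfl x 1 one_pos _
    (isTestFunction_quadratic T 0 m k s y) t ht x (Metric.mem_ball_self one_pos)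
    fun t₁ ht₁ x₁ _ => by
      have := hmax t₁ ht₁ s hs' x₁ y
      linarith
  obtain ⟨hw1, hw2⟩ := hw 0 T le_rfl hT le_rfl y 1 one_pos _
    (isTestFunction_quadratic T 0 m k t x) s hs y (Metric.mem_ball_self one_pos)
    fun s₁ hs₁ y₁ _ => by
      have := hmax t ht' s₁ hs₁ x y₁
      rw [norm_sub_rev y₁ x, norm_sub_rev y x]
      nlinarith
  rw [gradient_const_add_sq_norm] at hu2 hw2
  -- The penalty has gradient 2k(y - x) in y; the sign in the dual Hamiltonian makes both equations
  -- see the same momentum 2k(x - y).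
  simp only [dualHamiltonian, ← smul_neg, neg_sub] at hw2
  have hI := neg_le_add_caputo_integrals (f := fun σ => u σ x) (g := fun σ => w σ y) hα₀ ht.1 hs.1
    hu1 hw1 hL (fun σ hσ => huL σ ⟨hσ.1, hσ.2.trans ht.2⟩)
    (fun σ hσ => hwL σ ⟨hσ.1, hσ.2.trans hs.2⟩) fun τ h0 h1 h2 => by
      -- A common shift of both times does not change (t - s)².
      have := hmax (t - τ) ⟨by linarith, by linarith [ht.2]⟩ (s - τ)
        ⟨by linarith, by linarith [hs.2]⟩ x y
      rw [sub_sub_sub_cancel_right] at this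
      linarith
  have hI' := mul_le_mul_of_nonneg_left hI (show 0 ≤ α / Real.Gamma (1 - α) by positivity)
  unfold fracK at hu2 hw2
  rw [mul_add] at hI'
  linarith

/-- The limit of the doubled inequalities as the penalisation in time becomes infinite. -/
theorem doubled_limit (hα₀ : 0 < α) (hα₁ : α < 1) (hT : 0 < T)
    (hHc : ContinuousOn (fun q : ℝ × 𝔼 d × ℝ × 𝔼 d => H q.1 q.2.1 q.2.2.1 q.2.2.2)
      (Icc 0 T ×ˢ univ))
    (hu : CaputoSubsolution α T H u) (hw : CaputoSubsolution α T (dualHamiltonian H) w)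
    (husc : UpperSemicontinuousOn (fun q : ℝ × 𝔼 d => u q.1 q.2) (Icc 0 T ×ˢ univ))
    (hwsc : UpperSemicontinuousOn (fun q : ℝ × 𝔼 d => w q.1 q.2) (Icc 0 T ×ˢ univ))
    (hup : ∀ t ∈ Icc 0 T, ZPeriodic (u t)) (hwp : ∀ t ∈ Icc 0 T, ZPeriodic (w t))
    {k R : ℝ}
    (hR : ∀ m : ℝ, 0 ≤ m →
      ∃ t ∈ Icc 0 T, ∃ s ∈ Icc 0 T, ∃ x ∈ Metric.closedBall (0 : 𝔼 d) R,
        ∃ y ∈ Metric.closedBall (0 : 𝔼 d) R, ∀ t' ∈ Icc 0 T, ∀ s' ∈ Icc 0 T, ∀ x' y',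
          u t' x' + w s' y' - m * (t' - s') ^ 2 - k * ‖x' - y'‖ ^ 2 ≤
            u t x + w s y - m * (t - s) ^ 2 - k * ‖x - y‖ ^ 2) :
    ∃ t ∈ Icc 0 T, ∃ x ∈ Metric.closedBall (0 : 𝔼 d) R, ∃ y ∈ Metric.closedBall (0 : 𝔼 d) R,
      (∀ t' ∈ Icc 0 T, ∀ x' y', u t' x' + w t' y' - k * ‖x' - y'‖ ^ 2 ≤
        u t x + w t y - k * ‖x - y‖ ^ 2) ∧
      (0 < t → (u t x - u 0 x + (w t y - w 0 y)) / (t ^ α * Real.Gamma (1 - α)) +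
        H t x (u t x) ((2 * k) • (x - y)) - H t y (-w t y) ((2 * k) • (x - y)) ≤ 0) := by
  obtain ⟨M, hM⟩ := husc.exists_bound_of_periodic hup
  obtain ⟨N, hN⟩ := hwsc.exists_bound_of_periodic hwp
  choose t ht s hs x hx y hy hmax using fun n : ℕ => hR n n.cast_nonneg
  have hKc : IsCompact (Icc 0 T ×ˢ Icc 0 T ×ˢ Metric.closedBall (0 : 𝔼 d) R ×ˢ
      Metric.closedBall (0 : 𝔼 d) R) := isCompact_Icc.prod (isCompact_Icc.prod
    ((isCompact_closedBall _ _).prod (isCompact_closedBall _ _)))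
  obtain ⟨⟨t₀, s₀, x₀, y₀⟩, hmem, σ, hσ, hlim⟩ :=
    hKc.tendsto_subseq (x := fun n => (t n, s n, x n, y n)) fun n => ⟨ht n, hs n, hx n, hy n⟩
  have hσ' : Tendsto (fun n => ((σ n : ℕ) : ℝ)) atTop atTop :=
    tendsto_natCast_atTop_atTop.comp hσ.tendsto_atTop
  have hlt : Tendsto (fun n => t (σ n)) atTop (𝓝 t₀) := hlim.fst_nhds
  have hls : Tendsto (fun n => s (σ n)) atTop (𝓝 s₀) := hlim.snd_nhds.fst_nhds
  have hlx : Tendsto (fun n => x (σ n)) atTop (𝓝 x₀) := hlim.snd_nhds.snd_nhds.fst_nhds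
  have hly : Tendsto (fun n => y (σ n)) atTop (𝓝 y₀) := hlim.snd_nhds.snd_nhds.snd_nhds
  have hxy : Tendsto (fun n => k * ‖x (σ n) - y (σ n)‖ ^ 2) atTop (𝓝 (k * ‖x₀ - y₀‖ ^ 2)) :=
    ((hlx.sub hly).norm.pow 2).const_mul k
  -- Comparison with the value at the origin bounds m (t - s)², which would blow up if the limits
  -- differed.
  obtain rfl : t₀ = s₀ := by
    by_contra hne
    have h1 : Tendsto (fun n => (σ n : ℝ) * (t (σ n) - s (σ n)) ^ 2) atTop atTop :=
      hσ'.atTop_mul_pos (show 0 < (t₀ - s₀) ^ 2 by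
        have := sub_ne_zero.2 hne; positivity) ((hlt.sub hls).pow 2)
    obtain ⟨n, hn1, hn2⟩ := ((h1.eventually_gt_atTop
      (M + N - u 0 0 - w 0 0 - k * ‖x₀ - y₀‖ ^ 2 + 1)).and
      (hxy.eventually_const_lt (show k * ‖x₀ - y₀‖ ^ 2 - 1 < k * ‖x₀ - y₀‖ ^ 2 by linarith))).exists
    have h2 := hmax (σ n) 0 ⟨le_rfl, hT.le⟩ 0 ⟨le_rfl, hT.le⟩ 0 0
    simp only [sub_self, norm_zero, ne_eq, OfNat.ofNat_ne_zero, not_false_eq_true, zero_pow,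
      mul_zero] at h2
    have h3 := hM _ (ht (σ n)) (x (σ n))
    have h4 := hN _ (hs (σ n)) (y (σ n))
    linarith
  have ht₀ : t₀ ∈ Icc 0 T := hmem.1
  have hT0 : (0 : ℝ) ∈ Icc 0 T := ⟨le_rfl, hT.le⟩
  have hu_t : ∀ e > 0, ∀ᶠ n in atTop, u (t (σ n)) (x (σ n)) < u t₀ x₀ + e := fun e he =>
    husc.eventually_lt_of_tendsto ht₀ (Eventually.of_forall fun n => ht _) hlt hlx (by linarith)
  have hw_t : ∀ e > 0, ∀ᶠ n in atTop, w (s (σ n)) (y (σ n)) < w t₀ y₀ + e := fun e he =>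
    hwsc.eventually_lt_of_tendsto ht₀ (Eventually.of_forall fun n => hs _) hls hly (by linarith)
  have hu_0 : ∀ e > 0, ∀ᶠ n in atTop, u 0 (x (σ n)) < u 0 x₀ + e := fun e he =>
    husc.eventually_lt_of_tendsto hT0 (Eventually.of_forall fun n => hT0) tendsto_const_nhds hlx
      (by linarith)
  have hw_0 : ∀ e > 0, ∀ᶠ n in atTop, w 0 (y (σ n)) < w 0 y₀ + e := fun e he =>
    hwsc.eventually_lt_of_tendsto hT0 (Eventually.of_forall fun n => hT0) tendsto_const_nhds hly
      (by linarith)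
  have hdiag : ∀ n, ∀ t' ∈ Icc 0 T, ∀ x' y', u t' x' + w t' y' - k * ‖x' - y'‖ ^ 2 ≤
      u (t (σ n)) (x (σ n)) + w (s (σ n)) (y (σ n)) - k * ‖x (σ n) - y (σ n)‖ ^ 2 := by
    intro n t' ht' x' y'
    have h1 := hmax (σ n) t' ht' t' ht' x' y'
    have h2 : 0 ≤ (σ n : ℝ) * (t (σ n) - s (σ n)) ^ 2 := by positivity
    rw [sub_self] at h1
    linarith
  -- Semicontinuity bounds each of the two values from above in the limit, and `hdiag` bounds their
  -- sum from below; so both converge, although u and w are only semicontinuous.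
  have hux : Tendsto (fun n => u (t (σ n)) (x (σ n))) atTop (𝓝 (u t₀ x₀)) := by
    refine tendsto_order.2 ⟨fun c hc => ?_, fun c hc => ?_⟩
    · set e := (u t₀ x₀ - c) / 3 with he
      have he0 : 0 < e := by linarith
      filter_upwards [hw_t e he0, hxy.eventually_const_lt
        (show k * ‖x₀ - y₀‖ ^ 2 - e < k * ‖x₀ - y₀‖ ^ 2 by linarith)] with n h1 h2
      have := hdiag n t₀ ht₀ x₀ y₀
      linarith
    · filter_upwards [hu_t (c - u t₀ x₀) (by linarith)] with n h1
      linarith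
  have hwy : Tendsto (fun n => w (s (σ n)) (y (σ n))) atTop (𝓝 (w t₀ y₀)) := by
    refine tendsto_order.2 ⟨fun c hc => ?_, fun c hc => ?_⟩
    · set e := (w t₀ y₀ - c) / 3 with he
      have he0 : 0 < e := by linarith
      filter_upwards [hu_t e he0, hxy.eventually_const_lt
        (show k * ‖x₀ - y₀‖ ^ 2 - e < k * ‖x₀ - y₀‖ ^ 2 by linarith)] with n h1 h2
      have := hdiag n t₀ ht₀ x₀ y₀
      linarith
    · filter_upwards [hw_t (c - w t₀ y₀) (by linarith)] with n h1
      linarith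
  refine ⟨t₀, ht₀, x₀, hmem.2.2.1, y₀, hmem.2.2.2, fun t' ht' x' y' => ?_, fun hpos => ?_⟩
  · exact ge_of_tendsto ((hux.add hwy).sub hxy) (Eventually.of_forall fun n => hdiag n t' ht' x' y')
  have hΓ : 0 < Real.Gamma (1 - α) := Real.Gamma_pos_of_pos (by linarith)
  set Γ := Real.Gamma (1 - α) with hΓd
  have htα : 0 < t₀ ^ α * Γ := mul_pos (Real.rpow_pos_of_pos hpos _) hΓ
  -- The summand 1 absorbs the error of the approximating values, so that one L serves all large n.
  set L := max (M - u t₀ x₀ + 1) (max (N - w t₀ y₀ + 1) 0) with hL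
  have hL1 : M - u t₀ x₀ + 1 ≤ L := le_max_left _ _
  have hL2 : N - w t₀ y₀ + 1 ≤ L := (le_max_left _ _).trans (le_max_right _ _)
  have hL0 : 0 ≤ L := (le_max_right _ _).trans (le_max_right _ _)
  have hp : Tendsto (fun n => (2 * k) • (x (σ n) - y (σ n))) atTop (𝓝 ((2 * k) • (x₀ - y₀))) :=
    (hlx.sub hly).const_smul _
  have hH1 : Tendsto (fun n => H (t (σ n)) (x (σ n)) (u (t (σ n)) (x (σ n)))
      ((2 * k) • (x (σ n) - y (σ n)))) atTop (𝓝 (H t₀ x₀ (u t₀ x₀) ((2 * k) • (x₀ - y₀)))) :=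
    (hHc (t₀, x₀, u t₀ x₀, (2 * k) • (x₀ - y₀)) ⟨ht₀, mem_univ _⟩).tendsto.comp
      (tendsto_nhdsWithin_iff.2 ⟨hlt.prodMk_nhds (hlx.prodMk_nhds (hux.prodMk_nhds hp)),
        Eventually.of_forall fun n => ⟨ht _, mem_univ _⟩⟩)
  have hH2 : Tendsto (fun n => H (s (σ n)) (y (σ n)) (-w (s (σ n)) (y (σ n)))
      ((2 * k) • (x (σ n) - y (σ n)))) atTop (𝓝 (H t₀ y₀ (-w t₀ y₀) ((2 * k) • (x₀ - y₀)))) :=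
    (hHc (t₀, y₀, -w t₀ y₀, (2 * k) • (x₀ - y₀)) ⟨ht₀, mem_univ _⟩).tendsto.comp
      (tendsto_nhdsWithin_iff.2 ⟨hls.prodMk_nhds (hly.prodMk_nhds (hwy.neg.prodMk_nhds hp)),
        Eventually.of_forall fun n => ⟨hs _, mem_univ _⟩⟩)
  -- The initial values are only upper semicontinuous along the sequence, hence the slack e. The
  -- remainder term is kept in its limiting form, where |t₀ - t₀| = 0.
  have hmain : ∀ e > 0, (u t₀ x₀ - (u 0 x₀ + e)) / (t₀ ^ α * Γ) +
      (w t₀ y₀ - (w 0 y₀ + e)) / (t₀ ^ α * Γ) -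
      α / Γ * (L / min t₀ t₀ ^ (α + 1) * |t₀ - t₀|) +
      H t₀ x₀ (u t₀ x₀) ((2 * k) • (x₀ - y₀)) - H t₀ y₀ (-w t₀ y₀) ((2 * k) • (x₀ - y₀)) ≤ 0 := by
    intro e he
    have hlimit := (((((hux.sub_const (u 0 x₀ + e)).div
      ((hlt.rpow_const (Or.inl hpos.ne') (p := α)).mul_const Γ) htα.ne').add
      ((hwy.sub_const (w 0 y₀ + e)).div
      ((hls.rpow_const (Or.inl hpos.ne') (p := α)).mul_const Γ) htα.ne')).sub
      ((((tendsto_const_nhds (x := L)).div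
        ((hlt.min hls).rpow_const (Or.inl (by simpa using hpos.ne')) (p := α + 1))
        (Real.rpow_pos_of_pos (lt_min hpos hpos) _).ne').mul (hlt.sub hls).abs).const_mul
          (α / Γ))).add hH1).sub hH2
    refine le_of_tendsto hlimit ?_
    filter_upwards [hlt.eventually_const_lt hpos, hls.eventually_const_lt hpos,
      hu_0 e he, hw_0 e he,
      hux.eventually_const_lt (show u t₀ x₀ - 1 < u t₀ x₀ by linarith),
      hwy.eventually_const_lt (show w t₀ y₀ - 1 < w t₀ y₀ by linarith)] with n h1 h2 h3 h4 h5 h6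
    have h := doubled_inequality hα₀ hα₁ hT hu hw ⟨h1, (ht (σ n)).2⟩ ⟨h2, (hs (σ n)).2⟩ hL0
      (fun r hr => by have := hM r hr (x (σ n)); linarith)
      (fun r hr => by have := hN r hr (y (σ n)); linarith) (hmax (σ n))
    rw [← hΓd] at h
    have h7 : 0 < t (σ n) ^ α * Γ := mul_pos (Real.rpow_pos_of_pos h1 _) hΓ
    have h8 : 0 < s (σ n) ^ α * Γ := mul_pos (Real.rpow_pos_of_pos h2 _) hΓ
    have h9 : (u (t (σ n)) (x (σ n)) - (u 0 x₀ + e)) / (t (σ n) ^ α * Γ) ≤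
        (u (t (σ n)) (x (σ n)) - u 0 (x (σ n))) / (t (σ n) ^ α * Γ) :=
      div_le_div_of_nonneg_right (by linarith) h7.le
    have h10 : (w (s (σ n)) (y (σ n)) - (w 0 y₀ + e)) / (s (σ n) ^ α * Γ) ≤
        (w (s (σ n)) (y (σ n)) - w 0 (y (σ n))) / (s (σ n) ^ α * Γ) :=
      div_le_div_of_nonneg_right (by linarith) h8.le
    simp only [Pi.div_apply]
    linarith
  refine le_of_forall_pos_le_add fun e he => ?_
  have h := hmain (e * (t₀ ^ α * Γ) / 2) (by positivity)
  rw [sub_self, abs_zero, mul_zero, mul_zero, sub_zero, ← add_div] at h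
  have h' : (u t₀ x₀ - (u 0 x₀ + e * (t₀ ^ α * Γ) / 2) + (w t₀ y₀ - (w 0 y₀ + e * (t₀ ^ α * Γ) / 2)))
      / (t₀ ^ α * Γ) = (u t₀ x₀ - u 0 x₀ + (w t₀ y₀ - w 0 y₀)) / (t₀ ^ α * Γ) - e := by
    field_simp; ring
  rw [h'] at h
  linarith


/-- Comparison: a subsolution lies below a supersolution if it does so initially. -/
theorem comparison_of_initial_le (hα₀ : 0 < α) (hα₁ : α < 1) (hT : 0 < T)
    (hHc : ContinuousOn (fun q : ℝ × 𝔼 d × ℝ × 𝔼 d => H q.1 q.2.1 q.2.2.1 q.2.2.2)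
      (Icc 0 T ×ˢ univ))
    (hHω : ∃ ω : ℝ → ℝ, IsModulus ω ∧ ∀ t ∈ Icc 0 T, ∀ (x y : 𝔼 d) (r : ℝ) (p : 𝔼 d),
        |H t x r p - H t y r p| ≤ ω (‖x - y‖ * (1 + ‖p‖)))
    (hHm : ∀ t ∈ Icc 0 T, ∀ x p : 𝔼 d, Monotone fun r => H t x r p)
    (hu : IsViscositySubsolution α T H u) (hv : IsViscositySupersolution α T H v)
    (h0 : ∀ x, u 0 x ≤ v 0 x) : ∀ t ∈ Icc 0 T, ∀ x, u t x ≤ v t x := by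
  obtain ⟨ω, ⟨-, -, hω⟩, hHω⟩ := hHω
  have hw := isViscositySubsolution_neg_iff.2 hv
  set w : ℝ → 𝔼 d → ℝ := fun t x => -v t x with hwdef
  have hΓ : 0 < Real.Gamma (1 - α) := Real.Gamma_pos_of_pos (by linarith)
  intro t₁ ht₁ x₁
  by_contra hlt
  set θ := u t₁ x₁ - v t₁ x₁ with hθ
  have hθ0 : 0 < θ := by linarith [not_le.1 hlt]
  obtain ⟨M, hM⟩ := hu.2.1.exists_bound_of_periodic hu.1
  obtain ⟨N, hN⟩ := hw.2.1.exists_bound_of_periodic hw.1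
  obtain ⟨R, hR⟩ := exists_max_doubled hT hu.2.1 hw.2.1 hu.1 hw.1
  have hk1 : ∀ n : ℕ, (1 : ℝ) ≤ (n : ℝ) + 1 := fun n => by linarith [n.cast_nonneg (α := ℝ)]
  choose t ht x hx y hy hmax hineq using fun n : ℕ =>
    doubled_limit hα₀ hα₁ hT hHc (hu.caputoSubsolution hα₀ hα₁) (hw.caputoSubsolution hα₀ hα₁)
      hu.2.1 hw.2.1 hu.1 hw.1 (k := (n : ℝ) + 1) (R := R) fun m hm => hR _ m (hk1 n) hm
  have hKc : IsCompact (Icc 0 T ×ˢ Metric.closedBall (0 : 𝔼 d) R) :=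
    isCompact_Icc.prod (isCompact_closedBall _ _)
  obtain ⟨⟨t₀, x₀⟩, hmem, σ, hσ, hlim⟩ :=
    hKc.tendsto_subseq (x := fun n => (t n, x n)) fun n => ⟨ht n, hx n⟩
  have hσ' : Tendsto (fun n => ((σ n : ℕ) : ℝ) + 1) atTop atTop :=
    tendsto_atTop_add_const_right _ _ (tendsto_natCast_atTop_atTop.comp hσ.tendsto_atTop)
  have hlt : Tendsto (fun n => t (σ n)) atTop (𝓝 t₀) := hlim.fst_nhds
  have hlx : Tendsto (fun n => x (σ n)) atTop (𝓝 x₀) := hlim.snd_nhds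
  have hΨ : ∀ n, θ ≤ u (t (σ n)) (x (σ n)) + w (t (σ n)) (y (σ n)) -
      ((σ n : ℝ) + 1) * ‖x (σ n) - y (σ n)‖ ^ 2 := fun n => by
    have := hmax (σ n) t₁ ht₁ x₁ x₁
    simp only [sub_self, norm_zero, ne_eq, OfNat.ofNat_ne_zero, not_false_eq_true, zero_pow,
      mul_zero, hwdef] at this
    linarith
  have hsq : Tendsto (fun n => ‖x (σ n) - y (σ n)‖ ^ 2) atTop (𝓝 0) := by
    have h1 : Tendsto (fun n => (M + N - θ) / ((σ n : ℝ) + 1)) atTop (𝓝 0) :=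
      tendsto_const_nhds.div_atTop hσ'
    refine squeeze_zero (fun n => by positivity) (fun n => ?_) h1
    rw [le_div_iff₀ (by positivity)]
    have h2 := hM _ (ht (σ n)) (x (σ n))
    have h3 := hN _ (ht (σ n)) (y (σ n))
    linarith [hΨ n]
  have hnorm : Tendsto (fun n => ‖x (σ n) - y (σ n)‖) atTop (𝓝 0) := by
    have := hsq.sqrt
    simpa using this
  have hly : Tendsto (fun n => y (σ n)) atTop (𝓝 x₀) := by
    have := hlx.sub (tendsto_zero_iff_norm_tendsto_zero.2 hnorm)
    simpa using this
  have hT0 : (0 : ℝ) ∈ Icc 0 T := ⟨le_rfl, hT.le⟩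
  -- The maximal value is at least u + w at the limit point, while semicontinuity makes the limit
  -- superior of u + w at most that; nothing is left for the penalty.
  have hpen : Tendsto (fun n => ((σ n : ℝ) + 1) * ‖x (σ n) - y (σ n)‖ ^ 2) atTop (𝓝 0) := by
    refine tendsto_order.2 ⟨fun c hc => Eventually.of_forall fun n => hc.trans_le (by positivity),
      fun c hc => ?_⟩
    filter_upwards [hu.2.1.eventually_lt_of_tendsto hmem.1 (Eventually.of_forall fun n => ht _) hlt
      hlx (show u t₀ x₀ < u t₀ x₀ + c / 2 by linarith),
      hw.2.1.eventually_lt_of_tendsto hmem.1 (Eventually.of_forall fun n => ht _) hlt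
      hly (show w t₀ x₀ < w t₀ x₀ + c / 2 by linarith)] with n h1 h2
    have := hmax (σ n) t₀ hmem.1 x₀ x₀
    simp only [sub_self, norm_zero, ne_eq, OfNat.ofNat_ne_zero, not_false_eq_true, zero_pow,
      mul_zero] at this
    linarith
  have hωarg : Tendsto (fun n => ‖y (σ n) - x (σ n)‖ *
      (1 + ‖(2 * ((σ n : ℝ) + 1)) • (x (σ n) - y (σ n))‖)) atTop (𝓝[≥] 0) := by
    refine tendsto_nhdsWithin_iff.2 ⟨?_, Eventually.of_forall fun n => mem_Ici.2 (by positivity)⟩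
    have := hnorm.add (hpen.const_mul 2)
    rw [mul_zero, add_zero] at this
    refine this.congr fun n => ?_
    rw [norm_smul, Real.norm_of_nonneg (by positivity), norm_sub_rev (y _)]
    ring
  have hω0 := hω.comp hωarg
  have hTα : 0 < T ^ α * Real.Gamma (1 - α) := mul_pos (Real.rpow_pos_of_pos hT _) hΓ
  have hu0 : u 0 x₀ + w 0 x₀ ≤ 0 := by simp only [hwdef]; linarith [h0 x₀]
  -- One n for which both initial values are within θ / 4 of their bounds at x₀ and the modulus is
  -- smaller than the gain in the time term.
  obtain ⟨n, h1, h2, h3⟩ := ((hu.2.1.eventually_lt_of_tendsto hT0 (Eventually.of_forall fun _ => hT0)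
      tendsto_const_nhds hlx (show u 0 x₀ < u 0 x₀ + θ / 4 by linarith)).and
      ((hw.2.1.eventually_lt_of_tendsto hT0 (Eventually.of_forall fun _ => hT0)
      tendsto_const_nhds hly (show w 0 x₀ < w 0 x₀ + θ / 4 by linarith)).and
      (hω0.eventually_lt_const (show 0 < θ / 2 / (T ^ α * Real.Gamma (1 - α)) by
        positivity)))).exists
  have hpos_pen : 0 ≤ ((σ n : ℝ) + 1) * ‖x (σ n) - y (σ n)‖ ^ 2 := by positivity
  have hΨn := hΨ n
  -- At time 0 the doubled value would be less than θ / 2, against the lower bound θ.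
  have htpos : 0 < t (σ n) := by
    refine lt_of_le_of_ne (ht (σ n)).1 fun h => ?_
    rw [← h] at hΨn
    linarith
  have h4 := hineq (σ n) htpos
  have h5 : θ / 2 / (T ^ α * Real.Gamma (1 - α)) ≤
      (u (t (σ n)) (x (σ n)) - u 0 (x (σ n)) + (w (t (σ n)) (y (σ n)) - w 0 (y (σ n)))) /
        (t (σ n) ^ α * Real.Gamma (1 - α)) := by
    have h6 : t (σ n) ^ α ≤ T ^ α := Real.rpow_le_rpow htpos.le (ht _).2 hα₀.le
    have h7 : 0 < t (σ n) ^ α := Real.rpow_pos_of_pos htpos _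
    have h8 : 0 < t (σ n) ^ α * Real.Gamma (1 - α) := by positivity
    have h9 : θ / 2 ≤ u (t (σ n)) (x (σ n)) - u 0 (x (σ n)) +
      (w (t (σ n)) (y (σ n)) - w 0 (y (σ n))) := by linarith
    calc θ / 2 / (T ^ α * Real.Gamma (1 - α)) ≤ θ / 2 / (t (σ n) ^ α * Real.Gamma (1 - α)) := by
          gcongr
      _ ≤ _ := div_le_div_of_nonneg_right h9 h8.le
  -- Here v ≤ u at the maximum, so monotonicity replaces v by u in H at y; the modulus of continuity
  -- then moves y to x.
  have h6 := hHm _ (ht (σ n)) (y (σ n)) ((2 * ((σ n : ℝ) + 1)) • (x (σ n) - y (σ n)))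
    (show -w (t (σ n)) (y (σ n)) ≤ u (t (σ n)) (x (σ n)) by linarith)
  have h7 := hHω _ (ht (σ n)) (y (σ n)) (x (σ n)) (u (t (σ n)) (x (σ n)))
    ((2 * ((σ n : ℝ) + 1)) • (x (σ n) - y (σ n)))
  have h8 := le_abs_self (H (t (σ n)) (y (σ n)) (u (t (σ n)) (x (σ n)))
    ((2 * ((σ n : ℝ) + 1)) • (x (σ n) - y (σ n))) - H (t (σ n)) (x (σ n)) (u (t (σ n)) (x (σ n)))
    ((2 * ((σ n : ℝ) + 1)) • (x (σ n) - y (σ n))))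
  simp only [Function.comp_apply] at h3
  simp only at h6
  linarith

end

/-! ### Upper envelopes and their stability -/

section
variable {d : ℕ}
local notation:max "𝔼" d:max => EuclideanSpace ℝ (Fin d)

/-- The upper semicontinuous envelope, on `[0,T] × ℝ^d`, of the supremum of a family. -/
noncomputable def upperEnvelope (T : ℝ) (F : Set (ℝ → 𝔼 d → ℝ)) : ℝ → 𝔼 d → ℝ := fun t x =>
  sInf {c | ∀ᶠ q in 𝓝[Icc 0 T ×ˢ univ] (t, x), ∀ w ∈ F, w q.1 q.2 ≤ c}

variable {α T M : ℝ} {H : ℝ → 𝔼 d → ℝ → 𝔼 d → ℝ} {F : Set (ℝ → 𝔼 d → ℝ)}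

theorem mem_lowerBounds_of_mem {t : ℝ} (ht : t ∈ Icc 0 T) (x : 𝔼 d) {w : ℝ → 𝔼 d → ℝ}
    (hw : w ∈ F) :
    w t x ∈ lowerBounds {c | ∀ᶠ q in 𝓝[Icc 0 T ×ˢ univ] (t, x), ∀ w ∈ F, w q.1 q.2 ≤ c} :=
  fun c hc => Eventually.self_of_nhdsWithin (p := fun q : ℝ × 𝔼 d => ∀ w ∈ F, w q.1 q.2 ≤ c) hc
    (show (t, x) ∈ Icc 0 T ×ˢ univ from ⟨ht, mem_univ _⟩) w hw

theorem le_upperEnvelope (hM : ∀ w ∈ F, ∀ t ∈ Icc 0 T, ∀ x, w t x ≤ M) {w : ℝ → 𝔼 d → ℝ}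
    (hw : w ∈ F) {t : ℝ} (ht : t ∈ Icc 0 T) (x : 𝔼 d) : w t x ≤ upperEnvelope T F t x := by
  refine le_csInf ⟨M, ?_⟩ (mem_lowerBounds_of_mem ht x hw)
  filter_upwards [self_mem_nhdsWithin] with q hq w hw using hM w hw q.1 hq.1 q.2

theorem frequently_of_lt_upperEnvelope (hF : F.Nonempty) {t : ℝ} (ht : t ∈ Icc 0 T) {x : 𝔼 d}
    {c : ℝ} (hc : c < upperEnvelope T F t x) :
    ∃ᶠ q in 𝓝[Icc 0 T ×ˢ univ] (t, x), ∃ w ∈ F, c < w q.1 q.2 := by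
  intro h
  have : upperEnvelope T F t x ≤ c := by
    obtain ⟨w, hw⟩ := hF
    refine csInf_le ⟨_, mem_lowerBounds_of_mem ht x hw⟩ ?_
    filter_upwards [h] with q hq w hw
    by_contra hlt
    exact hq ⟨w, hw, not_le.1 hlt⟩
  exact absurd hc (not_lt.2 this)

/-- With `le_upperEnvelope` this makes the envelope the least upper semicontinuous majorant, the
property through which it is compared with barriers and translates. -/
theorem upperEnvelope_le (hF : F.Nonempty) {g : ℝ → 𝔼 d → ℝ}
    (hg : UpperSemicontinuousOn (fun q : ℝ × 𝔼 d => g q.1 q.2) (Icc 0 T ×ˢ univ))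
    (h : ∀ w ∈ F, ∀ t ∈ Icc 0 T, ∀ x, w t x ≤ g t x) {t : ℝ} (ht : t ∈ Icc 0 T) (x : 𝔼 d) :
    upperEnvelope T F t x ≤ g t x := by
  by_contra hlt
  obtain ⟨c, hc1, hc2⟩ := exists_between (not_le.1 hlt)
  obtain ⟨q, ⟨⟨w, hw, hwq⟩, hgq⟩, hq⟩ := ((frequently_of_lt_upperEnvelope hF ht hc2).and_eventually
    (hg (t, x) ⟨ht, mem_univ _⟩ c hc1)).and_eventually self_mem_nhdsWithin |>.exists
  have := h w hw q.1 hq.1 q.2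
  linarith

theorem upperSemicontinuousOn_upperEnvelope (hF : F.Nonempty)
    (hM : ∀ w ∈ F, ∀ t ∈ Icc 0 T, ∀ x, w t x ≤ M) :
    UpperSemicontinuousOn (fun q : ℝ × 𝔼 d => upperEnvelope T F q.1 q.2) (Icc 0 T ×ˢ univ) := by
  rintro ⟨t, x⟩ hq c hc
  have hne : {c | ∀ᶠ q in 𝓝[Icc 0 T ×ˢ univ] (t, x), ∀ w ∈ F, w q.1 q.2 ≤ c}.Nonempty := by
    refine ⟨M, ?_⟩
    filter_upwards [self_mem_nhdsWithin] with q hq w hw using hM w hw q.1 hq.1 q.2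
  obtain ⟨e, he, hec⟩ := exists_lt_of_csInf_lt hne hc
  filter_upwards [eventually_eventually_nhdsWithin.2 he, self_mem_nhdsWithin] with p hp hpD
  refine lt_of_le_of_lt (csInf_le ?_ hp) hec
  obtain ⟨w, hw⟩ := hF
  exact ⟨_, mem_lowerBounds_of_mem hpD.1 p.2 hw⟩

/-- The family is invariant under translations, so a translate of the envelope is again an upper
semicontinuous majorant and dominates it; the opposite translation gives equality. -/
theorem zPeriodic_upperEnvelope (hF : F.Nonempty)
    (hM : ∀ w ∈ F, ∀ t ∈ Icc 0 T, ∀ x, w t x ≤ M)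
    (hper : ∀ w ∈ F, ∀ z : Fin d → ℤ, ∃ w' ∈ F, ∀ t ∈ Icc 0 T, ∀ x,
      w t (x + WithLp.toLp 2 (fun i => (z i : ℝ))) = w' t x) :
    ∀ t ∈ Icc 0 T, ZPeriodic (upperEnvelope T F t) := by
  have key : ∀ t ∈ Icc 0 T, ∀ (x : 𝔼 d) (z : Fin d → ℤ),
      upperEnvelope T F t x ≤
        upperEnvelope T F t (x - WithLp.toLp 2 (fun i => (z i : ℝ))) := by
    intro t ht x z
    have husc : UpperSemicontinuousOn (fun q : ℝ × 𝔼 d =>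
        upperEnvelope T F q.1 (q.2 - WithLp.toLp 2 (fun i => (z i : ℝ)))) (Icc 0 T ×ˢ univ) :=
      (upperSemicontinuousOn_upperEnvelope hF hM).comp
        (g := fun q : ℝ × 𝔼 d => (q.1, q.2 - WithLp.toLp 2 (fun i => (z i : ℝ))))
        (by fun_prop) fun q hq => ⟨hq.1, mem_univ _⟩
    refine upperEnvelope_le (g := fun t x => upperEnvelope T F t
      (x - WithLp.toLp 2 (fun i => (z i : ℝ)))) hF husc (fun w hw s hs y => ?_) ht x
    obtain ⟨w', hw', h⟩ := hper w hw z
    have := h s hs (y - WithLp.toLp 2 (fun i => (z i : ℝ)))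
    rw [sub_add_cancel] at this
    rw [this]
    exact le_upperEnvelope hM hw' hs _
  intro t ht x z
  refine le_antisymm ?_ ?_
  · simpa using key t ht (x + WithLp.toLp 2 (fun i => (z i : ℝ))) z
  · have := key t ht x (fun i => -z i)
    have hneg : (WithLp.toLp 2 (fun i => ((-z i : ℤ) : ℝ)) : 𝔼 d) =
        -WithLp.toLp 2 (fun i => (z i : ℝ)) := by ext i; simp
    rwa [hneg, sub_neg_eq_add] at this

/-- The penalisation `|t-t'|² + |x-x'|² + Λ exp(-1/(t-b)₊)` used to localise maxima. -/
noncomputable def penalty (b t' : ℝ) (x' : 𝔼 d) (Λ : ℝ) : ℝ → 𝔼 d → ℝ := fun t x =>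
  (Λ * expNegInvGlue (t - b) + 1 * (t - t') ^ 2) + 1 * ‖x - x'‖ ^ 2

theorem contDiff_penalty (b t' : ℝ) (x' : 𝔼 d) (Λ : ℝ) :
    ContDiff ℝ 1 fun q : ℝ × 𝔼 d => penalty b t' x' Λ q.1 q.2 := by
  have h : ContDiff ℝ 1 fun q : ℝ × 𝔼 d => ‖q.2 - x'‖ ^ 2 :=
    (contDiff_snd.sub contDiff_const).norm_sq ℝ
  have h' : ContDiff ℝ 1 fun q : ℝ × 𝔼 d => (q.1 - t') ^ 2 :=
    (contDiff_fst.sub contDiff_const).pow 2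
  have h'' : ContDiff ℝ 1 fun q : ℝ × 𝔼 d => expNegInvGlue (q.1 - b) :=
    (expNegInvGlue.contDiff (n := 1)).comp (contDiff_fst.sub contDiff_const)
  exact ((contDiff_const.mul h'').add (contDiff_const.mul h')).add (contDiff_const.mul h)

theorem isTestFunction_penalty (T b t' : ℝ) (x' : 𝔼 d) (Λ : ℝ) :
    IsTestFunction T (penalty b t' x' Λ) :=
  IsTestFunction.of_contDiff (contDiff_penalty b t' x' Λ)

theorem gradient_penalty (b t' : ℝ) (x' : 𝔼 d) (Λ t : ℝ) (x : 𝔼 d) :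
    gradient (penalty b t' x' Λ t) x = (2 : ℝ) • (x - x') := by
  have := gradient_const_add_sq_norm (Λ * expNegInvGlue (t - b) + 1 * (t - t') ^ 2) 1 x x'
  rw [mul_one] at this
  exact this

theorem penalty_self {b t' : ℝ} (h : t' ≤ b) (x' : 𝔼 d) (Λ : ℝ) : penalty b t' x' Λ t' x' = 0 := by
  simp [penalty, expNegInvGlue.zero_of_nonpos (sub_nonpos.2 h)]

/-- The exponential term is nondecreasing in time and can be dropped; the quadratic term gives the
constant 3T. The bound is free of Λ, which later tends to infinity. -/
theorem penalty_sub_ge {b t' : ℝ} (x' : 𝔼 d) {Λ : ℝ} (hΛ : 0 ≤ Λ) (ht' : t' ∈ Icc 0 T)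
    {s τ : ℝ} (hs : s ∈ Icc 0 T) (hτ : 0 ≤ τ) (hτs : τ ≤ s) (y : 𝔼 d) :
    -(3 * T * τ) ≤ penalty b t' x' Λ s y - penalty b t' x' Λ (s - τ) y := by
  have h1 : expNegInvGlue (s - τ - b) ≤ expNegInvGlue (s - b) :=
    expNegInvGlue.monotone (by linarith)
  have h2 := mul_le_mul_of_nonneg_left h1 hΛ
  simp only [penalty]
  have h3 : 0 ≤ τ * (2 * (s - t') - τ + 3 * T) :=
    mul_nonneg hτ (by linarith [hs.1, hs.2, ht'.1, ht'.2])
  nlinarith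

theorem le_penalty (b t' : ℝ) (x' : 𝔼 d) {Λ : ℝ} (hΛ : 0 ≤ Λ) (t : ℝ) (x : 𝔼 d) :
    Λ * expNegInvGlue (t - b) ≤ penalty b t' x' Λ t x ∧
      (t - t') ^ 2 + ‖x - x'‖ ^ 2 ≤ penalty b t' x' Λ t x := by
  have h1 : 0 ≤ Λ * expNegInvGlue (t - b) := mul_nonneg hΛ (expNegInvGlue.nonneg _)
  have h2 : 0 ≤ (t - t') ^ 2 := sq_nonneg _
  have h3 : 0 ≤ ‖x - x'‖ ^ 2 := sq_nonneg _
  simp only [penalty]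
  constructor <;> linarith

end

section
variable {d : ℕ}
local notation:max "𝔼" d:max => EuclideanSpace ℝ (Fin d)
variable {α T M : ℝ} {H : ℝ → 𝔼 d → ℝ → 𝔼 d → ℝ} {F : Set (ℝ → 𝔼 d → ℝ)}

/-- A maximum point of `U - φ` over a compact cylinder is a limit of maximum points of penalised
members of the family. -/
theorem exists_approximating_maxima (hF : F.Nonempty)
    (hM : ∀ w ∈ F, ∀ t ∈ Icc 0 T, ∀ x, w t x ≤ M)
    (husc : ∀ w ∈ F, UpperSemicontinuousOn (fun q : ℝ × 𝔼 d => w q.1 q.2) (Icc 0 T ×ˢ univ))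
    {a b : ℝ} (ha : 0 ≤ a) (hb : b ≤ T) {c : 𝔼 d} {ρ : ℝ}
    {φ : ℝ → 𝔼 d → ℝ} (hφ : ContinuousOn (fun q : ℝ × 𝔼 d => φ q.1 q.2) (Icc 0 T ×ˢ univ))
    {t' : ℝ} (ht' : t' ∈ Ioc a b) {x' : 𝔼 d} (hx' : x' ∈ Metric.ball c ρ)
    (hmax : ∀ t ∈ Icc a b, ∀ x ∈ Metric.closedBall c ρ,
      upperEnvelope T F t x - φ t x ≤ upperEnvelope T F t' x' - φ t' x') :
    ∃ (Λ : ℕ → ℝ) (w : ℕ → ℝ → 𝔼 d → ℝ) (s : ℕ → ℝ) (y : ℕ → 𝔼 d),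
      (∀ n, 0 ≤ Λ n ∧ w n ∈ F ∧ s n ∈ Icc a T ∧ y n ∈ Metric.closedBall c ρ) ∧
      (∀ n, ∀ t ∈ Icc a T, ∀ x ∈ Metric.closedBall c ρ,
        w n t x - (φ t x + penalty b t' x' (Λ n) t x) ≤
          w n (s n) (y n) - (φ (s n) (y n) + penalty b t' x' (Λ n) (s n) (y n))) ∧
      Tendsto s atTop (𝓝 t') ∧ Tendsto y atTop (𝓝 x') ∧
      Tendsto (fun n => w n (s n) (y n)) atTop (𝓝 (upperEnvelope T F t' x')) := by
  set U := upperEnvelope T F with hU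
  have hUusc := upperSemicontinuousOn_upperEnvelope hF hM
  have htT : t' ∈ Icc 0 T := ⟨ha.trans ht'.1.le, ht'.2.trans hb⟩
  have haT : ∀ t ∈ Icc a T, t ∈ Icc 0 T := fun t ht => ⟨ha.trans ht.1, ht.2⟩
  have hφc : ∀ Λ, ContinuousOn (fun q : ℝ × 𝔼 d => φ q.1 q.2 + penalty b t' x' Λ q.1 q.2)
      (Icc 0 T ×ˢ univ) := fun Λ => hφ.add (contDiff_penalty b t' x' Λ).continuous.continuousOn
  -- The cylinder extends to time T because, when t' = b, points at which members of the family
  -- approach U may lie after b. The error 2 / (n + 1) is shared by the envelope and by the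
  -- continuity of φ plus the penalty.
  have happrox : ∀ n : ℕ, ∃ t ∈ Icc a T, ∃ x ∈ Metric.closedBall c ρ, ∃ w ∈ F,
      U t' x' - φ t' x' - 2 / ((n : ℝ) + 1) ≤ w t x - (φ t x + penalty b t' x' n t x) := by
    intro n
    have hn : 0 < 1 / ((n : ℝ) + 1) := by positivity
    have h1 := frequently_of_lt_upperEnvelope hF htT
      (show U t' x' - 1 / ((n : ℝ) + 1) < U t' x' by linarith)
    have h2 : ∀ᶠ q in 𝓝[Icc 0 T ×ˢ univ] (t', x'),
        φ q.1 q.2 + penalty b t' x' n q.1 q.2 < φ t' x' + 1 / ((n : ℝ) + 1) := by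
      refine (hφc n (t', x') ⟨htT, mem_univ _⟩).eventually_lt_const ?_
      simp only [penalty_self ht'.2]
      linarith
    have h3 : ∀ᶠ q in 𝓝[Icc 0 T ×ˢ univ] (t', x'), a < q.1 ∧ q.2 ∈ Metric.ball c ρ :=
      nhdsWithin_le_nhds ((continuous_fst.tendsto _ |>.eventually (lt_mem_nhds ht'.1)).and
        (continuous_snd.tendsto _ |>.eventually (Metric.isOpen_ball.mem_nhds hx')))
    obtain ⟨q, ⟨⟨w, hw, hwq⟩, hq2, hq3, hq4⟩, hqD⟩ :=
      ((h1.and_eventually (h2.and h3)).and_eventually self_mem_nhdsWithin).exists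
    refine ⟨q.1, ⟨hq3.le, hqD.1.2⟩, q.2, Metric.ball_subset_closedBall hq4, w, hw, ?_⟩
    have : 2 / ((n : ℝ) + 1) = 1 / ((n : ℝ) + 1) + 1 / ((n : ℝ) + 1) := by ring
    linarith
  have hKc : IsCompact (Icc a T ×ˢ Metric.closedBall c ρ) :=
    isCompact_Icc.prod (isCompact_closedBall _ _)
  have hmaxn : ∀ n : ℕ, ∃ w ∈ F, ∃ s ∈ Icc a T, ∃ y ∈ Metric.closedBall c ρ,
      (∀ t ∈ Icc a T, ∀ x ∈ Metric.closedBall c ρ,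
        w t x - (φ t x + penalty b t' x' n t x) ≤ w s y - (φ s y + penalty b t' x' n s y)) ∧
      U t' x' - φ t' x' - 2 / ((n : ℝ) + 1) ≤ w s y - (φ s y + penalty b t' x' n s y) := by
    intro n
    obtain ⟨t, ht, x, hx, w, hw, h⟩ := happrox n
    have h1 : UpperSemicontinuousOn (fun q : ℝ × 𝔼 d =>
        w q.1 q.2 + -(φ q.1 q.2 + penalty b t' x' n q.1 q.2)) (Icc a T ×ˢ Metric.closedBall c ρ) :=
      ((husc w hw).add (hφc n).neg.upperSemicontinuousOn).mono
        fun q hq => ⟨haT _ hq.1, mem_univ _⟩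
    obtain ⟨⟨s, y⟩, hsy, hm⟩ := h1.exists_isMaxOn ⟨(t, x), mk_mem_prod ht hx⟩ hKc
    have hm' : ∀ t ∈ Icc a T, ∀ x ∈ Metric.closedBall c ρ,
        w t x - (φ t x + penalty b t' x' n t x) ≤ w s y - (φ s y + penalty b t' x' n s y) :=
      fun t ht x hx => by
        have := hm (mk_mem_prod ht hx)
        simp only [mem_ofPred_eq] at this
        linarith
    exact ⟨w, hw, s, hsy.1, y, hsy.2, hm', h.trans (hm' t ht x hx)⟩
  choose w hw s hs y hy hm hval using hmaxn
  obtain ⟨⟨s₀, y₀⟩, hmem, σ, hσ, hlim⟩ :=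
    hKc.tendsto_subseq (x := fun n => (s n, y n)) fun n => ⟨hs n, hy n⟩
  have hls : Tendsto (fun n => s (σ n)) atTop (𝓝 s₀) := hlim.fst_nhds
  have hly : Tendsto (fun n => y (σ n)) atTop (𝓝 y₀) := hlim.snd_nhds
  have hσ' : Tendsto (fun n => ((σ n : ℕ) : ℝ)) atTop atTop :=
    tendsto_natCast_atTop_atTop.comp hσ.tendsto_atTop
  have h2n : Tendsto (fun n => 2 / ((σ n : ℝ) + 1)) atTop (𝓝 0) :=
    tendsto_const_nhds.div_atTop (tendsto_atTop_add_const_right _ _ hσ')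
  have hφl : Tendsto (fun n => φ (s (σ n)) (y (σ n))) atTop (𝓝 (φ s₀ y₀)) := by
    have hin : Tendsto (fun n => (s (σ n), y (σ n))) atTop (𝓝[Icc 0 T ×ˢ univ] (s₀, y₀)) :=
      tendsto_nhdsWithin_iff.2
        ⟨hls.prodMk_nhds hly, Eventually.of_forall fun n => ⟨haT _ (hs _), mem_univ _⟩⟩
    exact (hφ (s₀, y₀) ⟨haT _ hmem.1, mem_univ _⟩).tendsto.comp hin
  have hwU : ∀ n, w n (s n) (y n) ≤ U (s n) (y n) := fun n =>
    le_upperEnvelope hM (hw n) (haT _ (hs n)) _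
  -- After b the factor n of the exponential drives the penalised values to -∞.
  have hs₀b : s₀ ≤ b := by
    by_contra hlt
    have hpos : 0 < expNegInvGlue (s₀ - b) := expNegInvGlue.pos_of_pos (by linarith [not_le.1 hlt])
    have h1 : Tendsto (fun n => (σ n : ℝ) * expNegInvGlue (s (σ n) - b)) atTop atTop :=
      hσ'.atTop_mul_pos hpos
        (((expNegInvGlue.contDiff (n := 0)).continuous.tendsto _).comp (hls.sub_const b))
    obtain ⟨n, hn1, hn2, hn3⟩ := ((h1.eventually_gt_atTop
      (M - (φ s₀ y₀ - 1) - (U t' x' - φ t' x' - 1))).and ((hφl.eventually_const_lt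
        (show φ s₀ y₀ - 1 < φ s₀ y₀ by linarith)).and
        (h2n.eventually_lt_const (show (0 : ℝ) < 1 by norm_num)))).exists
    have h3 := hM _ (hw (σ n)) _ (haT _ (hs (σ n))) (y (σ n))
    have h4 := (le_penalty b t' x' (σ n).cast_nonneg (s (σ n)) (y (σ n))).1
    linarith [hval (σ n)]
  -- At the limit point U - φ is at most its maximum, yet exceeds or equals that maximum plus the
  -- quadratic penalty.
  have hquad : (s₀ - t') ^ 2 + ‖y₀ - x'‖ ^ 2 ≤ 0 := by
    refine le_of_forall_pos_le_add fun e he => ?_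
    have h1 : Tendsto (fun n => (U s₀ y₀ + e) - φ (s (σ n)) (y (σ n)) -
        ((s (σ n) - t') ^ 2 + ‖y (σ n) - x'‖ ^ 2) + 2 / ((σ n : ℝ) + 1)) atTop
        (𝓝 ((U s₀ y₀ + e) - φ s₀ y₀ - ((s₀ - t') ^ 2 + ‖y₀ - x'‖ ^ 2) + 0)) :=
      ((hφl.const_sub _).sub (((hls.sub_const t').pow 2).add
        ((hly.sub_const x').norm.pow 2))).add h2n
    have h2 : U t' x' - φ t' x' ≤
        (U s₀ y₀ + e) - φ s₀ y₀ - ((s₀ - t') ^ 2 + ‖y₀ - x'‖ ^ 2) + 0 := by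
      refine ge_of_tendsto h1 ?_
      filter_upwards [hUusc.eventually_lt_of_tendsto (haT _ hmem.1)
        (Eventually.of_forall fun n => haT _ (hs _)) hls hly
        (show U s₀ y₀ < U s₀ y₀ + e by linarith)] with n hn
      have h3 := hwU (σ n)
      have h4 := (le_penalty b t' x' (σ n).cast_nonneg (s (σ n)) (y (σ n))).2
      linarith [hval (σ n)]
    have h5 := hmax s₀ ⟨hmem.1.1, hs₀b⟩ y₀ hmem.2
    linarith
  obtain rfl : s₀ = t' := by
    have h1 := sq_nonneg ‖y₀ - x'‖
    have h2 : (s₀ - t') ^ 2 = 0 := le_antisymm (by linarith) (sq_nonneg _)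
    exact sub_eq_zero.1 (pow_eq_zero_iff two_ne_zero |>.1 h2)
  obtain rfl : y₀ = x' := by
    have h2 : ‖y₀ - x'‖ ^ 2 = 0 := le_antisymm (by simpa using hquad) (sq_nonneg _)
    exact sub_eq_zero.1 (norm_eq_zero.1 (pow_eq_zero_iff two_ne_zero |>.1 h2))
  refine ⟨fun n => (σ n : ℝ), fun n => w (σ n), fun n => s (σ n), fun n => y (σ n),
    fun n => ⟨(σ n).cast_nonneg, hw _, hs _, hy _⟩, fun n => hm (σ n), hls, hly, ?_⟩
  refine tendsto_order.2 ⟨fun c hc => ?_, fun c hc => ?_⟩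
  · set e := (U s₀ y₀ - c) / 3 with he
    have he0 : 0 < e := by linarith
    filter_upwards [hφl.eventually_const_lt (show φ s₀ y₀ - e < φ s₀ y₀ by linarith),
      h2n.eventually_lt_const he0] with n h1 h2
    have h3 := (le_penalty b s₀ y₀ (σ n).cast_nonneg (s (σ n)) (y (σ n))).2
    have h4 : 0 ≤ (s (σ n) - s₀) ^ 2 + ‖y (σ n) - y₀‖ ^ 2 := by positivity
    linarith [hval (σ n)]
  · filter_upwards [hUusc.eventually_lt_of_tendsto (haT _ hmem.1)
        (Eventually.of_forall fun n => haT _ (hs _)) hls hly hc] with n hn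
    exact (hwU (σ n)).trans_lt hn

/-- The upper envelope of a family of subsolutions is a subsolution. -/
theorem caputoSubsolution_upperEnvelope (hα₀ : 0 < α) (hα₁ : α < 1)
    (hHc : ContinuousOn (fun q : ℝ × 𝔼 d × ℝ × 𝔼 d => H q.1 q.2.1 q.2.2.1 q.2.2.2)
      (Icc 0 T ×ˢ univ)) (hF : F.Nonempty)
    (hM : ∀ w ∈ F, ∀ t ∈ Icc 0 T, ∀ x, w t x ≤ M)
    (husc : ∀ w ∈ F, UpperSemicontinuousOn (fun q : ℝ × 𝔼 d => w q.1 q.2) (Icc 0 T ×ˢ univ))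
    (hsub : ∀ w ∈ F, CaputoSubsolution α T H w) :
    CaputoSubsolution α T H (upperEnvelope T F) := by
  intro a b ha hab hb c ρ hρ φ hφ t' ht' x' hx' hmax
  set U := upperEnvelope T F with hU
  have hUusc := upperSemicontinuousOn_upperEnvelope hF hM
  have htT : t' ∈ Ioc 0 T := ⟨ha.trans_lt ht'.1, ht'.2.trans hb⟩
  have htT' : t' ∈ Icc 0 T := ⟨htT.1.le, htT.2⟩
  have hT0 : (0 : ℝ) ∈ Icc 0 T := ⟨le_rfl, htT.1.le.trans htT.2⟩
  have hxc : x' ∈ Metric.closedBall c ρ := Metric.ball_subset_closedBall hx'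
  obtain ⟨Λ, w, s, y, hmem, hm, hls, hly, hlw⟩ :=
    exists_approximating_maxima hF hM husc ha hb hφ.1 ht' hx' hmax
  obtain ⟨C, δ, hC, hδ, hlip⟩ := hφ.exists_lipschitz htT x'
  -- If |s - t'| < r₀ and τ ≤ r₀, then s - τ stays after a and within δ of t', where φ is uniformly
  -- Lipschitz.
  set r₀ := min (δ / 2) ((t' - a) / 2) with hr₀
  have hta : 0 < t' - a := sub_pos.2 ht'.1
  have hr₀0 : 0 < r₀ := by positivity
  have hr₁ : r₀ ≤ δ / 2 := min_le_left _ _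
  have hr₂ : r₀ ≤ (t' - a) / 2 := min_le_right _ _
  obtain ⟨N, hN⟩ := eventually_atTop.1
    ((hls.eventually (Metric.ball_mem_nhds t' hr₀0)).and
      ((hly.eventually (Metric.ball_mem_nhds x' hδ)).and
        (hly.eventually (Metric.isOpen_ball.mem_nhds hx'))))
  have hN1 : ∀ n, |s (n + N) - t'| < r₀ := fun n => by
    have := (hN (n + N) (by omega)).1
    rwa [Real.dist_eq] at this
  have hN2 : ∀ n, y (n + N) ∈ Metric.ball x' δ := fun n => (hN (n + N) (by omega)).2.1
  have hN3 : ∀ n, y (n + N) ∈ Metric.ball c ρ := fun n => (hN (n + N) (by omega)).2.2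
  have hsa : ∀ n, a + r₀ < s (n + N) := fun n => by
    have := (abs_lt.1 (hN1 n)).1; linarith
  have hsT : ∀ n, s (n + N) ∈ Ioc 0 T := fun n => ⟨by linarith [hsa n], (hmem _).2.2.1.2⟩
  have htest : ∀ n, IsTestFunction T fun t x => φ t x + penalty b t' x' (Λ n) t x := fun n =>
    hφ.add (isTestFunction_penalty T b t' x' (Λ n))
  have hvisc : ∀ n, FracKExists α 0 (fun r => w (n + N) r (y (n + N))) (s (n + N)) ∧
      fracK α 0 (fun r => w (n + N) r (y (n + N))) (s (n + N)) +
        H (s (n + N)) (y (n + N)) (w (n + N) (s (n + N)) (y (n + N)))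
          (gradient (φ (s (n + N))) (y (n + N)) + (2 : ℝ) • (y (n + N) - x')) ≤ 0 := by
    intro n
    have h := hsub _ (hmem (n + N)).2.1 a T ha (hab.trans_le hb) le_rfl c ρ hρ _ (htest (n + N))
      (s (n + N)) ⟨by linarith [hsa n], (hsT n).2⟩ (y (n + N)) (hN3 n) (hm (n + N))
    rw [gradient_add' (hφ.differentiableAt (hsT n) _)
      ((isTestFunction_penalty T b t' x' (Λ (n + N))).differentiableAt (hsT n) _),
      gradient_penalty] at h
    exact h
  have hshift : Tendsto (fun n => n + N) atTop atTop := tendsto_add_atTop_nat N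
  have hls' : Tendsto (fun n => s (n + N)) atTop (𝓝 t') := hls.comp hshift
  have hly' : Tendsto (fun n => y (n + N)) atTop (𝓝 x') := hly.comp hshift
  have hlw' : Tendsto (fun n => w (n + N) (s (n + N)) (y (n + N))) atTop (𝓝 (U t' x')) :=
    hlw.comp hshift
  have hlip' : ∀ y₁ ∈ Metric.ball x' δ, ∀ s₁ ∈ Ioc 0 T, |s₁ - t'| < r₀ → ∀ τ, 0 < τ → τ ≤ r₀ →
      0 < s₁ - τ → -(C * τ) ≤ φ s₁ y₁ - φ (s₁ - τ) y₁ := by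
    intro y₁ hy₁ s₁ hs₁ hs₁' τ hτ hτr hpos
    have h1 := hlip y₁ hy₁ s₁ hs₁ (s₁ - τ) ⟨hpos, by linarith [hs₁.2]⟩ (by linarith) (by
      have h2 := abs_sub_le (s₁ - τ) s₁ t'
      rw [sub_sub_cancel_left, abs_neg, abs_of_pos hτ] at h2
      linarith)
    rw [sub_sub_cancel, abs_of_pos hτ] at h1
    linarith [neg_abs_le (φ s₁ y₁ - φ (s₁ - τ) y₁)]
  have hgrad : Tendsto (fun n => gradient (φ (s (n + N))) (y (n + N)) +
      (2 : ℝ) • (y (n + N) - x')) atTop (𝓝 (gradient (φ t') x')) := by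
    have h1 := (hφ.continuousOn_gradient (t', x') ⟨htT, mem_univ _⟩).tendsto.comp
      (tendsto_nhdsWithin_iff.2 ⟨hls'.prodMk_nhds hly',
        Eventually.of_forall fun n => ⟨hsT n, mem_univ _⟩⟩)
    simpa using h1.add ((hly'.sub_const x').const_smul (2 : ℝ))
  have hHlim : Tendsto (fun n => H (s (n + N)) (y (n + N)) (w (n + N) (s (n + N)) (y (n + N)))
      (gradient (φ (s (n + N))) (y (n + N)) + (2 : ℝ) • (y (n + N) - x'))) atTop
      (𝓝 (H t' x' (U t' x') (gradient (φ t') x'))) :=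
    (hHc (t', x', U t' x', gradient (φ t') x') ⟨htT', mem_univ _⟩).tendsto.comp
      (tendsto_nhdsWithin_iff.2 ⟨hls'.prodMk_nhds (hly'.prodMk_nhds (hlw'.prodMk_nhds hgrad)),
        Eventually.of_forall fun n => ⟨⟨(hsT n).1.le, (hsT n).2⟩, mem_univ _⟩⟩)
  have hUM : ∀ t ∈ Icc 0 T, ∀ x, U t x ≤ M := fun t ht x =>
    upperEnvelope_le (g := fun _ _ => M) hF upperSemicontinuousOn_const hM ht x
  -- In the one-sided Lipschitz constant, C comes from φ and 3T from the penalty, both uniform in n.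
  -- Semicontinuity of U supplies the upper relaxed limit of the members along the moving points.
  refine caputoFrom_add_le_of_limit (T := T) (M := M) (C := C + 3 * T) (r₀ := r₀)
    (F := fun n r => w (n + N) r (y (n + N))) (R := fun _ => 0) (S := fun n => s (n + N))
    (A := fun n => w (n + N) (s (n + N)) (y (n + N))) (f := fun r => U r x')
    (Y := fun n => H (s (n + N)) (y (n + N)) (w (n + N) (s (n + N)) (y (n + N)))
      (gradient (φ (s (n + N))) (y (n + N)) + (2 : ℝ) • (y (n + N) - x')))
    hα₀ hα₁ hsT htT.1 htT.2 le_rfl (fun _ => le_rfl) (fun n => (hvisc n).1)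
    (hUusc.aestronglyMeasurable_time_slice htT.2 x') (by linarith [htT.1, htT.2]) hr₀0
    (fun n τ hτ hτr => ?_) (fun τ hτ hτr => ?_)
    (fun n r hr => hM _ (hmem _).2.1 r ⟨hr.1, hr.2.trans (hsT n).2⟩ _)
    (fun r hr => hUM r ⟨hr.1, hr.2.trans htT.2⟩ _) hlw' hls' tendsto_const_nhds
    (fun τ hτ e he => ?_) (fun e he => ?_) hHlim
    (fun e he => Eventually.of_forall fun n => (hvisc n).2.trans he.le)
  · have h1 := hm (n + N) (s (n + N) - τ) ⟨by linarith [hsa n], by linarith [hτ.1, (hsT n).2]⟩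
      (y (n + N)) (Metric.ball_subset_closedBall (hN3 n))
    have h2 := penalty_sub_ge (b := b) x' (hmem (n + N)).1 htT' ⟨(hsT n).1.le, (hsT n).2⟩ hτ.1.le
      hτ.2 (y (n + N))
    have h3 := hlip' _ (hN2 n) _ (hsT n) (hN1 n) τ hτ.1 hτr (by linarith [hsa n])
    rw [add_mul]
    linarith
  · have h1 := hmax (t' - τ) ⟨by linarith, by linarith [hτ.1, ht'.2]⟩ x' hxc
    have h3 := hlip' x' (Metric.mem_ball_self hδ) t' htT (by simpa using hr₀0) τ hτ.1 hτr
      (by linarith)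
    have h4 : 0 ≤ 3 * T * τ := by
      have := htT.1.trans_le htT.2; have := hτ.1; positivity
    rw [add_mul]
    linarith
  · have hev : ∀ᶠ n in atTop, s (n + N) - τ ∈ Icc 0 T := by
      filter_upwards [hls'.eventually_const_lt hτ.2] with n hn
      exact ⟨by linarith, by linarith [hτ.1, (hsT n).2]⟩
    filter_upwards [hev, hUusc.eventually_lt_of_tendsto
      (show t' - τ ∈ Icc 0 T from ⟨by linarith [hτ.2], by linarith [hτ.1, htT.2]⟩) hev
      (hls'.sub_const τ) hly' (show U (t' - τ) x' < U (t' - τ) x' + e by linarith)] with n h1 h2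
    exact (le_upperEnvelope hM (hmem (n + N)).2.1 h1 _).trans h2.le
  · filter_upwards [hUusc.eventually_lt_of_tendsto hT0 (Eventually.of_forall fun _ => hT0)
      tendsto_const_nhds hly' (show U 0 x' < U 0 x' + e by linarith)] with n h2
    exact (le_upperEnvelope hM (hmem (n + N)).2.1 hT0 _).trans h2.le

end

/-! ### The bump construction of Perron's method -/

section
variable {d : ℕ}
local notation:max "𝔼" d:max => EuclideanSpace ℝ (Fin d)
variable {α T : ℝ} {H : ℝ → 𝔼 d → ℝ → 𝔼 d → ℝ} {V : ℝ → 𝔼 d → ℝ}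

/-- A strict inequality for `K_r` persists at nearby points. -/
theorem exists_nhds_lt_caputoFrom (hα₀ : 0 < α) (hα₁ : α < 1)
    (hHc : ContinuousOn (fun q : ℝ × 𝔼 d × ℝ × 𝔼 d => H q.1 q.2.1 q.2.2.1 q.2.2.2)
      (Icc 0 T ×ˢ univ))
    (hV : UpperSemicontinuousOn (fun q : ℝ × 𝔼 d => V q.1 q.2) (Icc 0 T ×ˢ univ))
    {B : ℝ} (hB : ∀ t ∈ Icc 0 T, ∀ x, |V t x| ≤ B)
    {φ : ℝ → 𝔼 d → ℝ} (hφ : IsTestFunction T φ) {t' : ℝ} (ht' : t' ∈ Ioc 0 T) {x' : 𝔼 d}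
    {r e : ℝ} (hr : 0 < r)
    (h : e < fracK α r (fun s => V s x') t' +
      dualHamiltonian H t' x' (V t' x') (gradient (φ t') x')) :
    ∃ σ > 0, ∀ s ∈ Ioc 0 T, ∀ y l, |s - t'| < σ → ‖y - x'‖ < σ → 0 ≤ l → l < σ →
      e < caputoFrom α r (φ s y + V t' x' - φ t' x' - l) (fun q => V q y) s +
        dualHamiltonian H s y (φ s y + V t' x' - φ t' x' - l)
          (gradient (φ s) y + (2 : ℝ) • (y - x')) := by
  -- Failure in every neighbourhood gives a sequence of points with the opposite inequality, which
  -- the stability lemma would carry to the limit.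
  by_contra! hcon
  choose s hs y l hst hyx hl0 hl hbad using fun n : ℕ =>
    hcon (1 / ((n : ℝ) + 1)) (by positivity)
  have h1n := tendsto_one_div_add_atTop_nhds_zero_nat (𝕜 := ℝ)
  have hls : Tendsto s atTop (𝓝 t') := by
    refine tendsto_iff_dist_tendsto_zero.2 (squeeze_zero (fun _ => dist_nonneg) (fun n => ?_) h1n)
    rw [Real.dist_eq]; exact (hst n).le
  have hly : Tendsto y atTop (𝓝 x') := by
    refine tendsto_iff_dist_tendsto_zero.2 (squeeze_zero (fun _ => dist_nonneg) (fun n => ?_) h1n)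
    rw [dist_eq_norm]; exact (hyx n).le
  have hll : Tendsto l atTop (𝓝 0) := squeeze_zero hl0 (fun n => (hl n).le) h1n
  have ht'' : t' ∈ Icc 0 T := ⟨ht'.1.le, ht'.2⟩
  have hT0 : (0 : ℝ) ∈ Icc 0 T := ⟨le_rfl, ht'.1.le.trans ht'.2⟩
  have hsT : ∀ n, s n ∈ Icc 0 T := fun n => ⟨(hs n).1.le, (hs n).2⟩
  have hin : Tendsto (fun n => (s n, y n)) atTop (𝓝[Icc 0 T ×ˢ univ] (t', x')) :=
    tendsto_nhdsWithin_iff.2 ⟨hls.prodMk_nhds hly, Eventually.of_forall fun n =>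
      ⟨hsT n, mem_univ _⟩⟩
  have hin' : Tendsto (fun n => (s n, y n)) atTop (𝓝[Ioc 0 T ×ˢ univ] (t', x')) :=
    tendsto_nhdsWithin_iff.2 ⟨hls.prodMk_nhds hly, Eventually.of_forall fun n =>
      ⟨hs n, mem_univ _⟩⟩
  have hφl : Tendsto (fun n => φ (s n) (y n)) atTop (𝓝 (φ t' x')) :=
    (hφ.1 (t', x') ⟨ht'', mem_univ _⟩).tendsto.comp hin
  have hA : Tendsto (fun n => φ (s n) (y n) + V t' x' - φ t' x' - l n) atTop (𝓝 (V t' x')) := by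
    have := ((hφl.add_const (V t' x')).sub_const (φ t' x')).sub hll
    rwa [add_sub_cancel_left, sub_zero] at this
  have hp : Tendsto (fun n => gradient (φ (s n)) (y n) + (2 : ℝ) • (y n - x')) atTop
      (𝓝 (gradient (φ t') x')) := by
    have h1 := (hφ.continuousOn_gradient (t', x') ⟨ht', mem_univ _⟩).tendsto.comp hin'
    simpa using h1.add ((hly.sub_const x').const_smul (2 : ℝ))
  have hHlim : Tendsto (fun n => dualHamiltonian H (s n) (y n)
      (φ (s n) (y n) + V t' x' - φ t' x' - l n) (gradient (φ (s n)) (y n) + (2 : ℝ) • (y n - x')))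
      atTop (𝓝 (dualHamiltonian H t' x' (V t' x') (gradient (φ t') x'))) := by
    have hin'' : Tendsto (fun n => (s n, y n, -(φ (s n) (y n) + V t' x' - φ t' x' - l n),
        -(gradient (φ (s n)) (y n) + (2 : ℝ) • (y n - x')))) atTop
        (𝓝[Icc 0 T ×ˢ univ] (t', x', -V t' x', -gradient (φ t') x')) :=
      tendsto_nhdsWithin_iff.2 ⟨hls.prodMk_nhds (hly.prodMk_nhds (hA.neg.prodMk_nhds hp.neg)),
        Eventually.of_forall fun n => ⟨hsT n, mem_univ _⟩⟩
    exact ((hHc (t', x', -V t' x', -gradient (φ t') x')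
      ⟨ht'', mem_univ _⟩).tendsto.comp hin'').neg
  have hVM : ∀ t ∈ Icc 0 T, ∀ x, V t x ≤ B := fun t ht x => (le_abs_self _).trans (hB t ht x)
  have hB0 : 0 ≤ B := (abs_nonneg _).trans (hB 0 hT0 0)
  -- With r₀ = r / 2 no τ > r is subject to the near-zero condition, so C = 0 is admissible.
  have key := caputoFrom_add_le_of_limit (T := T) (M := B) (C := 0) (r₀ := r / 2)
    (F := fun n q => V q (y n)) (R := fun _ => r) (S := s) (a := V t' x')
    (A := fun n => φ (s n) (y n) + V t' x' - φ t' x' - l n) (f := fun q => V q x')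
    (Y := fun n => dualHamiltonian H (s n) (y n)
      (φ (s n) (y n) + V t' x' - φ t' x' - l n)
      (gradient (φ (s n)) (y n) + (2 : ℝ) • (y n - x')) - e)
    hα₀ hα₁ hs ht'.1 ht'.2 hr.le (fun _ => hr.le)
    (fun n => integrableOn_caputo_of_pos (f := fun q => V q (y n))
      (K := |φ (s n) (y n) + V t' x' - φ t' x' - l n| + B) hα₀
      (hV.aestronglyMeasurable_time_slice (hs n).2 _) hr (by positivity) fun τ hτ =>
        (abs_sub _ _).trans (add_le_add_right (hB _
          ⟨by linarith [hτ.2], by linarith [hτ.1, (hs n).2]⟩ _) _))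
    (hV.aestronglyMeasurable_time_slice ht'.2 x') le_rfl (by positivity)
    (fun n τ hτ h => absurd hτ.1 (by linarith)) (fun τ hτ h => absurd hτ.1 (by linarith))
    (fun n q hq => hVM q ⟨hq.1, hq.2.trans (hs n).2⟩ _)
    (fun q hq => hVM q ⟨hq.1, hq.2.trans ht'.2⟩ _) hA hls tendsto_const_nhds
    (fun τ hτ c hc => ?_) (fun c hc => ?_) (hHlim.sub_const e)
    (fun c hc => Eventually.of_forall fun n => by linarith [hbad n])
  · have h2 : e < caputoFrom α r (V t' x') (fun q => V q x') t' +
      dualHamiltonian H t' x' (V t' x') (gradient (φ t') x') := h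
    linarith [key.2]
  · have hev : ∀ᶠ n in atTop, s n - τ ∈ Icc 0 T := by
      filter_upwards [hls.eventually_const_lt hτ.2] with n hn
      exact ⟨by linarith, by linarith [hτ.1, (hs n).2]⟩
    exact (hV.eventually_lt_of_tendsto
      (show t' - τ ∈ Icc 0 T from ⟨by linarith [hτ.2], by linarith [hτ.1, ht'.2]⟩) hev
      (hls.sub_const τ) hly (show V (t' - τ) x' < V (t' - τ) x' + c by linarith)).mono
      fun _ hn => hn.le
  · exact (hV.eventually_lt_of_tendsto hT0 (Eventually.of_forall fun _ => hT0)
      tendsto_const_nhds hly (show V 0 x' < V 0 x' + c by linarith)).mono fun _ hn => hn.le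

/-- For large penalisation the penalised test function lies strictly above `V` away from the
maximum point. -/
theorem exists_penalty_gap
    (hV : UpperSemicontinuousOn (fun q : ℝ × 𝔼 d => V q.1 q.2) (Icc 0 T ×ˢ univ))
    {B : ℝ} (hB : ∀ t ∈ Icc 0 T, ∀ x, V t x ≤ B)
    {φ : ℝ → 𝔼 d → ℝ} (hφ : ContinuousOn (fun q : ℝ × 𝔼 d => φ q.1 q.2) (Icc 0 T ×ˢ univ))
    {a b : ℝ} (ha : 0 ≤ a) {c : 𝔼 d} {ρ : ℝ} {t' : ℝ} {x' : 𝔼 d}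
    (hmax : ∀ t ∈ Icc a b, ∀ x ∈ Metric.closedBall c ρ, V t x - φ t x ≤ V t' x' - φ t' x')
    {σ : ℝ} (hσ : 0 < σ) :
    ∃ Λ l : ℝ, 0 ≤ Λ ∧ 0 < l ∧ l < σ ∧ ∀ t ∈ Icc a T, ∀ x ∈ Metric.closedBall c ρ,
      (σ / 2 ≤ |t - t'| ∨ σ / 2 ≤ ‖x - x'‖) →
      V t x < φ t x + penalty b t' x' Λ t x + V t' x' - φ t' x' - l := by
  by_contra! hcon
  have h2n : ∀ n : ℕ, 0 < 1 / ((n : ℝ) + 1) := fun n => by positivity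
  -- The trial values are Λ = n and l = σ / (n + 2); the 2 keeps l strictly below σ already at n =
  -- 0.
  choose s hs y hy hfar hbad using fun n : ℕ => hcon n (σ / ((n : ℝ) + 2)) n.cast_nonneg
    (by positivity) (div_lt_self hσ (by linarith [n.cast_nonneg (α := ℝ)]))
  have haT : ∀ t ∈ Icc a T, t ∈ Icc 0 T := fun t ht => ⟨ha.trans ht.1, ht.2⟩
  have hKc : IsCompact (Icc a T ×ˢ Metric.closedBall c ρ) :=
    isCompact_Icc.prod (isCompact_closedBall _ _)
  obtain ⟨⟨s₀, y₀⟩, hmem, θ, hθ, hlim⟩ :=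
    hKc.tendsto_subseq (x := fun n => (s n, y n)) fun n => ⟨hs n, hy n⟩
  have hls : Tendsto (fun n => s (θ n)) atTop (𝓝 s₀) := hlim.fst_nhds
  have hly : Tendsto (fun n => y (θ n)) atTop (𝓝 y₀) := hlim.snd_nhds
  have hθ' : Tendsto (fun n => ((θ n : ℕ) : ℝ)) atTop atTop :=
    tendsto_natCast_atTop_atTop.comp hθ.tendsto_atTop
  have hl : Tendsto (fun n => σ / ((θ n : ℝ) + 2)) atTop (𝓝 0) :=
    tendsto_const_nhds.div_atTop (tendsto_atTop_add_const_right _ _ hθ')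
  have hφl : Tendsto (fun n => φ (s (θ n)) (y (θ n))) atTop (𝓝 (φ s₀ y₀)) := by
    have hin : Tendsto (fun n => (s (θ n), y (θ n))) atTop (𝓝[Icc 0 T ×ˢ univ] (s₀, y₀)) :=
      tendsto_nhdsWithin_iff.2
        ⟨hls.prodMk_nhds hly, Eventually.of_forall fun n => ⟨haT _ (hs _), mem_univ _⟩⟩
    exact (hφ (s₀, y₀) ⟨haT _ hmem.1, mem_univ _⟩).tendsto.comp hin
  have hs₀b : s₀ ≤ b := by
    by_contra hlt
    have hpos : 0 < expNegInvGlue (s₀ - b) := expNegInvGlue.pos_of_pos (by linarith [not_le.1 hlt])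
    have h1 : Tendsto (fun n => (θ n : ℝ) * expNegInvGlue (s (θ n) - b)) atTop atTop :=
      hθ'.atTop_mul_pos hpos
        (((expNegInvGlue.contDiff (n := 0)).continuous.tendsto _).comp (hls.sub_const b))
    obtain ⟨n, hn1, hn2, hn3⟩ := ((h1.eventually_gt_atTop
      (B - (φ s₀ y₀ - 1) - (V t' x' - φ t' x') + 1)).and ((hφl.eventually_const_lt
        (show φ s₀ y₀ - 1 < φ s₀ y₀ by linarith)).and
        (hl.eventually_lt_const (show (0 : ℝ) < 1 by norm_num)))).exists
    have h3 := hB _ (haT _ (hs (θ n))) (y (θ n))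
    have h4 := (le_penalty b t' x' (θ n).cast_nonneg (s (θ n)) (y (θ n))).1
    linarith [hbad (θ n)]
  have hquad : (s₀ - t') ^ 2 + ‖y₀ - x'‖ ^ 2 ≤ 0 := by
    refine le_of_forall_pos_le_add fun e he => ?_
    have h1 : Tendsto (fun n => φ (s (θ n)) (y (θ n)) +
        ((s (θ n) - t') ^ 2 + ‖y (θ n) - x'‖ ^ 2) + (V t' x' - φ t' x') - σ / ((θ n : ℝ) + 2)) atTop
        (𝓝 (φ s₀ y₀ + ((s₀ - t') ^ 2 + ‖y₀ - x'‖ ^ 2) + (V t' x' - φ t' x') - 0)) :=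
      ((hφl.add (((hls.sub_const t').pow 2).add
        ((hly.sub_const x').norm.pow 2))).add_const _).sub hl
    have h2 : φ s₀ y₀ + ((s₀ - t') ^ 2 + ‖y₀ - x'‖ ^ 2) + (V t' x' - φ t' x') - 0 ≤
        V s₀ y₀ + e := by
      refine le_of_tendsto h1 ?_
      filter_upwards [hV.eventually_lt_of_tendsto (haT _ hmem.1)
        (Eventually.of_forall fun n => haT _ (hs _)) hls hly
        (show V s₀ y₀ < V s₀ y₀ + e by linarith)] with n hn
      have h4 := (le_penalty b t' x' (θ n).cast_nonneg (s (θ n)) (y (θ n))).2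
      linarith [hbad (θ n)]
    have h5 := hmax s₀ ⟨hmem.1.1, hs₀b⟩ y₀ hmem.2
    linarith
  have h1 : (s₀ - t') ^ 2 = 0 :=
    le_antisymm (by linarith [sq_nonneg ‖y₀ - x'‖]) (sq_nonneg _)
  have h2 : ‖y₀ - x'‖ ^ 2 = 0 := le_antisymm (by linarith [sq_nonneg (s₀ - t')]) (sq_nonneg _)
  have h3 : Tendsto (fun n => |s (θ n) - t'|) atTop (𝓝 0) := by
    have := (hls.sub_const t').abs
    rwa [pow_eq_zero_iff two_ne_zero |>.1 h1, abs_zero] at this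
  have h4 : Tendsto (fun n => ‖y (θ n) - x'‖) atTop (𝓝 0) := by
    have := (hly.sub_const x').norm
    rwa [pow_eq_zero_iff two_ne_zero |>.1 h2] at this
  obtain ⟨n, hn1, hn2⟩ := ((h3.eventually_lt_const (half_pos hσ)).and
    (h4.eventually_lt_const (half_pos hσ))).exists
  rcases hfar (θ n) with h | h <;> linarith

end

section
variable {d : ℕ}
local notation:max "𝔼" d:max => EuclideanSpace ℝ (Fin d)
variable {α T : ℝ} {H : ℝ → 𝔼 d → ℝ → 𝔼 d → ℝ} {U V w g : ℝ → 𝔼 d → ℝ}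

/-- The subsolution inequality at a point passes to a larger function with the same value there. -/
theorem caputo_le_of_le_of_eq {f h : ℝ → ℝ} (hα₀ : 0 < α) (hα₁ : α < 1) {t C r₀ M X : ℝ}
    (ht : 0 < t) (hh : AEStronglyMeasurable h (volume.restrict (Icc 0 t)))
    (hfh : ∀ s ∈ Icc 0 t, f s ≤ h s) (heq : h t = f t) (hM : ∀ s ∈ Icc 0 t, h s ≤ M)
    (hC : 0 ≤ C) (hr₀ : 0 < r₀) (hlow : ∀ τ ∈ Ioc 0 t, τ ≤ r₀ → -(C * τ) ≤ h t - h (t - τ))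
    (hf : FracKExists α 0 f t) (hX : fracK α 0 f t + X ≤ 0) :
    FracKExists α 0 h t ∧ fracK α 0 h t + X ≤ 0 := by
  have hmem : ∀ τ ∈ Ioc 0 t, t - τ ∈ Icc 0 t := fun τ hτ =>
    ⟨by linarith [hτ.2], by linarith [hτ.1]⟩
  -- The stability lemma is applied to constant sequences: it only asks that the members be
  -- asymptotically below the limit function, and f ≤ h.
  refine caputoFrom_add_le_of_limit (T := t) (M := M) (C := C) (r₀ := r₀) (F := fun _ => f)
    (A := fun _ => f t) (R := fun _ => 0) (S := fun _ => t) (Y := fun _ => X) hα₀ hα₁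
    (fun _ => ⟨ht, le_rfl⟩) ht le_rfl le_rfl (fun _ => le_rfl) (fun _ => hf) hh hC hr₀
    (fun _ τ hτ hτr => ?_) hlow (fun _ s hs => (hfh s hs).trans (hM s hs)) hM ?_
    tendsto_const_nhds tendsto_const_nhds (fun τ hτ e he => Eventually.of_forall fun _ => ?_)
    (fun e he => Eventually.of_forall fun _ => ?_) tendsto_const_nhds
    (fun e he => Eventually.of_forall fun _ => hX.trans he.le)
  · have h1 := hlow τ hτ hτr
    have h2 := hfh _ (hmem τ hτ)
    linarith
  · rw [heq]; exact tendsto_const_nhds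
  · have := hfh _ (hmem τ ⟨hτ.1, hτ.2.le⟩)
    linarith
  · have := hfh 0 ⟨le_rfl, ht.le⟩
    linarith

/-- Upper bound for the Caputo derivative of a function bounded below by two competitors. -/
theorem fracK_zero_le_of_bounds {h k : ℝ → ℝ} (hα₀ : 0 < α) (hα₁ : α < 1) {t r C A : ℝ}
    (hr : 0 < r) (hrt : r ≤ t) (hh : FracKExists α 0 h t)
    (hk : IntegrableOn (fun τ => (A - k (t - τ)) / τ ^ (α + 1)) (Ioc r t))
    (hnear : ∀ τ ∈ Ioc 0 r, h t - h (t - τ) ≤ C * τ)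
    (hfar : ∀ τ ∈ Ioc r t, h t - h (t - τ) ≤ k (t - τ) - A) (h0 : h t - h 0 ≤ k 0 - A) :
    fracK α 0 h t ≤ α / Real.Gamma (1 - α) * (C * (r ^ (1 - α) / (1 - α))) -
      caputoFrom α r A k t := by
  have hΓ : 0 < Real.Gamma (1 - α) := Real.Gamma_pos_of_pos (by linarith)
  have ht : 0 < t := hr.trans_le hrt
  have hun : Ioc 0 r ∪ Ioc r t = Ioc 0 t := Ioc_union_Ioc_eq_Ioc hr.le hrt
  unfold FracKExists at hh
  have h1 : ∫ τ in Ioc 0 r, (h t - h (t - τ)) / τ ^ (α + 1) ≤ C * (r ^ (1 - α) / (1 - α)) := by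
    rw [← integral_rpow_neg_Ioc hα₁ hr.le, ← integral_const_mul]
    refine setIntegral_mono_on (hh.mono_set (hun ▸ subset_union_left))
      ((integrableOn_rpow_neg_Ioc hα₁ r).const_mul C) measurableSet_Ioc fun τ hτ => ?_
    rw [← mul_div_rpow_add_one hτ.1]
    exact div_le_div_of_nonneg_right (hnear τ hτ) (Real.rpow_nonneg hτ.1.le _)
  have h2 : ∫ τ in Ioc r t, (h t - h (t - τ)) / τ ^ (α + 1) ≤
      -∫ τ in Ioc r t, (A - k (t - τ)) / τ ^ (α + 1) := by
    rw [← integral_neg]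
    refine setIntegral_mono_on (hh.mono_set (hun ▸ subset_union_right)) hk.neg
      measurableSet_Ioc fun τ hτ => ?_
    rw [← neg_div]
    exact div_le_div_of_nonneg_right (by linarith [hfar τ hτ])
      (Real.rpow_nonneg (hr.trans hτ.1).le _)
  have h3 : (h t - h 0) / (t ^ α * Real.Gamma (1 - α)) ≤
      -((A - k 0) / (t ^ α * Real.Gamma (1 - α))) := by
    rw [← neg_div]
    exact div_le_div_of_nonneg_right (by linarith)
      (mul_nonneg (Real.rpow_nonneg ht.le _) hΓ.le)
  have h4 : ∫ τ in Ioc 0 t, (h t - h (t - τ)) / τ ^ (α + 1) =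
      (∫ τ in Ioc 0 r, (h t - h (t - τ)) / τ ^ (α + 1)) +
        ∫ τ in Ioc r t, (h t - h (t - τ)) / τ ^ (α + 1) := by
    rw [← hun]
    exact setIntegral_union (Ioc_disjoint_Ioc_of_le le_rfl) measurableSet_Ioc
      (hh.mono_set (hun ▸ subset_union_left)) (hh.mono_set (hun ▸ subset_union_right))
  have h5 := mul_le_mul_of_nonneg_left (add_le_add h1 h2)
    (show 0 ≤ α / Real.Gamma (1 - α) by positivity)
  unfold fracK caputoFrom
  rw [h4]
  rw [mul_add, mul_add, mul_neg] at h5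
  rw [mul_add]
  linarith

/-- Raising a function to `g` where `g` lies above it. -/
noncomputable def bump (t' : ℝ) (x' : 𝔼 d) (σ : ℝ) (U g : ℝ → 𝔼 d → ℝ) : ℝ → 𝔼 d → ℝ :=
  fun t x => open Classical in if |t - t'| < σ ∧ ‖x - x'‖ < σ then max (U t x) (g t x) else U t x

theorem le_bump (t' : ℝ) (x' : 𝔼 d) (σ : ℝ) (U g : ℝ → 𝔼 d → ℝ) (t : ℝ) (x : 𝔼 d) :
    U t x ≤ bump t' x' σ U g t x := by
  unfold bump; split_ifs
  exacts [le_max_left _ _, le_rfl]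

theorem le_bump_of_near {t' : ℝ} {x' : 𝔼 d} {σ : ℝ} (U g : ℝ → 𝔼 d → ℝ) {t : ℝ} {x : 𝔼 d}
    (ht : |t - t'| < σ) (hx : ‖x - x'‖ < σ) : g t x ≤ bump t' x' σ U g t x := by
  unfold bump; rw [if_pos ⟨ht, hx⟩]; exact le_max_right _ _

theorem bump_eq_of_ne {t' : ℝ} {x' : 𝔼 d} {σ : ℝ} {U g : ℝ → 𝔼 d → ℝ} {t : ℝ} {x : 𝔼 d}
    (h : bump t' x' σ U g t x ≠ U t x) :
    |t - t'| < σ ∧ ‖x - x'‖ < σ ∧ U t x < g t x ∧ bump t' x' σ U g t x = g t x := by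
  unfold bump at h ⊢
  split_ifs at h ⊢ with hn
  · rcases le_total (g t x) (U t x) with h1 | h1
    · exact absurd (max_eq_left h1) h
    · rw [max_eq_right h1] at h ⊢
      exact ⟨hn.1, hn.2, lt_of_le_of_ne h1 (Ne.symm h), rfl⟩
  · exact absurd rfl h

/-- Inside the neighbourhood the bump is a maximum of semicontinuous functions. By `hfar` it is
inactive on the outer ring, so near any point outside it agrees with U. -/
theorem upperSemicontinuousOn_bump {t' : ℝ} {x' : 𝔼 d} {σ : ℝ} (hσ : 0 < σ)
    (hU : UpperSemicontinuousOn (fun q : ℝ × 𝔼 d => U q.1 q.2) (Icc 0 T ×ˢ univ))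
    (hg : ContinuousOn (fun q : ℝ × 𝔼 d => g q.1 q.2) (Icc 0 T ×ˢ univ))
    (hfar : ∀ t ∈ Icc 0 T, ∀ x, |t - t'| < σ → ‖x - x'‖ < σ →
      (σ / 2 ≤ |t - t'| ∨ σ / 2 ≤ ‖x - x'‖) → g t x ≤ U t x) :
    UpperSemicontinuousOn (fun q : ℝ × 𝔼 d => bump t' x' σ U g q.1 q.2) (Icc 0 T ×ˢ univ) := by
  rintro ⟨t, x⟩ hq c hc
  by_cases hnear : |t - t'| < σ ∧ ‖x - x'‖ < σ
  · have hUc := (le_bump t' x' σ U g t x).trans_lt hc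
    have hgc := (le_bump_of_near U g hnear.1 hnear.2).trans_lt hc
    filter_upwards [hU _ hq c hUc, (hg _ hq).eventually_lt_const hgc] with p h1 h2
    by_cases h : bump t' x' σ U g p.1 p.2 = U p.1 p.2
    · rwa [h]
    · rwa [(bump_eq_of_ne h).2.2.2]
  · have hUc := (le_bump t' x' σ U g t x).trans_lt hc
    have hopen : ∀ᶠ p in 𝓝[Icc 0 T ×ˢ univ] (t, x), σ / 2 ≤ |p.1 - t'| ∨ σ / 2 ≤ ‖p.2 - x'‖ := by
      refine nhdsWithin_le_nhds ?_
      have h1 : Continuous fun p : ℝ × 𝔼 d => |p.1 - t'| := by fun_prop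
      have h2 : Continuous fun p : ℝ × 𝔼 d => ‖p.2 - x'‖ := by fun_prop
      rcases not_and_or.1 hnear with h | h
      · exact (h1.tendsto (t, x) |>.eventually_const_lt
          (show σ / 2 < |t - t'| by linarith [not_lt.1 h])).mono fun p hp => Or.inl hp.le
      · exact (h2.tendsto (t, x) |>.eventually_const_lt
          (show σ / 2 < ‖x - x'‖ by linarith [not_lt.1 h])).mono fun p hp => Or.inr hp.le
    filter_upwards [hU _ hq c hUc, hopen, self_mem_nhdsWithin] with p h1 h2 h3
    by_cases h : bump t' x' σ U g p.1 p.2 = U p.1 p.2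
    · rwa [h]
    · have h4 := bump_eq_of_ne h
      exact absurd (hfar p.1 h3.1 p.2 h4.1 h4.2.1 h2) (not_le.2 h4.2.2.1)

end

section
variable {d : ℕ}
local notation:max "𝔼" d:max => EuclideanSpace ℝ (Fin d)
variable {α T : ℝ} {H : ℝ → 𝔼 d → ℝ → 𝔼 d → ℝ} {U V : ℝ → 𝔼 d → ℝ}

theorem gradient_add_const' (f : 𝔼 d → ℝ) (κ : ℝ) (x : 𝔼 d) :
    gradient (fun y => f y + κ) x = gradient f x := by
  simp [gradient]

/-- The bump construction in Perron's method yields a subsolution. -/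
theorem caputoSubsolution_bump (hα₀ : 0 < α) (hα₁ : α < 1)
    (hHm : ∀ t ∈ Icc 0 T, ∀ x p : 𝔼 d, Monotone fun r => H t x r p)
    (hU : CaputoSubsolution α T H U)
    (hV : UpperSemicontinuousOn (fun q : ℝ × 𝔼 d => V q.1 q.2) (Icc 0 T ×ˢ univ))
    {B M : ℝ} (hUB : ∀ t ∈ Icc 0 T, ∀ x, |U t x| ≤ B) (hVB : ∀ t ∈ Icc 0 T, ∀ x, |V t x| ≤ B)
    (hUV : ∀ t ∈ Icc 0 T, ∀ x, -V t x ≤ U t x)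
    {φ : ℝ → 𝔼 d → ℝ} (hφ : IsTestFunction T φ) {a b ρ r σ Λ κ e C : ℝ} {t' : ℝ} {c x' : 𝔼 d}
    (ha : 0 ≤ a) (ht' : t' ∈ Icc 0 T) (hr : 0 < r) (hra : r + σ ≤ t' - a)
    (hball : ∀ x, ‖x - x'‖ < σ → x ∈ Metric.ball c ρ) (hΛ : 0 ≤ Λ) (hC : 0 ≤ C)
    {g : ℝ → 𝔼 d → ℝ} (hgdef : g = fun t x => -(φ t x + penalty b t' x' Λ t x + κ))
    (hwusc : UpperSemicontinuousOn (fun q : ℝ × 𝔼 d => bump t' x' σ U g q.1 q.2)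
      (Icc 0 T ×ˢ univ))
    (hwM : ∀ t ∈ Icc 0 T, ∀ x, bump t' x' σ U g t x ≤ M)
    (hfar : ∀ t ∈ Icc a T, ∀ x ∈ Metric.closedBall c ρ, (σ ≤ |t - t'| ∨ σ ≤ ‖x - x'‖) →
      g t x ≤ U t x)
    (hnear : ∀ s ∈ Ioc 0 T, ∀ y, |s - t'| < σ → ‖y - x'‖ < σ →
      e < caputoFrom α r (φ s y + κ) (fun q => V q y) s +
        dualHamiltonian H s y (φ s y + κ) (gradient (φ s) y + (2 : ℝ) • (y - x')))
    (hlip : ∀ s ∈ Ioc 0 T, ∀ y, |s - t'| < σ → ‖y - x'‖ < σ → ∀ τ ∈ Ioc 0 r,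
      -(C * τ) ≤ φ s y - φ (s - τ) y)
    (hsmall : α / Real.Gamma (1 - α) * ((C + 3 * T) * (r ^ (1 - α) / (1 - α))) ≤ e) :
    CaputoSubsolution α T H (bump t' x' σ U g) := by
  set w := bump t' x' σ U g with hw
  have hgw : ∀ t ∈ Icc a T, ∀ x ∈ Metric.closedBall c ρ, g t x ≤ w t x := by
    intro t ht x hx
    by_cases h : |t - t'| < σ ∧ ‖x - x'‖ < σ
    · exact le_bump_of_near U g h.1 h.2
    · refine (hfar t ht x hx ?_).trans (le_bump _ _ _ _ _ _ _)
      rcases not_and_or.1 h with h | h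
      exacts [Or.inl (not_lt.1 h), Or.inr (not_lt.1 h)]
  have hT : 0 ≤ T := ht'.1.trans ht'.2
  have hwlow : ∀ t ∈ Icc 0 T, ∀ x, -B ≤ w t x := fun t ht x =>
    (neg_le_of_abs_le (hUB t ht x)).trans (le_bump _ _ _ _ _ _ _)
  intro a₁ b₁ ha₁ hab₁ hb₁ c₁ ρ₁ hρ₁ ψ hψ s hs y hy hmax
  have hsT : s ∈ Ioc 0 T := ⟨ha₁.trans_lt hs.1, hs.2.trans hb₁⟩
  have hsT' : s ∈ Icc 0 T := ⟨hsT.1.le, hsT.2⟩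
  have hIcc : ∀ q ∈ Icc 0 s, q ∈ Icc 0 T := fun q hq => ⟨hq.1, hq.2.trans hsT.2⟩
  have hyc : y ∈ Metric.closedBall c₁ ρ₁ := Metric.ball_subset_closedBall hy
  obtain ⟨C', r₀, hC', hr₀, hlow⟩ := hψ.exists_lower_bound (x := y) (f := fun q => w q y) ha₁ hs.1
    hsT.2 fun q hq => hmax q ⟨hq.1, hq.2.trans hs.2⟩ y hyc
  have hmeas := hwusc.aestronglyMeasurable_time_slice hsT.2 y
  -- Where w and U agree, a maximum of w - ψ is one of U - ψ, and the inequality for U passes to the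
  -- larger function.
  by_cases hne : w s y = U s y
  · obtain ⟨h1, h2⟩ := hU a₁ b₁ ha₁ hab₁ hb₁ c₁ ρ₁ hρ₁ ψ hψ s hs y hy fun q hq x hx => by
      rw [← hne]
      linarith [hmax q hq x hx, le_bump t' x' σ U g q x]
    rw [hne]
    exact caputo_le_of_le_of_eq (h := fun q => w q y) hα₀ hα₁ hsT.1 hmeas
      (fun q _ => le_bump _ _ _ _ _ _ _) hne (fun q hq => hwM q (hIcc q hq) y) hC' hr₀ hlow h1 h2
  · obtain ⟨hst, hyx, -, hwg⟩ := bump_eq_of_ne hne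
    rw [← hw] at hwg
    have hst' := abs_lt.1 hst
    have hyball := hball y hyx
    have hpen : ∀ q x, 0 ≤ penalty b t' x' Λ q x := fun q x =>
      (mul_nonneg hΛ (expNegInvGlue.nonneg _)).trans (le_penalty b t' x' hΛ q x).1
    have hwA : w s y ≤ -(φ s y + κ) := by
      rw [hwg, hgdef]; simp only; linarith [hpen s y]
    -- In the recent past w ≥ g with equality at (s,y), so the increments of w are at most those of
    -- the smooth g.
    have hnr : ∀ τ ∈ Ioc 0 r, w s y - w (s - τ) y ≤ (C + 3 * T) * τ := by
      intro τ hτ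
      have h1 := hgw (s - τ) ⟨by linarith [hτ.2], by linarith [hτ.1, hsT.2]⟩ y
        (Metric.ball_subset_closedBall hyball)
      have h2 := hlip s hsT y hst hyx τ hτ
      have h3 := penalty_sub_ge (b := b) x' hΛ ht' hsT' hτ.1.le (by linarith [hτ.2]) y
      rw [hwg]
      rw [hgdef] at h1 ⊢
      simp only at h1 ⊢
      linarith
    have hmemτ : ∀ τ ∈ Ioc 0 s, s - τ ∈ Icc 0 T := fun τ hτ =>
      ⟨by linarith [hτ.2], by linarith [hτ.1, hsT.2]⟩
    have hM' : ∀ q ∈ Icc 0 T, w q y ≤ |M| := fun q hq => (hwM q hq y).trans (le_abs_self M)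
    have hB0 : 0 ≤ B := (abs_nonneg _).trans (hUB s hsT' y)
    -- Near τ = 0 the lower bound comes from ψ and the upper one from g.
    have hFE : FracKExists α 0 (fun q => w q y) s := by
      refine integrableOn_caputo_of_bounds (C := C' + (C + 3 * T)) (K := |M| + B)
        (r₀ := min r₀ r) hα₀ hα₁ hmeas (by positivity) (by positivity) (by positivity)
        (fun τ hτ hτr => ?_) (fun τ hτ => ?_)
      · have h1 := hlow τ hτ (hτr.trans (min_le_left _ _))
        have h2 := hnr τ ⟨hτ.1, hτr.trans (min_le_right _ _)⟩
        have h3 : 0 ≤ C' * τ := mul_nonneg hC' hτ.1.le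
        have h4 : 0 ≤ (C + 3 * T) * τ := mul_nonneg (by positivity) hτ.1.le
        rw [add_mul C', abs_le]
        constructor <;> linarith
      · have h1 := hM' s hsT'
        have h2 := hM' _ (hmemτ τ hτ)
        have h3 := hwlow s hsT' y
        have h4 := hwlow _ (hmemτ τ hτ) y
        rw [abs_le]
        constructor <;> linarith
    refine ⟨hFE, ?_⟩
    -- g - ψ inherits the local maximum of w - ψ, since g ≤ w with equality at y; so ψ and g have
    -- equal gradients.
    have hgrad : gradient (ψ s) y = -(gradient (φ s) y + (2 : ℝ) • (y - x')) := by
      have hpt := isTestFunction_penalty T b t' x' Λ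
      have hd := ((hφ.differentiableAt hsT y).add (hpt.differentiableAt hsT y)).add_const κ |>.neg
      have hd' : DifferentiableAt ℝ (g s) y := by rw [hgdef]; exact hd
      have h1 : IsLocalMax (fun z => g s z - ψ s z) y := by
        filter_upwards [Metric.isOpen_ball.mem_nhds hy, Metric.isOpen_ball.mem_nhds hyball]
          with z hz1 hz2
        have h2 := hmax s ⟨hs.1.le, hs.2⟩ z (Metric.ball_subset_closedBall hz1)
        have h3 := hgw s ⟨by linarith, hsT.2⟩ z (Metric.ball_subset_closedBall hz2)
        linarith
      rw [← gradient_eq_of_isLocalMax_sub hd' (hψ.differentiableAt hsT y) h1, hgdef]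
      have h4 := gradient_neg' (fun x => φ s x + penalty b t' x' Λ s x + κ) y
      rw [h4, gradient_add_const', gradient_add' (hφ.differentiableAt hsT y)
        (hpt.differentiableAt hsT y), gradient_penalty]
    have hk : IntegrableOn (fun τ => ((φ s y + κ) - V (s - τ) y) / τ ^ (α + 1)) (Ioc r s) :=
      integrableOn_caputo_of_pos (f := fun q => V q y) (K := |φ s y + κ| + B) hα₀
        (hV.aestronglyMeasurable_time_slice hsT.2 _) hr (by positivity) fun τ hτ =>
          (abs_sub _ _).trans (add_le_add_right (hVB _ (hmemτ τ hτ) _) _)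
    -- The remote past is compared with the lower envelope, by w ≥ U ≥ -V.
    have hwV : ∀ q ∈ Icc 0 T, w s y - w q y ≤ V q y - (φ s y + κ) := fun q hq => by
      have h1 := hUV q hq y
      have h2 := le_bump t' x' σ U g q y
      linarith
    have hK := fracK_zero_le_of_bounds (h := fun q => w q y) (k := fun q => V q y)
      (A := φ s y + κ) hα₀ hα₁ hr (by linarith) hFE hk hnr
      (fun τ hτ => hwV _ (hmemτ τ ⟨hr.trans hτ.1, hτ.2⟩)) (hwV 0 ⟨le_rfl, hT⟩)
    have h1 := hnear s hsT y hst hyx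
    have h2 := hHm s hsT' y (gradient (ψ s) y) hwA
    simp only [dualHamiltonian, ← hgrad] at h1 h2
    linarith

/-- If the lower envelope of a subsolution is not a supersolution, then there is a larger
subsolution with the same values for small times. -/
theorem exists_larger_subsolution (hα₀ : 0 < α) (hα₁ : α < 1)
    (hHc : ContinuousOn (fun q : ℝ × 𝔼 d × ℝ × 𝔼 d => H q.1 q.2.1 q.2.2.1 q.2.2.2)
      (Icc 0 T ×ˢ univ))
    (hHm : ∀ t ∈ Icc 0 T, ∀ x p : 𝔼 d, Monotone fun r => H t x r p)
    (hU : CaputoSubsolution α T H U)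
    (hUusc : UpperSemicontinuousOn (fun q : ℝ × 𝔼 d => U q.1 q.2) (Icc 0 T ×ˢ univ))
    {B : ℝ} (hUB : ∀ t ∈ Icc 0 T, ∀ x, |U t x| ≤ B)
    (hnot : ¬CaputoSubsolution α T (dualHamiltonian H)
      (upperEnvelope T {fun t x => -U t x})) :
    ∃ w : ℝ → 𝔼 d → ℝ, CaputoSubsolution α T H w ∧
      UpperSemicontinuousOn (fun q : ℝ × 𝔼 d => w q.1 q.2) (Icc 0 T ×ˢ univ) ∧
      (∃ M, ∀ t ∈ Icc 0 T, ∀ x, w t x ≤ M) ∧ (∀ t x, U t x ≤ w t x) ∧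
      (∃ κ > 0, ∀ t < κ, ∀ x, w t x = U t x) ∧ ∃ t ∈ Icc 0 T, ∃ x, U t x < w t x := by
  set F : Set (ℝ → 𝔼 d → ℝ) := {fun t x => -U t x} with hFdef
  set V := upperEnvelope T F with hVdef
  have hF : F.Nonempty := singleton_nonempty _
  have hFB : ∀ w ∈ F, ∀ t ∈ Icc 0 T, ∀ x, w t x ≤ B := by
    rintro w rfl t ht x
    linarith [neg_le_of_abs_le (hUB t ht x)]
  have hVusc : UpperSemicontinuousOn (fun q : ℝ × 𝔼 d => V q.1 q.2) (Icc 0 T ×ˢ univ) :=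
    upperSemicontinuousOn_upperEnvelope hF hFB
  have hUV : ∀ t ∈ Icc 0 T, ∀ x, -V t x ≤ U t x := fun t ht x => by
    have : -U t x ≤ V t x := le_upperEnvelope hFB (mem_singleton _) ht x
    linarith
  have hVB : ∀ t ∈ Icc 0 T, ∀ x, |V t x| ≤ B := fun t ht x => by
    rw [abs_le]
    refine ⟨?_, upperEnvelope_le (g := fun _ _ => B) hF upperSemicontinuousOn_const hFB ht x⟩
    linarith [hUV t ht x, le_of_abs_le (hUB t ht x)]
  simp only [CaputoSubsolution, not_forall] at hnot
  obtain ⟨a, b, ha, hab, hb, c, ρ, hρ, φ, hφ, t', ht', x', hx', hmax, hbad⟩ := hnot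
  have ht'T : t' ∈ Ioc 0 T := ⟨ha.trans_lt ht'.1, ht'.2.trans hb⟩
  have ht'T' : t' ∈ Icc 0 T := ⟨ht'T.1.le, ht'T.2⟩
  have hta : 0 < t' - a := sub_pos.2 ht'.1
  have hB0 : 0 ≤ B := (abs_nonneg _).trans (hUB t' ht'T' x')
  have hΓ : 0 < Real.Gamma (1 - α) := Real.Gamma_pos_of_pos (by linarith)
  -- Otherwise `fracK_zero_add_le` would yield the inequality. Working with small r > 0 also covers
  -- the case in which K_0[V] is infinite.
  obtain ⟨e, he, hfreq⟩ : ∃ e > 0, ∃ᶠ r in 𝓝[>] (0 : ℝ), e < fracK α r (fun s => V s x') t' +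
      dualHamiltonian H t' x' (V t' x') (gradient (φ t') x') := by
    by_contra! hcon
    obtain ⟨C, r₀, hC, hr₀, hlow⟩ := hφ.exists_lower_bound (x := x') (f := fun q => V q x') ha ht'.1
      ht'T.2 fun q hq => hmax q ⟨hq.1, hq.2.trans ht'.2⟩ x' (Metric.ball_subset_closedBall hx')
    refine hbad (fracK_zero_add_le hα₀ hα₁ ht'T.1
      (hVusc.aestronglyMeasurable_time_slice ht'T.2 x')
      (fun s hs => le_of_abs_le (hVB s ⟨hs.1, hs.2.trans ht'T.2⟩ x')) hC hr₀ hlow fun e he => ?_)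
    filter_upwards [hcon e he, self_mem_nhdsWithin] with r hr hr0
    refine ⟨?_, hr⟩
    exact integrableOn_caputo_of_pos (f := fun q => V q x') (K := B + B) hα₀
      (hVusc.aestronglyMeasurable_time_slice ht'T.2 x') hr0 (by positivity) fun τ hτ =>
        (abs_sub _ _).trans (add_le_add (hVB _ ht'T' _)
          (hVB _ ⟨by linarith [hτ.2], by linarith [hτ.1, ht'T.2]⟩ _))
  obtain ⟨C, δ, hC, hδ, hlip⟩ := hφ.exists_lipschitz ht'T x'
  have hsmall : ∀ᶠ r in 𝓝[>] (0 : ℝ),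
      α / Real.Gamma (1 - α) * ((C + 3 * T) * (r ^ (1 - α) / (1 - α))) < e := by
    have h1 : Tendsto (fun r : ℝ => α / Real.Gamma (1 - α) *
        ((C + 3 * T) * (r ^ (1 - α) / (1 - α)))) (𝓝 0) (𝓝 (α / Real.Gamma (1 - α) *
        ((C + 3 * T) * ((0 : ℝ) ^ (1 - α) / (1 - α))))) :=
      (((tendsto_id.rpow_const (Or.inr (by linarith))).div_const _).const_mul _).const_mul _
    rw [Real.zero_rpow (by linarith), zero_div, mul_zero, mul_zero] at h1
    exact nhdsWithin_le_nhds (h1.eventually_lt_const he)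
  obtain ⟨r, ⟨hr1, hr2⟩, hr3⟩ := ((hfreq.and_eventually hsmall).and_eventually
    (Ioo_mem_nhdsGT (show (0 : ℝ) < min ((t' - a) / 2) (δ / 2) by positivity))).exists
  have hr4 := hr3.2.trans_le (min_le_left _ _)
  have hr5 := hr3.2.trans_le (min_le_right _ _)
  obtain ⟨σ₁, hσ₁, hnear⟩ := exists_nhds_lt_caputoFrom hα₀ hα₁ hHc hVusc hVB hφ ht'T hr3.1 hr1
  have hρ' : 0 < ρ - dist x' c := sub_pos.2 hx'
  -- The four bounds preserve the strict inequality, leave r + σ ≤ t' - a, stay in the Lipschitz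
  -- region of φ and remain in the ball.
  obtain ⟨σ, hσ, hσ1, hσ2, hσ3, hσ4⟩ : ∃ σ > 0, σ ≤ σ₁ ∧ σ ≤ (t' - a) / 2 ∧ σ ≤ δ / 2 ∧
      σ ≤ ρ - dist x' c :=
    ⟨min (min σ₁ ((t' - a) / 2)) (min (δ / 2) (ρ - dist x' c)), by positivity,
      (min_le_left _ _).trans (min_le_left _ _), (min_le_left _ _).trans (min_le_right _ _),
      (min_le_right _ _).trans (min_le_left _ _), (min_le_right _ _).trans (min_le_right _ _)⟩
  have hball : ∀ x, ‖x - x'‖ < σ → x ∈ Metric.ball c ρ := fun x hx => by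
    have := dist_triangle x x' c
    rw [← dist_eq_norm] at hx
    rw [Metric.mem_ball]; linarith
  obtain ⟨Λ, l, hΛ, hl0, hlσ, hgap⟩ := exists_penalty_gap (b := b) hVusc
    (fun t ht x => le_of_abs_le (hVB t ht x)) hφ.1 ha hmax hσ
  -- The shift by l puts g above -V by exactly l at the contact point.
  set κ := V t' x' - φ t' x' - l with hκ
  set g : ℝ → 𝔼 d → ℝ := fun t x => -(φ t x + penalty b t' x' Λ t x + κ) with hg
  have hgc : ContinuousOn (fun q : ℝ × 𝔼 d => g q.1 q.2) (Icc 0 T ×ˢ univ) :=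
    ((hφ.1.add (contDiff_penalty b t' x' Λ).continuous.continuousOn).add continuousOn_const).neg
  have hgU : ∀ t ∈ Icc a T, ∀ x ∈ Metric.closedBall c ρ,
      (σ / 2 ≤ |t - t'| ∨ σ / 2 ≤ ‖x - x'‖) → g t x ≤ U t x := fun t ht x hx h => by
    have h1 := hgap t ht x hx h
    have h2 := hUV t ⟨ha.trans ht.1, ht.2⟩ x
    simp only [hg, hκ]
    linarith
  have hwusc := upperSemicontinuousOn_bump (T := T) (t' := t') (x' := x') hσ hUusc hgc
    fun t ht x h1 h2 h3 => hgU t ⟨by linarith [(abs_lt.1 h1).1], ht.2⟩ x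
      (Metric.ball_subset_closedBall (hball x h2)) h3
  obtain ⟨M₂, hM₂⟩ := (isCompact_Icc.prod (isCompact_closedBall c ρ)).exists_bound_of_continuousOn
    (hgc.mono (prod_mono_right (subset_univ _)))
  have hwM : ∀ t ∈ Icc 0 T, ∀ x, bump t' x' σ U g t x ≤ max B M₂ := fun t ht x => by
    by_cases h : bump t' x' σ U g t x = U t x
    · rw [h]; exact (le_of_abs_le (hUB t ht x)).trans (le_max_left _ _)
    · obtain ⟨-, h2, -, h4⟩ := bump_eq_of_ne h
      rw [h4]
      exact ((le_abs_self _).trans (hM₂ (t, x) ⟨ht, Metric.ball_subset_closedBall (hball x h2)⟩)).trans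
        (le_max_right _ _)
  have hκ' : ∀ s y, φ s y + κ = φ s y + V t' x' - φ t' x' - l := fun s y => by rw [hκ]; ring
  refine ⟨bump t' x' σ U g, caputoSubsolution_bump hα₀ hα₁ hHm hU hVusc hUB hVB hUV hφ ha ht'T'
    hr3.1 (by linarith) hball hΛ hC hg hwusc hwM (fun t ht x hx h => hgU t ht x hx (h.imp
      (fun h => by linarith) fun h => by linarith)) (fun s hs y h1 h2 => ?_)
      (fun s hs y h1 h2 τ hτ => ?_) hr2.le, hwusc, ⟨_, hwM⟩, le_bump _ _ _ _ _,
      ⟨t' - σ, by linarith, fun t ht x => ?_⟩, ?_⟩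
  · rw [hκ']
    exact hnear s hs y l (h1.trans_le hσ1) (h2.trans_le hσ1) hl0.le (hlσ.trans_le hσ1)
  · have h3 := abs_lt.1 h1
    have h4 := hlip y (by rw [Metric.mem_ball, dist_eq_norm]; linarith) s hs (s - τ)
      ⟨by linarith [hτ.2], by linarith [hτ.1, hs.2]⟩ (by linarith) (by
        rw [abs_lt]
        constructor <;> linarith [hτ.1, hτ.2])
    rw [sub_sub_cancel, abs_of_pos hτ.1] at h4
    linarith [neg_abs_le (φ s y - φ (s - τ) y)]
  · by_contra h
    have h1 := (abs_lt.1 (bump_eq_of_ne h).1).1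
    linarith
  -- U may exceed -V at (t',x') itself, but at points arbitrarily near it is below -V(t',x') + l /
  -- 2, whereas g stays above that number.
  · have h1 := frequently_of_lt_upperEnvelope hF ht'T' (show V t' x' - l / 2 < V t' x' by linarith)
    have h2 : ∀ᶠ q in 𝓝[Icc 0 T ×ˢ univ] (t', x'), -V t' x' + l / 2 < g q.1 q.2 := by
      refine (hgc (t', x') ⟨ht'T', mem_univ _⟩).eventually_const_lt ?_
      simp only [hg, hκ, penalty_self ht'.2]
      linarith
    have h3 : ∀ᶠ q in 𝓝[Icc 0 T ×ˢ univ] (t', x'), |q.1 - t'| < σ ∧ ‖q.2 - x'‖ < σ := by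
      refine nhdsWithin_le_nhds ?_
      have h4 : Continuous fun p : ℝ × 𝔼 d => |p.1 - t'| := by fun_prop
      have h5 : Continuous fun p : ℝ × 𝔼 d => ‖p.2 - x'‖ := by fun_prop
      exact (h4.tendsto (t', x') |>.eventually_lt_const (by simpa using hσ)).and
        (h5.tendsto (t', x') |>.eventually_lt_const (by simpa using hσ))
    obtain ⟨q, ⟨⟨w, rfl, hwq⟩, h4, h5, h6⟩, hqD⟩ :=
      ((h1.and_eventually (h2.and h3)).and_eventually self_mem_nhdsWithin).exists
    refine ⟨q.1, hqD.1, q.2, ?_⟩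
    have := le_bump_of_near U g h5 h6
    linarith

end

/-! ### Barriers -/

section
variable {d : ℕ}
local notation:max "𝔼" d:max => EuclideanSpace ℝ (Fin d)
variable {α T : ℝ} {H : ℝ → 𝔼 d → ℝ → 𝔼 d → ℝ} {U V w : ℝ → 𝔼 d → ℝ}

/-- A number in [0,1] is at most its power of exponent α < 1, here for 1 - τ / t. The bound linear
in τ offsets the singularity of the kernel. -/
theorem sub_rpow_bounds (hα₀ : 0 < α) (hα₁ : α < 1) {t τ : ℝ} (ht : 0 < t) (hτ : τ ∈ Ioc 0 t) :
    0 ≤ t ^ α - (t - τ) ^ α ∧ t ^ α - (t - τ) ^ α ≤ t ^ α / t * τ := by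
  have h0 : 0 ≤ t - τ := by linarith [hτ.2]
  refine ⟨sub_nonneg.2 (Real.rpow_le_rpow h0 (by linarith [hτ.1]) hα₀.le), ?_⟩
  have h1 : 0 ≤ (t - τ) / t := div_nonneg h0 ht.le
  have h2 : (t - τ) / t ≤ 1 := (div_le_one ht).2 (by linarith [hτ.1])
  have h3 : (t - τ) / t ≤ ((t - τ) / t) ^ α := by
    have := Real.rpow_le_rpow_of_exponent_ge_of_imp h1 h2 hα₁.le (fun _ h => absurd h one_ne_zero)
    rwa [Real.rpow_one] at this
  have h4 : (t - τ) ^ α = t ^ α * ((t - τ) / t) ^ α := by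
    rw [← Real.mul_rpow ht.le h1, mul_div_cancel₀ _ ht.ne']
  have h5 := mul_le_mul_of_nonneg_left h3 (Real.rpow_nonneg ht.le α)
  have h6 : t ^ α / t * τ = t ^ α - t ^ α * ((t - τ) / t) := by field_simp; ring
  rw [h6, h4]
  linarith

theorem gradient_comp_add_right (f : 𝔼 d → ℝ) (x z : 𝔼 d) :
    gradient (fun y => f (y + z)) x = gradient f (x + z) := by
  simp [gradient, fderiv_comp_add_right]

/-- A smooth periodic initial profile decreasing like `t^α` is a subsolution. -/
theorem exists_caputoSubsolution_of_contDiff (hα₀ : 0 < α) (hα₁ : α < 1)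
    (hHper : ∀ t ∈ Icc 0 T, ∀ (r : ℝ) (p : 𝔼 d), ZPeriodic (fun x => H t x r p))
    (hHc : ContinuousOn (fun q : ℝ × 𝔼 d × ℝ × 𝔼 d => H q.1 q.2.1 q.2.2.1 q.2.2.2)
      (Icc 0 T ×ˢ univ))
    (hHm : ∀ t ∈ Icc 0 T, ∀ x p : 𝔼 d, Monotone fun r => H t x r p)
    {β : 𝔼 d → ℝ} (hβ : ContDiff ℝ 1 β) (hβper : ZPeriodic β) :
    ∃ K : ℝ, 0 ≤ K ∧ CaputoSubsolution α T H fun t x => β x - K * t ^ α := by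
  have hΓ : 0 < Real.Gamma (1 - α) := Real.Gamma_pos_of_pos (by linarith)
  have hgper : ∀ x (z : Fin d → ℤ),
      gradient β (x + WithLp.toLp 2 (fun i => (z i : ℝ))) = gradient β x := fun x z => by
    rw [← gradient_comp_add_right]
    congr 1
    exact funext fun y => hβper y z
  have hgc : Continuous (gradient β) :=
    (InnerProductSpace.toDual ℝ (𝔼 d)).symm.continuous.comp (hβ.continuous_fderiv one_ne_zero)
  -- β does not depend on time, so the degenerate interval [0,0] suffices to bound it.
  obtain ⟨R, hR⟩ := UpperSemicontinuousOn.exists_bound_of_periodic (T := 0) (u := fun _ x => β x)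
    (hβ.continuous.comp continuous_snd).continuousOn.upperSemicontinuousOn fun _ _ => hβper
  obtain ⟨N, hN⟩ := UpperSemicontinuousOn.exists_bound_of_periodic (T := T)
    (u := fun t x => H t x R (gradient β x))
    (ContinuousOn.upperSemicontinuousOn (hHc.comp (t := Icc 0 T ×ˢ univ)
      (f := fun q : ℝ × 𝔼 d => (q.1, q.2, R, gradient β q.2)) (by fun_prop)
      fun q hq => ⟨hq.1, mem_univ _⟩)) (fun t ht x z => by
        simp only [hgper]; exact hHper t ht R _ x z)
  -- This K makes the boundary term equal to -max N 0. The integral term is nonpositive since the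
  -- profile decreases in time, and H ≤ N by monotonicity in the value.
  refine ⟨Real.Gamma (1 - α) * max N 0, by positivity, ?_⟩
  set K := Real.Gamma (1 - α) * max N 0 with hK
  have hK0 : 0 ≤ K := by positivity
  intro a b ha hab hb c ρ hρ φ hφ t ht x hx hmax
  have htT : t ∈ Ioc 0 T := ⟨ha.trans_lt ht.1, ht.2.trans hb⟩
  have htα : 0 < t ^ α := Real.rpow_pos_of_pos htT.1 _
  have hgrad : gradient (φ t) x = gradient β x := by
    have hd : DifferentiableAt ℝ (fun y => β y + -(K * t ^ α)) x :=
      (hβ.differentiable one_ne_zero x).add_const _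
    rw [← gradient_add_const' β (-(K * t ^ α)) x]
    refine (gradient_eq_of_isLocalMax_sub hd (hφ.differentiableAt htT x) ?_).symm
    filter_upwards [Metric.isOpen_ball.mem_nhds hx] with y hy
    have := hmax t ⟨ht.1.le, ht.2⟩ y (Metric.ball_subset_closedBall hy)
    linarith
  have hdiff : ∀ τ, (β x - K * t ^ α) - (β x - K * (t - τ) ^ α) =
      -(K * (t ^ α - (t - τ) ^ α)) := fun τ => by ring
  constructor
  · refine integrableOn_caputo_of_bounds (f := fun s => β x - K * s ^ α) (C := K * (t ^ α / t))
      (K := K * t ^ α) (r₀ := t) hα₀ hα₁ ?_ ?_ htT.1 (by positivity) (fun τ hτ _ => ?_)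
      (fun τ hτ => ?_)
    · have : Measurable fun s : ℝ => β x - K * s ^ α := by fun_prop
      exact this.aestronglyMeasurable
    · have := htT.1; positivity
    · have := sub_rpow_bounds hα₀ hα₁ htT.1 hτ
      rw [hdiff, abs_neg, abs_of_nonneg (mul_nonneg hK0 this.1)]
      exact (mul_le_mul_of_nonneg_left this.2 hK0).trans_eq (by ring)
    · have := sub_rpow_bounds hα₀ hα₁ htT.1 hτ
      have h2 : 0 ≤ (t - τ) ^ α := Real.rpow_nonneg (by linarith [hτ.2]) _
      rw [hdiff, abs_neg, abs_of_nonneg (mul_nonneg hK0 this.1)]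
      exact mul_le_mul_of_nonneg_left (by linarith) hK0
  · have h1 : fracK α 0 (fun s => β x - K * s ^ α) t ≤ -max N 0 := by
      unfold fracK
      have h2 : ∫ τ in Ioc 0 t, ((β x - K * t ^ α) - (β x - K * (t - τ) ^ α)) / τ ^ (α + 1) ≤ 0 := by
        refine setIntegral_nonpos measurableSet_Ioc fun τ hτ => ?_
        rw [hdiff]
        exact div_nonpos_of_nonpos_of_nonneg
          (neg_nonpos.2 (mul_nonneg hK0 (sub_rpow_bounds hα₀ hα₁ htT.1 hτ).1))
          (Real.rpow_nonneg hτ.1.le _)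
      have h3 := mul_nonpos_of_nonneg_of_nonpos
        (show 0 ≤ α / Real.Gamma (1 - α) by positivity) h2
      have h4 : ((β x - K * t ^ α) - (β x - K * (0 : ℝ) ^ α)) / (t ^ α * Real.Gamma (1 - α)) =
          -max N 0 := by
        rw [Real.zero_rpow hα₀.ne', hK]
        field_simp
        ring
      linarith
    have h5 := hHm t ⟨htT.1.le, htT.2⟩ x (gradient β x)
      (show β x - K * t ^ α ≤ R by
        have := hR 0 ⟨le_rfl, le_rfl⟩ x
        have : 0 ≤ K * t ^ α := by positivity
        linarith)
    have h6 := hN t ⟨htT.1.le, htT.2⟩ x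
    rw [hgrad]
    simp only at h5
    linarith [le_max_left N 0]

/-- A smooth nonnegative periodic function vanishing exactly on the lattice. -/
noncomputable def latticeDist (x : 𝔼 d) : ℝ := ∑ i, (1 - Real.cos (x i * (2 * Real.pi)))

theorem contDiff_latticeDist : ContDiff ℝ 1 (latticeDist (d := d)) := by
  unfold latticeDist
  fun_prop

theorem latticeDist_nonneg (x : 𝔼 d) : 0 ≤ latticeDist x :=
  Finset.sum_nonneg fun _ _ => sub_nonneg.2 (Real.cos_le_one _)

theorem zPeriodic_latticeDist : ZPeriodic (latticeDist (d := d)) := by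
  intro x z
  refine Finset.sum_congr rfl fun i _ => ?_
  rw [PiLp.add_apply, add_mul, Real.cos_add_int_mul_two_pi]

theorem exists_eq_of_latticeDist_eq_zero {x : 𝔼 d} (h : latticeDist x = 0) :
    ∃ z : Fin d → ℤ, x = WithLp.toLp 2 (fun i => (z i : ℝ)) := by
  have h1 := (Finset.sum_eq_zero_iff_of_nonneg
    fun i _ => sub_nonneg.2 (Real.cos_le_one (x i * (2 * Real.pi)))).1 h
  have h2 : ∀ i, ∃ n : ℤ, x i = n := fun i => by
    obtain ⟨n, hn⟩ := (Real.cos_eq_one_iff _).1 (sub_eq_zero.1 (h1 i (Finset.mem_univ i))).symm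
    exact ⟨n, (mul_right_cancel₀ Real.two_pi_pos.ne' hn).symm⟩
  choose z hz using h2
  exact ⟨z, by ext i; exact hz i⟩

/-- Smooth periodic functions below a continuous periodic function touch it approximately. -/
theorem exists_contDiff_periodic_le {f : 𝔼 d → ℝ} (hf : Continuous f) (hper : ZPeriodic f)
    (y : 𝔼 d) {ε : ℝ} (hε : 0 < ε) :
    ∃ β : 𝔼 d → ℝ, ContDiff ℝ 1 β ∧ ZPeriodic β ∧ (∀ x, β x ≤ f x) ∧ β y = f y - ε := by
  have hψc : Continuous fun x => latticeDist (x - y) :=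
    contDiff_latticeDist.continuous.comp (continuous_id.sub continuous_const)
  -- Off this set the constant f y - ε already lies below f. On it the lattice function is bounded
  -- away from 0, so a large multiple pushes the profile below min f.
  set K := Metric.closedBall (0 : 𝔼 d) √d ∩ {x | f x ≤ f y - ε} with hK
  have hKc : IsCompact K :=
    (isCompact_closedBall _ _).inter_right (isClosed_le hf continuous_const)
  obtain ⟨C, hC, hCK⟩ : ∃ C : ℝ, 0 ≤ C ∧ ∀ x ∈ K, f y - ε - C * latticeDist (x - y) ≤ f x := by
    rcases K.eq_empty_or_nonempty with hemp | hne
    · exact ⟨0, le_rfl, fun x hx => absurd hx (by simp [hemp])⟩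
    obtain ⟨x₁, hx₁, hmin⟩ := hKc.exists_isMinOn hne hψc.continuousOn
    obtain ⟨x₂, hx₂, hmin'⟩ := hKc.exists_isMinOn hne hf.continuousOn
    have hpos : 0 < latticeDist (x₁ - y) := by
      refine lt_of_le_of_ne (latticeDist_nonneg _) fun h => ?_
      obtain ⟨z, hz⟩ := exists_eq_of_latticeDist_eq_zero h.symm
      have h1 := hper y z
      rw [← hz, add_sub_cancel] at h1
      have h2 : f x₁ ≤ f y - ε := hx₁.2
      linarith
    refine ⟨|f y - ε - f x₂| / latticeDist (x₁ - y), by positivity, fun x hx => ?_⟩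
    have h1 : latticeDist (x₁ - y) ≤ latticeDist (x - y) := hmin hx
    have h2 : f x₂ ≤ f x := hmin' hx
    have h3 : |f y - ε - f x₂| ≤ |f y - ε - f x₂| / latticeDist (x₁ - y) * latticeDist (x - y) := by
      rw [div_mul_eq_mul_div, le_div_iff₀ hpos]
      gcongr
    linarith [le_abs_self (f y - ε - f x₂)]
  have hβper : ZPeriodic fun x => f y - ε - C * latticeDist (x - y) := fun x z => by
    have := zPeriodic_latticeDist (x - y) z
    rw [sub_add_eq_add_sub] at this
    simp only [this]
  refine ⟨fun x => f y - ε - C * latticeDist (x - y),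
    contDiff_const.sub (contDiff_const.mul (contDiff_latticeDist.comp
      (contDiff_id.sub contDiff_const))), hβper, fun x => ?_, ?_⟩
  · obtain ⟨z, hz⟩ := exists_integer_translate_norm_le x
    have h1 := hβper x z
    refine h1.symm.trans_le ?_
    simp only
    rw [← hper x z]
    by_cases h : f (x + WithLp.toLp 2 fun i => (z i : ℝ)) ≤ f y - ε
    · exact hCK _ ⟨by simpa using hz, h⟩
    · have := mul_nonneg hC (latticeDist_nonneg (x + WithLp.toLp 2 (fun i => (z i : ℝ)) - y))
      linarith
  · simp [latticeDist]

/-- Lower barriers attaining the initial value at a point up to `ε`. -/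
theorem exists_lower_barrier (hα₀ : 0 < α) (hα₁ : α < 1)
    (hHper : ∀ t ∈ Icc 0 T, ∀ (r : ℝ) (p : 𝔼 d), ZPeriodic (fun x => H t x r p))
    (hHc : ContinuousOn (fun q : ℝ × 𝔼 d × ℝ × 𝔼 d => H q.1 q.2.1 q.2.2.1 q.2.2.2)
      (Icc 0 T ×ˢ univ))
    (hHm : ∀ t ∈ Icc 0 T, ∀ x p : 𝔼 d, Monotone fun r => H t x r p)
    {f : 𝔼 d → ℝ} (hf : Continuous f) (hper : ZPeriodic f) (y : 𝔼 d) {ε : ℝ} (hε : 0 < ε) :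
    ∃ w : ℝ → 𝔼 d → ℝ, IsViscositySubsolution α T H w ∧
      (Continuous fun q : ℝ × 𝔼 d => w q.1 q.2) ∧ (∀ x, w 0 x ≤ f x) ∧ w 0 y = f y - ε := by
  obtain ⟨β, hβ, hβper, hβf, hβy⟩ := exists_contDiff_periodic_le hf hper y hε
  obtain ⟨K, -, hK⟩ := exists_caputoSubsolution_of_contDiff hα₀ hα₁ hHper hHc hHm hβ hβper
  have hc : Continuous fun q : ℝ × 𝔼 d => β q.2 - K * q.1 ^ α :=
    (hβ.continuous.comp continuous_snd).sub
      (continuous_const.mul (continuous_fst.rpow_const fun _ => Or.inr hα₀.le))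
  refine ⟨fun t x => β x - K * t ^ α, hK.isViscositySubsolution hα₀ hα₁ (fun t _ x z => ?_)
    hc.continuousOn.upperSemicontinuousOn, hc, fun x => ?_, ?_⟩
  · simp only [hβper x z]
  · simpa [Real.zero_rpow hα₀.ne'] using hβf x
  · simpa [Real.zero_rpow hα₀.ne'] using hβy

end

/-! ### Perron's method and conclusion -/

section
variable {d : ℕ}
local notation:max "𝔼" d:max => EuclideanSpace ℝ (Fin d)
variable {α T : ℝ} {H : ℝ → 𝔼 d → ℝ → 𝔼 d → ℝ} {U V w : ℝ → 𝔼 d → ℝ}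

theorem IsTestFunction.comp_add_right {φ : ℝ → 𝔼 d → ℝ} (hφ : IsTestFunction T φ) (v : 𝔼 d) :
    IsTestFunction T fun t x => φ t (x + v) := by
  have hg : ContDiff ℝ 1 fun q : ℝ × 𝔼 d => (q.1, q.2 + v) :=
    contDiff_fst.prodMk (contDiff_snd.add contDiff_const)
  exact ⟨hφ.1.comp (f := fun q : ℝ × 𝔼 d => (q.1, q.2 + v)) hg.continuous.continuousOn
      fun q hq => ⟨hq.1, mem_univ _⟩,
    hφ.2.1.comp (f := fun q : ℝ × 𝔼 d => (q.1, q.2 + v)) hg.contDiffOn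
      fun q hq => ⟨hq.1, mem_univ _⟩, fun x => hφ.2.2 (x + v)⟩

theorem CaputoSubsolution.comp_add_right
    (hHper : ∀ t ∈ Icc 0 T, ∀ (r : ℝ) (p : 𝔼 d), ZPeriodic (fun x => H t x r p))
    (hw : CaputoSubsolution α T H w) (z : Fin d → ℤ) :
    CaputoSubsolution α T H fun t x => w t (x + WithLp.toLp 2 (fun i => (z i : ℝ))) := by
  intro a b ha hab hb c ρ hρ φ hφ t ht x hx hmax
  set v : 𝔼 d := WithLp.toLp 2 (fun i => (z i : ℝ)) with hv
  have h := hw a b ha hab hb (c + v) ρ hρ _ (hφ.comp_add_right (-v)) t ht (x + v)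
    (by simpa using hx) fun s hs y hy => by
      have h1 := hmax s hs (y + -v) (by
        rw [Metric.mem_closedBall, dist_eq_norm] at hy ⊢
        rwa [show y + -v - c = y - (c + v) by abel])
      simp only [neg_add_cancel_right] at h1
      simp only [add_neg_cancel_right]
      exact h1
  have hg : gradient (fun y => φ t (y + -v)) (x + v) = gradient (φ t) x := by
    rw [gradient_comp_add_right, add_neg_cancel_right]
  have hH := hHper t ⟨(ha.trans_lt ht.1).le, ht.2.trans hb⟩ (w t (x + v)) (gradient (φ t) x) x z
  rw [hg] at h
  simp only at hH
  rw [← hv] at hH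
  rwa [hH] at h

/-- Outside [0,T] the filter is trivial, every real is admissible, and `sInf` takes its default
value 0. This allows envelopes to be identified for all times. -/
theorem upperEnvelope_of_notMem (F : Set (ℝ → 𝔼 d → ℝ)) {t : ℝ} (ht : t ∉ Icc 0 T) (x : 𝔼 d) :
    upperEnvelope T F t x = 0 := by
  have h : 𝓝[Icc 0 T ×ˢ univ] (t, x) = ⊥ := by
    rw [← notMem_closure_iff_nhdsWithin_eq_bot, (isClosed_Icc.prod isClosed_univ).closure_eq]
    exact fun h => ht h.1
  simp [upperEnvelope, h]

theorem UpperSemicontinuousOn.comp_add_right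
    (hw : UpperSemicontinuousOn (fun q : ℝ × 𝔼 d => w q.1 q.2) (Icc 0 T ×ˢ univ)) (v : 𝔼 d) :
    UpperSemicontinuousOn (fun q : ℝ × 𝔼 d => w q.1 (q.2 + v)) (Icc 0 T ×ˢ univ) :=
  hw.comp (g := fun q : ℝ × 𝔼 d => (q.1, q.2 + v)) (by fun_prop) fun q hq => ⟨hq.1, mem_univ _⟩

/-- The assumptions on the Hamiltonian. -/
structure IsAdmissibleHamiltonian (T : ℝ) (H : ℝ → 𝔼 d → ℝ → 𝔼 d → ℝ) : Prop where
  periodic : ∀ t ∈ Icc 0 T, ∀ (r : ℝ) (p : 𝔼 d), ZPeriodic (fun x => H t x r p)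
  continuousOn : ContinuousOn (fun q : ℝ × 𝔼 d × ℝ × 𝔼 d => H q.1 q.2.1 q.2.2.1 q.2.2.2)
    (Icc 0 T ×ˢ univ)
  modulus : ∃ ω : ℝ → ℝ, IsModulus ω ∧ ∀ t ∈ Icc 0 T, ∀ (x y : 𝔼 d) (r : ℝ) (p : 𝔼 d),
    |H t x r p - H t y r p| ≤ ω (‖x - y‖ * (1 + ‖p‖))
  monotone : ∀ t ∈ Icc 0 T, ∀ x p : 𝔼 d, Monotone fun r => H t x r p

theorem IsAdmissibleHamiltonian.dual (hH : IsAdmissibleHamiltonian T H) :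
    IsAdmissibleHamiltonian T (dualHamiltonian H) where
  periodic t ht r p x z := by
    have := hH.periodic t ht (-r) (-p) x z
    simp only at this
    simp only [dualHamiltonian, this]
  continuousOn := (hH.continuousOn.comp (t := Icc 0 T ×ˢ univ)
    (f := fun q : ℝ × 𝔼 d × ℝ × 𝔼 d => (q.1, q.2.1, -q.2.2.1, -q.2.2.2)) (by fun_prop)
    fun q hq => ⟨hq.1, mem_univ _⟩).neg
  modulus := by
    obtain ⟨ω, hω, h⟩ := hH.modulus
    refine ⟨ω, hω, fun t ht x y r p => ?_⟩
    have := h t ht x y (-r) (-p)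
    rw [norm_neg] at this
    rwa [dualHamiltonian, dualHamiltonian, neg_sub_neg, abs_sub_comm]
  monotone t ht x p r s hrs := neg_le_neg (hH.monotone t ht x (-p) (neg_le_neg hrs))

theorem IsAdmissibleHamiltonian.comparison (hα₀ : 0 < α) (hα₁ : α < 1) (hT : 0 < T)
    (hH : IsAdmissibleHamiltonian T H) (hU : IsViscositySubsolution α T H U)
    (hV : IsViscositySupersolution α T H V) (h0 : ∀ x, U 0 x ≤ V 0 x) :
    ∀ t ∈ Icc 0 T, ∀ x, U t x ≤ V t x :=
  comparison_of_initial_le hα₀ hα₁ hT hH.continuousOn hH.modulus hH.monotone hU hV h0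

/-- Upper barriers attaining the initial value at a point up to `ε`. -/
theorem IsAdmissibleHamiltonian.exists_upper_barrier (hα₀ : 0 < α) (hα₁ : α < 1)
    (hH : IsAdmissibleHamiltonian T H) {f : 𝔼 d → ℝ} (hf : Continuous f) (hper : ZPeriodic f)
    (y : 𝔼 d) {ε : ℝ} (hε : 0 < ε) :
    ∃ w : ℝ → 𝔼 d → ℝ, IsViscositySupersolution α T H w ∧
      (Continuous fun q : ℝ × 𝔼 d => w q.1 q.2) ∧ (∀ x, f x ≤ w 0 x) ∧ w 0 y = f y + ε := by
  obtain ⟨w, h1, h2, h3, h4⟩ := exists_lower_barrier hα₀ hα₁ hH.dual.periodic hH.dual.continuousOn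
    hH.dual.monotone (f := fun x => -f x) hf.neg (fun x z => by simp only [hper x z]) y hε
  refine ⟨fun t x => -w t x, isViscositySubsolution_neg_iff.1 (by simpa only [neg_neg] using h1),
    h2.neg, fun x => le_neg_of_le_neg (h3 x), ?_⟩
  simp only [h4]
  ring

/-- The family of subsolutions in Perron's method. -/
def perronFamily (α T : ℝ) (H : ℝ → 𝔼 d → ℝ → 𝔼 d → ℝ) (f : 𝔼 d → ℝ) : Set (ℝ → 𝔼 d → ℝ) :=
  {w | IsViscositySubsolution α T H w ∧ ∀ x, w 0 x ≤ f x}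

/-- A subsolution, larger than a periodic one and equal to it for small times, lies below a
periodic subsolution with the same initial values. -/
theorem exists_periodic_majorant (hα₀ : 0 < α) (hα₁ : α < 1) (hT : 0 < T)
    (hH : IsAdmissibleHamiltonian T H) (hU : IsViscositySubsolution α T H U)
    (hw : CaputoSubsolution α T H w)
    (hwusc : UpperSemicontinuousOn (fun q : ℝ × 𝔼 d => w q.1 q.2) (Icc 0 T ×ˢ univ))
    {M κ : ℝ} (hM : ∀ t ∈ Icc 0 T, ∀ x, w t x ≤ M) (hκ : 0 < κ)
    (hwU : ∀ t < κ, ∀ x, w t x = U t x) :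
    ∃ W, IsViscositySubsolution α T H W ∧ (∀ x, W 0 x ≤ U 0 x) ∧
      ∀ t ∈ Icc 0 T, ∀ x, w t x ≤ W t x := by
  set F : Set (ℝ → 𝔼 d → ℝ) := range fun (z : Fin d → ℤ) =>
    fun t x => w t (x + WithLp.toLp 2 (fun i => (z i : ℝ))) with hF
  have hne : F.Nonempty := range_nonempty _
  have hFM : ∀ v ∈ F, ∀ t ∈ Icc 0 T, ∀ x, v t x ≤ M := by
    rintro _ ⟨z, rfl⟩ t ht x
    exact hM t ht _
  have hT0 : (0 : ℝ) ∈ Icc 0 T := ⟨le_rfl, hT.le⟩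
  refine ⟨upperEnvelope T F, CaputoSubsolution.isViscositySubsolution hα₀ hα₁
    (caputoSubsolution_upperEnvelope hα₀ hα₁ hH.continuousOn hne hFM ?_ ?_)
    (zPeriodic_upperEnvelope hne hFM ?_) (upperSemicontinuousOn_upperEnvelope hne hFM),
    fun x => ?_, fun t ht x => ?_⟩
  · rintro _ ⟨z, rfl⟩
    exact hwusc.comp_add_right _
  · rintro _ ⟨z, rfl⟩
    exact hw.comp_add_right hH.periodic z
  · rintro _ ⟨z, rfl⟩ z'
    refine ⟨_, ⟨fun i => z' i + z i, rfl⟩, fun t _ x => ?_⟩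
    simp only
    congr 1
    ext i
    simp [add_assoc]
  -- Near time 0 every translate of w agrees with a translate of U, that is, with U itself, which is
  -- upper semicontinuous.
  · by_contra hlt
    obtain ⟨c, hc1, hc2⟩ := exists_between (not_le.1 hlt)
    have h1 := frequently_of_lt_upperEnvelope hne hT0 hc2
    have h2 := hU.2.1 (0, x) ⟨hT0, mem_univ _⟩ c hc1
    have h3 : ∀ᶠ q in 𝓝[Icc 0 T ×ˢ univ] ((0 : ℝ), x), q.1 < κ :=
      nhdsWithin_le_nhds (continuous_fst.tendsto _ |>.eventually_lt_const hκ)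
    obtain ⟨q, ⟨⟨_, ⟨z, rfl⟩, h4⟩, h5, h6⟩, h7⟩ :=
      ((h1.and_eventually (h2.and h3)).and_eventually self_mem_nhdsWithin).exists
    simp only at h4 h5
    rw [hwU _ h6, hU.1 _ h7.1 q.2 z] at h4
    linarith
  · have h1 : (fun t x => w t (x + WithLp.toLp 2 (fun i => (((0 : Fin d → ℤ) i : ℤ) : ℝ)))) ∈ F :=
      ⟨0, rfl⟩
    have h2 := le_upperEnvelope hFM h1 ht x
    have h3 : (WithLp.toLp 2 (fun i => (((0 : Fin d → ℤ) i : ℤ) : ℝ)) : 𝔼 d) = 0 := by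
      ext i; simp
    rwa [h3, add_zero] at h2

theorem IsAdmissibleHamiltonian.exists_solution (hα₀ : 0 < α) (hα₁ : α < 1) (hT : 0 < T)
    (hH : IsAdmissibleHamiltonian T H) {f : 𝔼 d → ℝ} (hf : Continuous f) (hper : ZPeriodic f) :
    ∃ u, IsViscositySolutionIVP α T H f u := by
  set S := perronFamily α T H f with hS
  have hT0 : (0 : ℝ) ∈ Icc 0 T := ⟨le_rfl, hT.le⟩
  have hlower := fun (y : 𝔼 d) (ε : ℝ) (hε : 0 < ε) => exists_lower_barrier hα₀ hα₁ hH.periodic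
    hH.continuousOn hH.monotone hf hper y hε
  have hupper := fun (y : 𝔼 d) (ε : ℝ) (hε : 0 < ε) => hH.exists_upper_barrier hα₀ hα₁ hf hper y hε
  obtain ⟨b₁, hb₁, hb₁c, hb₁f, -⟩ := hlower 0 1 one_pos
  obtain ⟨b₂, hb₂, hb₂c, hb₂f, -⟩ := hupper 0 1 one_pos
  have hSne : S.Nonempty := ⟨b₁, hb₁, hb₁f⟩
  have hSle : ∀ v, IsViscositySupersolution α T H v → (∀ x, f x ≤ v 0 x) →
      ∀ w ∈ S, ∀ t ∈ Icc 0 T, ∀ x, w t x ≤ v t x := fun v hv hfv w hw =>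
    hH.comparison hα₀ hα₁ hT hw.1 hv fun x => (hw.2 x).trans (hfv x)
  obtain ⟨M₂, hM₂⟩ := UpperSemicontinuousOn.exists_bound_of_periodic
    hb₂c.continuousOn.upperSemicontinuousOn hb₂.1
  obtain ⟨M₁, hM₁⟩ := UpperSemicontinuousOn.exists_bound_of_periodic (T := T)
    (u := fun t x => -b₁ t x) hb₁c.neg.continuousOn.upperSemicontinuousOn
    fun t ht x z => by simp only [hb₁.1 t ht x z]
  have hSM : ∀ w ∈ S, ∀ t ∈ Icc 0 T, ∀ x, w t x ≤ M₂ := fun w hw t ht x =>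
    (hSle b₂ hb₂ hb₂f w hw t ht x).trans (hM₂ t ht x)
  set U := upperEnvelope T S with hUdef
  have hUusc := upperSemicontinuousOn_upperEnvelope hSne hSM
  have hUcap : CaputoSubsolution α T H U := caputoSubsolution_upperEnvelope hα₀ hα₁ hH.continuousOn
    hSne hSM (fun w hw => hw.1.2.1) fun w hw => hw.1.caputoSubsolution hα₀ hα₁
  have hUsub : IsViscositySubsolution α T H U := hUcap.isViscositySubsolution hα₀ hα₁
    (zPeriodic_upperEnvelope hSne hSM fun w hw z => ⟨w, hw, fun t ht x => hw.1.1 t ht x z⟩) hUusc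
  -- Upper barriers dominate the whole family by comparison, are continuous, and meet f at x up to
  -- ε.
  have hU0 : ∀ x, U 0 x ≤ f x := fun x => le_of_forall_pos_le_add fun ε hε => by
    obtain ⟨v, hv, hvc, hfv, hvx⟩ := hupper x ε hε
    rw [← hvx]
    exact upperEnvelope_le (g := v) hSne hvc.continuousOn.upperSemicontinuousOn (hSle v hv hfv) hT0 x
  have hUge : ∀ w ∈ S, ∀ t ∈ Icc 0 T, ∀ x, w t x ≤ U t x := fun w hw t ht x =>
    le_upperEnvelope hSM hw ht x
  have hUB : ∀ t ∈ Icc 0 T, ∀ x, |U t x| ≤ max M₁ M₂ := fun t ht x => by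
    rw [abs_le]
    have h1 := hUge b₁ ⟨hb₁, hb₁f⟩ t ht x
    have h2 := hM₁ t ht x
    have h3 : U t x ≤ M₂ :=
      upperEnvelope_le (g := fun _ _ => M₂) hSne upperSemicontinuousOn_const hSM ht x
    exact ⟨by linarith [le_max_left M₁ M₂], h3.trans (le_max_right _ _)⟩
  set V := upperEnvelope T {fun t x => -U t x} with hVdef
  have hne : ({fun t x => -U t x} : Set (ℝ → 𝔼 d → ℝ)).Nonempty := singleton_nonempty _
  have hVM : ∀ w ∈ ({fun t x => -U t x} : Set (ℝ → 𝔼 d → ℝ)), ∀ t ∈ Icc 0 T, ∀ x,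
      w t x ≤ max M₁ M₂ := by
    rintro w rfl t ht x
    linarith [neg_le_of_abs_le (hUB t ht x)]
  -- A bumped function exceeds U somewhere, yet its periodic majorant belongs to the family and so
  -- lies below U.
  have hVcap : CaputoSubsolution α T (dualHamiltonian H) V := by
    by_contra hnot
    obtain ⟨w, hw, hwusc, ⟨M, hM⟩, -, ⟨κ, hκ, hwU⟩, t, ht, x, hlt⟩ :=
      exists_larger_subsolution hα₀ hα₁ hH.continuousOn hH.monotone hUcap hUusc hUB hnot
    obtain ⟨W, hW, hW0, hwW⟩ := exists_periodic_majorant hα₀ hα₁ hT hH hUsub hw hwusc hM hκ hwU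
    have h1 := hUge W ⟨hW, fun x => (hW0 x).trans (hU0 x)⟩ t ht x
    have h2 := hwW t ht x
    linarith
  have hVusc := upperSemicontinuousOn_upperEnvelope hne hVM
  have hVsub : IsViscositySubsolution α T (dualHamiltonian H) V :=
    hVcap.isViscositySubsolution hα₀ hα₁ (zPeriodic_upperEnvelope hne hVM (by
      rintro w rfl z
      exact ⟨_, rfl, fun t ht x => by simp only [hUsub.1 t ht x z]⟩)) hVusc
  have hL : IsViscositySupersolution α T H fun t x => -V t x :=
    isViscositySubsolution_neg_iff.1 (by simpa only [neg_neg] using hVsub)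
  have hV0 : ∀ x, f x ≤ -V 0 x := fun x => le_of_forall_pos_le_add fun ε hε => by
    obtain ⟨v, hv, hvc, hfv, hvx⟩ := hlower x ε hε
    have h1 : V 0 x ≤ -v 0 x :=
      upperEnvelope_le (g := fun t x => -v t x) hne hvc.neg.continuousOn.upperSemicontinuousOn
        (by
          rintro w rfl t ht x
          exact neg_le_neg (hUge v ⟨hv, hfv⟩ t ht x)) hT0 x
    linarith
  have hle := hH.comparison hα₀ hα₁ hT hUsub hL fun x => (hU0 x).trans (hV0 x)
  -- -V ≤ U holds by construction and U ≤ -V by comparison; equality supplies the missing lower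
  -- semicontinuity.
  have heq : (fun t x => -V t x) = U := by
    funext t x
    by_cases ht : t ∈ Icc 0 T
    · have h1 : -U t x ≤ V t x := le_upperEnvelope hVM (mem_singleton _) ht x
      have h2 := hle t ht x
      linarith
    · rw [hVdef, hUdef, upperEnvelope_of_notMem _ ht, upperEnvelope_of_notMem _ ht, neg_zero]
  rw [heq] at hL
  refine ⟨U, continuousOn_iff_lower_upperSemicontinuousOn.2 ⟨hL.2.1, hUusc⟩, hUsub, hL,
    fun x => le_antisymm (hU0 x) ?_⟩
  rw [← heq]
  exact hV0 x

end

theorem mainTheorem5 (d : ℕ) (α T : ℝ) (hα₀ : 0 < α) (hα₁ : α < 1) (hT : 0 < T)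
    (H : ℝ → EuclideanSpace ℝ (Fin d) → ℝ → EuclideanSpace ℝ (Fin d) → ℝ)
    (u₀ : EuclideanSpace ℝ (Fin d) → ℝ)
    (hHper : ∀ t ∈ Icc 0 T, ∀ (r : ℝ) (p : EuclideanSpace ℝ (Fin d)),
      ZPeriodic (fun x => H t x r p))
    (hA1 : ContinuousOn
      (fun q : ℝ × EuclideanSpace ℝ (Fin d) × ℝ × EuclideanSpace ℝ (Fin d) =>
        H q.1 q.2.1 q.2.2.1 q.2.2.2) (Icc 0 T ×ˢ univ))
    (hA2 : ∃ ω : ℝ → ℝ, IsModulus ω ∧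
      ∀ t ∈ Icc 0 T, ∀ (x y : EuclideanSpace ℝ (Fin d)) (r : ℝ) (p : EuclideanSpace ℝ (Fin d)),
        |H t x r p - H t y r p| ≤ ω (‖x - y‖ * (1 + ‖p‖)))
    (hA3 : ∀ t ∈ Icc 0 T, ∀ (x p : EuclideanSpace ℝ (Fin d)), Monotone (fun r => H t x r p))
    (hu₀per : ZPeriodic u₀) (hA4 : Continuous u₀) :
    (∃ u : ℝ → EuclideanSpace ℝ (Fin d) → ℝ, IsViscositySolutionIVP α T H u₀ u) ∧
    ∀ u v : ℝ → EuclideanSpace ℝ (Fin d) → ℝ,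
      IsViscositySolutionIVP α T H u₀ u → IsViscositySolutionIVP α T H u₀ v →
        ∀ t ∈ Icc 0 T, ∀ x, u t x = v t x := by
  have hH : IsAdmissibleHamiltonian T H := ⟨hHper, hA1, hA2, hA3⟩
  refine ⟨hH.exists_solution hα₀ hα₁ hT hA4 hu₀per, fun u v hu hv t ht x => le_antisymm ?_ ?_⟩
  · exact hH.comparison hα₀ hα₁ hT hu.2.1 hv.2.2.1
      (fun x => by rw [hu.2.2.2 x, hv.2.2.2 x]) t ht x
  · exact hH.comparison hα₀ hα₁ hT hv.2.1 hu.2.2.1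
      (fun x => by rw [hu.2.2.2 x, hv.2.2.2 x]) t ht x
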